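/- Let $M$ be a smooth manifold and let $(\mathcal A,\wedge,d)$ be its real de Rham algebra. A commutative $\mathrm{BV}_\infty$-algebra is a tuple $(A,\wedge,d=\Delta_0,\Delta_1,\Delta_2,\dots)$ such that $(A,\wedge,d)$ is a commutative dg-algebra, $\Delta_n$ has degree $1-2n$ and algebraic order at most $n+1$, and $\sum_{i=0}^n\Delta_i\Delta_{n-i}=0$ for all $n\ge 0$. Brackets are graded commutators. Let $\omega$ be an almost symplectic form on $M$ (a nondegenerate $2$-form), $\dim M=2n$, and let $L=\omega\wedge\cdot$, so that $[d,L]=d\omega\wedge\cdot$. Let $\omega^{-1}$ be the bilinear form on covectors whose matrix is the inverse of the matrix of $\omega$, and extend it to forms by $\langle a_1\wedge\dots\wedge a_k,b_1\wedge\dots\wedge b_k\rangle_\omega=\det(\omega^{-1}(a_i,b_j))$. Let $\star_\omega$ be the symplectic star operator, $\alpha\wedge\star_\omega\beta=\langle\alpha,\beta\rangle_\omega\,\omega^n/n!$, let $\varphi^\omega$ be the pointwise symplectic adjoint of a bundle endomorphism $\varphi$, $\langle\varphi\alpha,\beta\rangle_\omega=\langle\alpha,\varphi^\omega\beta\rangle_\omega$,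 let $\Lambda=L^\omega$, and let $d^\omega=(-1)^k\star_\omega d\,\star_\omega$ on $\mathcal A^k$. To the almost symplectic manifold $(M,\omega)$ one associates the tuple $$(\mathcal A,\wedge,d,\ \Delta_1=d^\omega+[\Lambda,[d,L]]^\omega,\ \Delta_2=-[d,L]^\omega).\qquad(1)$$ Suppose moreover that $(M,g,J,\omega)$ is almost Hermitian, i.e. $J$ is an almost complex structure and $g(X,Y)=\omega(X,JY)$ is a Riemannian metric. Let $J$ act on forms by $(J\alpha)(X_1,\dots,X_k)=\alpha(JX_1,\dots,JX_k)$, let $\star$ be the Hodge star of $g$ with volume form $\omega^n/n!$, and let ${}^*$ be the pointwise metric adjoint of bundle endomorphisms; $L^*$ is again denoted $\Lambda$. Put $d_c=J^{-1}dJ$, $d_c^*=-\star d_c\star$, $T=[\Lambda,d\omega\wedge\cdot]$, $T_c=J^{-1}TJ$ and $d\omega_c=J^{-1}(d\omega\wedge\cdot)J$. To the almost Hermitian manifold one associates the tuple $$(\mathcal A,\wedge,d,\ \Delta_1=-(d_c^*+T_c^*),\ \Delta_2=d\omega_c^*).\qquad(2)$$ Then, for every almost Hermitian manifold: (a) $d_c^*=-d^\omega$,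 $\ d\omega_c^*=-[d,L]^\omega$, $\ T_c^*=-[\Lambda,[d,L]]^\omega$ (where $[d,L]=d\omega\wedge\cdot$). (b) The tuples (1) and (2) (with $\Delta_n=0$ for $n\ge3$) are commutative $\mathrm{BV}_\infty$-algebras and they coincide. In particular (2) depends only on $\omega$: two almost Hermitian structures on $M$ with the same form $\omega$ give the same operators. (c) In the almost Kähler case $d\omega=0$, the commutative $\mathrm{BV}_\infty$-algebra (2) is $(\mathcal A,\wedge,d,\Delta_1=d^\omega,\Delta_2=0)$, which is Koszul's $\mathrm{BV}$-algebra $(\mathcal A,\wedge,d,\Delta=[i_\pi,d])$ of the Poisson bivector field $\pi=\omega^{-1}$, where $i_\pi=\tfrac12\sum_{i,j}\omega^{-1}(e^i,e^j)\,\iota_{e_i}\iota_{e_j}$ for a local frame $(e_i)$ with dual coframe $(e^i)$. -/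

import Mathlib

open scoped Manifold ContDiff ExteriorAlgebra
open Bundle

noncomputable section

/-! ### The exterior algebra of a cotangent space -/

/-- The exterior algebra `⋀ E*`.  As `TangentSpace 𝓘(ℝ, E) x` is by definition the vector space `E`
(through the preferred chart at `x`), this is the fibre `⋀ T*ₓM` at any point `x` of a manifold
modelled on `E`. -/
abbrev FormFibre (E : Type*) [NormedAddCommGroup E] [NormedSpace ℝ E] : Type _ :=
  ExteriorAlgebra ℝ (Module.Dual ℝ E)

namespace FormFibre

variable {E : Type*} [NormedAddCommGroup E] [NormedSpace ℝ E] [FiniteDimensional ℝ E]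

instance finite : Module.Finite ℝ (FormFibre E) :=
  Module.Finite.of_basis (Module.finBasis ℝ (Module.Dual ℝ E)).ExteriorAlgebra

/-- Some norm on the finite-dimensional space `⋀ E*`; it is used only to speak of smooth functions
with values in this space, a notion that does not depend on the choice of the norm. -/
instance normedAddCommGroup : NormedAddCommGroup (FormFibre E) :=
  NormedAddCommGroup.induced (FormFibre E)
    (Fin (Module.finrank ℝ (FormFibre E)) → ℝ)
    (Module.finBasis ℝ (FormFibre E)).equivFun.toLinearMap
    (Module.finBasis ℝ (FormFibre E)).equivFun.injective

instance normedSpace : NormedSpace ℝ (FormFibre E) :=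
  NormedSpace.induced ℝ (FormFibre E)
    (Fin (Module.finrank ℝ (FormFibre E)) → ℝ)
    (Module.finBasis ℝ (FormFibre E)).equivFun.toLinearMap

/-- The `k`-th exterior power inside `⋀ E*`; it is zero for `k < 0`. -/
def deg : ℤ → Submodule ℝ (FormFibre E)
  | Int.ofNat k => ⋀[ℝ]^k (Module.Dual ℝ E)
  | Int.negSucc _ => ⊥

/-- Pullback of covectors along a linear map `A`, `(A^* α)(v₁, …, vₖ) = α(A v₁, …, A vₖ)`. -/
def pullback (A : E →ₗ[ℝ] E) : FormFibre E →ₐ[ℝ] FormFibre E :=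
  ExteriorAlgebra.map A.dualMap

/-- The operator `(-1)^k` on `⋀ᵏ E*`. -/
def parity : FormFibre E →ₐ[ℝ] FormFibre E :=
  ExteriorAlgebra.map (-LinearMap.id)

/-- Interior product (contraction) with a vector `v`. -/
def interior (v : E) : FormFibre E →ₗ[ℝ] FormFibre E :=
  CliffordAlgebra.contractLeft (Module.Dual.eval ℝ E v)

/-- `v ↦ σ(v, ·)` for a `2`-form `σ`. -/
def flat (σ : FormFibre E) : E →ₗ[ℝ] Module.Dual ℝ E where
  toFun v := ExteriorAlgebra.ιInv (interior v σ)
  map_add' v w := by simp [interior]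
  map_smul' c v := by simp [interior]

/-- The bilinear form on covectors that is inverse to a nondegenerate bilinear form on vectors
given by `F v = B(v, ·)`: it sends `(B(v, ·), b)` to `b v`, so that its matrix in a dual basis is
the inverse of the matrix `B(eᵢ, eⱼ)`. -/
def inverseForm (F : E ≃ₗ[ℝ] Module.Dual ℝ E) :
    Module.Dual ℝ E →ₗ[ℝ] Module.Dual ℝ (Module.Dual ℝ E) :=
  Module.Dual.eval ℝ E ∘ₗ F.symm.toLinearMap

/-- The extension of a bilinear form `c` on covectors to `⋀ E*`: on `⋀ᵏ E*` it is
`⟨a₁ ∧ … ∧ aₖ, b₁ ∧ … ∧ bₖ⟩ = det (c(aᵢ, bⱼ))`, and different degrees are orthogonal. -/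
def pairing (c : Module.Dual ℝ E →ₗ[ℝ] Module.Dual ℝ (Module.Dual ℝ E))
    (α β : FormFibre E) : ℝ :=
  ∑ k ∈ Finset.range (Module.finrank ℝ E + 1),
    exteriorPower.pairingDual ℝ (Module.Dual ℝ E) k
      (exteriorPower.map k c (DirectSum.decompose (fun i : ℕ => ⋀[ℝ]^i (Module.Dual ℝ E)) α k))
      (DirectSum.decompose (fun i : ℕ => ⋀[ℝ]^i (Module.Dual ℝ E)) β k)

/-- The adjoint of a linear operator `φ` for the pairing extending `c`, that is, the operator `ψ`
with `⟨φ α, β⟩ = ⟨α, ψ β⟩` (there is exactly one if `c` is nondegenerate). -/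
def adjoint (c : Module.Dual ℝ E →ₗ[ℝ] Module.Dual ℝ (Module.Dual ℝ E))
    (φ : Module.End ℝ (FormFibre E)) : Module.End ℝ (FormFibre E) :=
  Classical.epsilon fun ψ => ∀ α β, pairing c (φ α) β = pairing c α (ψ β)

/-- The star operator of the pairing extending `c` and the volume element `vol`, that is, the
operator `s : ⋀ᵏ E* → ⋀ᵐ⁻ᵏ E*`, `m = dim E`, with `α ∧ s β = ⟨α, β⟩ vol` (there is exactly one
if `c` is nondegenerate and `vol` is a nonzero element of top degree). -/
def star (c : Module.Dual ℝ E →ₗ[ℝ] Module.Dual ℝ (Module.Dual ℝ E)) (vol : FormFibre E) :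
    Module.End ℝ (FormFibre E) :=
  Classical.epsilon fun s => ∀ k ≤ Module.finrank ℝ E, ∀ β ∈ ⋀[ℝ]^k (Module.Dual ℝ E),
    s β ∈ ⋀[ℝ]^(Module.finrank ℝ E - k) (Module.Dual ℝ E) ∧
    ∀ α ∈ ⋀[ℝ]^k (Module.Dual ℝ E), α * s β = pairing c α β • vol

end FormFibre

/-! ### Differential forms on a manifold -/

section Forms

variable (E : Type*) [NormedAddCommGroup E] [NormedSpace ℝ E] [FiniteDimensional ℝ E]
  (M : Type*) [TopologicalSpace M] [ChartedSpace E M]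

/-- Sections of `⋀ T*M`, not necessarily smooth, with the pointwise wedge product. -/
abbrev FormSection : Type _ := M → FormFibre E

variable {E M}

/-- The pullback of a section of `⋀ T*M` along the inverse of the preferred chart `φₓ` at `x`. As the
tangent space at `p = φₓ⁻¹(y)` is identified with `E` through the preferred chart `φₚ` at `p`, the
derivative of `φₓ⁻¹` at `y` is the derivative of `φₚ ∘ φₓ⁻¹` at `y`. -/
def FormSection.inChart (x : M) (α : FormSection E M) : E → FormFibre E := fun y =>
  FormFibre.pullback
    (fderiv ℝ (extChartAt 𝓘(ℝ, E) ((extChartAt 𝓘(ℝ, E) x).symm y) ∘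
      (extChartAt 𝓘(ℝ, E) x).symm) y).toLinearMap
    (α ((extChartAt 𝓘(ℝ, E) x).symm y))

/-- A differential form (of possibly mixed degree): a section that is smooth in the charts. -/
def FormSection.IsSmooth (α : FormSection E M) : Prop :=
  ∀ x : M, ContDiffOn ℝ ∞ (α.inChart x) (extChartAt 𝓘(ℝ, E) x).target

/-- The exterior derivative, `dα = ∑ᵢ eⁱ ∧ ∂ᵢα` in the chart at the point in question. -/
def FormSection.d (α : FormSection E M) : FormSection E M := fun x =>
  ∑ i, ExteriorAlgebra.ι ℝ ((Module.finBasis ℝ E).coord i) *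
    fderiv ℝ (α.inChart x) (extChartAt 𝓘(ℝ, E) x x) (Module.finBasis ℝ E i)

variable (E M) in
/-- The de Rham algebra: smooth sections of `⋀ T*M` with the wedge product. -/
def DeRham : Subalgebra ℝ (FormSection E M) where
  carrier := {α | α.IsSmooth}
  mul_mem' {α β} hα hβ x := by
    have h : FormSection.inChart x (α * β) = fun y => α.inChart x y * β.inChart x y := by
      funext y; simp [FormSection.inChart]
    rw [h]
    exact ((LinearMap.toContinuousLinearMap
      ((LinearMap.toContinuousLinearMap : (FormFibre E →ₗ[ℝ] FormFibre E) ≃ₗ[ℝ] _).toLinearMap ∘ₗ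
        LinearMap.mul ℝ (FormFibre E))).contDiff.comp_contDiffOn (hα x)).clm_apply (hβ x)
  add_mem' {α β} hα hβ x := by
    have h : FormSection.inChart x (α + β) = fun y => α.inChart x y + β.inChart x y := by
      funext y; simp [FormSection.inChart]
    rw [h]
    exact (hα x).add (hβ x)
  algebraMap_mem' r x := by
    have h : FormSection.inChart x (algebraMap ℝ (FormSection E M) r) =
        fun _ => algebraMap ℝ (FormFibre E) r := by
      funext y; simp [FormSection.inChart]
    rw [h]
    exact contDiffOn_const

variable (E M) in
/-- The `k`-forms inside the de Rham algebra. -/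
def DeRham.deg (k : ℤ) : Submodule ℝ (DeRham E M) where
  carrier := {α | ∀ x, (α : FormSection E M) x ∈ FormFibre.deg k}
  add_mem' hα hβ x := add_mem (hα x) (hβ x)
  zero_mem' := fun _ => zero_mem _
  smul_mem' c _ hα := fun x => Submodule.smul_mem _ c (hα x)

end Forms

/-! ### Commutative `BV_∞`-algebras -/

section BV

variable {A : Type*} [Ring A] [Algebra ℝ A]

/-- The graded commutator of operators `f`, `g` of degrees `p`, `q`. -/
def gradedCommutator (p q : ℤ) (f g : Module.End ℝ A) : Module.End ℝ A :=
  f * g - ((-1 : ℝ) ^ (p * q)) • (g * f)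

/-- `f` is an operator of degree `k` and of algebraic order at most `r`. -/
def HasOrderLE (𝒜 : ℤ → Submodule ℝ A) : ℕ → ℤ → Module.End ℝ A → Prop
  | 0, k, f => ∃ c ∈ 𝒜 k, f = LinearMap.mulLeft ℝ c
  | r + 1, k, f => (∀ j, ∀ a ∈ 𝒜 j, f a ∈ 𝒜 (j + k)) ∧
      ∀ j, ∀ a ∈ 𝒜 j,
        HasOrderLE 𝒜 r (j + k) (gradedCommutator j k (LinearMap.mulLeft ℝ a) f)

/-- The algebra `A` with the grading `𝒜` and the operators `d = Δ 0, Δ 1, Δ 2, …` is a commutative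
`BV_∞`-algebra. -/
structure IsCommBVInfty (𝒜 : ℤ → Submodule ℝ A) (Δ : ℕ → Module.End ℝ A) : Prop where
  isInternal : DirectSum.IsInternal 𝒜
  one_mem : (1 : A) ∈ 𝒜 0
  mul_mem : ∀ j k, ∀ a ∈ 𝒜 j, ∀ b ∈ 𝒜 k, a * b ∈ 𝒜 (j + k)
  graded_comm : ∀ j k, ∀ a ∈ 𝒜 j, ∀ b ∈ 𝒜 k, a * b = ((-1 : ℝ) ^ (j * k)) • (b * a)
  leibniz : ∀ j, ∀ a ∈ 𝒜 j, ∀ b, Δ 0 (a * b) = Δ 0 a * b + ((-1 : ℝ) ^ j) • (a * Δ 0 b)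
  degree : ∀ n : ℕ, ∀ j, ∀ a ∈ 𝒜 j, Δ n a ∈ 𝒜 (j + (1 - 2 * n))
  multicomplex : ∀ n : ℕ, ∑ i ∈ Finset.range (n + 1), Δ i * Δ (n - i) = 0
  order : ∀ n : ℕ, HasOrderLE 𝒜 (n + 1) (1 - 2 * n) (Δ n)

end BV

/-! ### Almost symplectic manifolds -/

section Geometry

variable (E : Type*) [NormedAddCommGroup E] [NormedSpace ℝ E] [FiniteDimensional ℝ E]
  (M : Type*) [TopologicalSpace M] [ChartedSpace E M]

/-- An almost symplectic structure: a smooth nondegenerate `2`-form `ω`. -/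
structure AlmostSymplectic where
  form : FormSection E M
  smooth : form.IsSmooth
  degree_two : ∀ x, form x ∈ ⋀[ℝ]^2 (Module.Dual ℝ E)
  nondegenerate : ∀ x, Function.Bijective (FormFibre.flat (form x))

namespace AlmostSymplectic

variable {E M} (S : AlmostSymplectic E M)

/-- The value `ωₓ(v, w)`. -/
def eval (x : M) (v w : TangentSpace 𝓘(ℝ, E) x) : ℝ := FormFibre.flat (E := E) (S.form x) v w

/-- The inverse `ω⁻¹` of the `2`-form, a bilinear form on covectors (the Poisson tensor if
`dω = 0`). -/
def inverse (x : M) : Module.Dual ℝ E →ₗ[ℝ] Module.Dual ℝ (Module.Dual ℝ E) :=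
  FormFibre.inverseForm (LinearEquiv.ofBijective (FormFibre.flat (S.form x)) (S.nondegenerate x))

/-- The volume form `ωⁿ / n!`, where `dim M = 2n`. -/
def vol (x : M) : FormFibre E :=
  ((Nat.factorial (Module.finrank ℝ E / 2) : ℝ))⁻¹ • (S.form x) ^ (Module.finrank ℝ E / 2)

/-- The symplectic star operator `⋆_ω` at a point. -/
def starω (x : M) : Module.End ℝ (FormFibre E) := FormFibre.star (S.inverse x) (S.vol x)

/-- The symplectic adjoint of an operator at a point. -/
def adjointω (x : M) (φ : Module.End ℝ (FormFibre E)) : Module.End ℝ (FormFibre E) :=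
  FormFibre.adjoint (S.inverse x) φ

/-- The Lefschetz operator `L = ω ∧ ·` at a point. -/
def L (x : M) : Module.End ℝ (FormFibre E) := LinearMap.mulLeft ℝ (S.form x)

/-- The operator `[d, L] = dω ∧ ·` at a point. -/
def dL (x : M) : Module.End ℝ (FormFibre E) := LinearMap.mulLeft ℝ (S.form.d x)

/-- The symplectic adjoint `Λ` of `L` at a point. -/
def Lam (x : M) : Module.End ℝ (FormFibre E) := S.adjointω x (S.L x)

/-- The operator `[Λ, [d, L]]` at a point. -/
def LamdL (x : M) : Module.End ℝ (FormFibre E) := S.Lam x * S.dL x - S.dL x * S.Lam x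

/-- The symplectic adjoint of the exterior derivative, `d^ω = (-1)ᵏ ⋆_ω d ⋆_ω` on `k`-forms. -/
def dω (α : FormSection E M) : FormSection E M := fun x =>
  S.starω x (FormSection.d (fun y => S.starω y (FormFibre.parity (α y))) x)

/-- `[d, L]^ω`. -/
def dLω (α : FormSection E M) : FormSection E M := fun x => S.adjointω x (S.dL x) (α x)

/-- `[Λ, [d, L]]^ω`. -/
def LamdLω (α : FormSection E M) : FormSection E M := fun x => S.adjointω x (S.LamdL x) (α x)

/-- The operators `d`, `Δ₁ = d^ω + [Λ, [d, L]]^ω`, `Δ₂ = -[d, L]^ω` and `Δₙ = 0` for `n ≥ 3` of the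
almost symplectic manifold. -/
def Δ : ℕ → FormSection E M → FormSection E M
  | 0 => fun α => α.d
  | 1 => fun α => S.dω α + S.LamdLω α
  | 2 => fun α => -S.dLω α
  | _ => fun _ => 0

/-- Contraction with the bivector `π = ω⁻¹`, `i_π = (1/2) ∑ᵢⱼ πⁱʲ i_{eᵢ} i_{eⱼ}`. -/
def contractPoisson (α : FormSection E M) : FormSection E M := fun x =>
  (1 / 2 : ℝ) • ∑ i, ∑ j,
    (S.inverse x ((Module.finBasis ℝ E).coord i) ((Module.finBasis ℝ E).coord j) : ℝ) •
      FormFibre.interior (Module.finBasis ℝ E i)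
        (FormFibre.interior (Module.finBasis ℝ E j) (α x))

/-- The operators `d`, `Δ₁ = [i_π, d]`, `Δₙ = 0` for `n ≥ 2` of Koszul's `BV`-algebra. -/
def koszul : ℕ → FormSection E M → FormSection E M
  | 0 => fun α => α.d
  | 1 => fun α => S.contractPoisson α.d - (S.contractPoisson α).d
  | _ => fun _ => 0

end AlmostSymplectic

/-! ### Almost Hermitian manifolds -/

/-- An almost Hermitian structure: an almost symplectic form `ω` and a smooth almost complex
structure `J` compatible with it, so that `g(X, Y) = ω(X, J Y)` is a Riemannian metric;
equivalently, `ω(X, Y) = g(J X, Y)` for a `J`-invariant metric `g`. -/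
structure AlmostHermitian [IsManifold 𝓘(ℝ, E) ∞ M] extends AlmostSymplectic E M where
  J : (x : M) → TangentSpace 𝓘(ℝ, E) x →L[ℝ] TangentSpace 𝓘(ℝ, E) x
  smooth_J : ContMDiff 𝓘(ℝ, E) (𝓘(ℝ, E).prod 𝓘(ℝ, E →L[ℝ] E)) ∞
    (fun x => TotalSpace.mk' (E →L[ℝ] E)
      (E := fun x : M => TangentSpace 𝓘(ℝ, E) x →L[ℝ] TangentSpace 𝓘(ℝ, E) x) x (J x))
  J_sq : ∀ x v, J x (J x v) = -v
  symm : ∀ x v w, toAlmostSymplectic.eval x v (J x w) = toAlmostSymplectic.eval x w (J x v)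
  pos : ∀ x v, v ≠ 0 → 0 < toAlmostSymplectic.eval x v (J x v)

namespace AlmostHermitian

variable {E M} [IsManifold 𝓘(ℝ, E) ∞ M] (H : AlmostHermitian E M)

/-- The endomorphism `J` of a tangent space, as a linear map. -/
def Jlin (x : M) : E →ₗ[ℝ] E := (H.J x).toLinearMap

/-- `v ↦ g(v, ·)` for the metric `g(v, w) = ω(v, J w)`. -/
def metricFlat (x : M) : E →ₗ[ℝ] Module.Dual ℝ E :=
  (H.Jlin x).dualMap ∘ₗ FormFibre.flat (H.form x)

theorem metricFlat_bijective (x : M) : Function.Bijective (H.metricFlat x) := by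
  have hJ : Function.Injective (H.Jlin x).dualMap := by
    intro a b hab
    ext v
    have h := LinearMap.congr_fun hab (-(H.Jlin x v))
    have hv : H.Jlin x (-(H.Jlin x v)) = v := by
      have := H.J_sq x v
      rw [map_neg]
      exact neg_eq_iff_eq_neg.mpr this
    simpa [LinearMap.dualMap_apply, hv] using h
  have h2 : Function.Bijective (H.Jlin x).dualMap :=
    ⟨hJ, (LinearMap.injective_iff_surjective).mp hJ⟩
  exact h2.comp (H.nondegenerate x)

/-- The metric on covectors. -/
def inverseMetric (x : M) : Module.Dual ℝ E →ₗ[ℝ] Module.Dual ℝ (Module.Dual ℝ E) :=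
  FormFibre.inverseForm (LinearEquiv.ofBijective (H.metricFlat x) (H.metricFlat_bijective x))

/-- The Hodge star operator `⋆` at a point; the Riemannian volume form is `ωⁿ / n!`. -/
def hodgeStar (x : M) : Module.End ℝ (FormFibre E) :=
  FormFibre.star (H.inverseMetric x) (H.vol x)

/-- The metric adjoint of an operator at a point. -/
def adjoint (x : M) (φ : Module.End ℝ (FormFibre E)) : Module.End ℝ (FormFibre E) :=
  FormFibre.adjoint (H.inverseMetric x) φ

/-- The extension of `J` to forms as an algebra automorphism, `(Jα)(X, …) = α(JX, …)`. -/
def Jform (x : M) : Module.End ℝ (FormFibre E) :=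
  (FormFibre.pullback (H.Jlin x)).toLinearMap

/-- The inverse `J⁻¹` on forms, induced by `J⁻¹ = -J` on vectors. -/
def JformInv (x : M) : Module.End ℝ (FormFibre E) :=
  (FormFibre.pullback (-H.Jlin x)).toLinearMap

/-- The metric adjoint `Λ = L^*` of the Lefschetz operator at a point. -/
def metricLam (x : M) : Module.End ℝ (FormFibre E) := H.adjoint x (H.L x)

/-- The torsion operator `T = [Λ, dω ∧ ·]` at a point. -/
def torsion (x : M) : Module.End ℝ (FormFibre E) :=
  H.metricLam x * LinearMap.mulLeft ℝ (H.form.d x) - LinearMap.mulLeft ℝ (H.form.d x) * H.metricLam x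

/-- `d_c = J⁻¹ d J`. -/
def dc (α : FormSection E M) : FormSection E M := fun x =>
  H.JformInv x (FormSection.d (fun y => H.Jform y (α y)) x)

/-- `d_c^* = -⋆ d_c ⋆ = -⋆ J⁻¹ d J ⋆`. -/
def dcStar (α : FormSection E M) : FormSection E M := fun x =>
  -H.hodgeStar x (H.dc (fun y => H.hodgeStar y (α y)) x)

/-- `T_c^*`, the metric adjoint of `T_c = J⁻¹ T J`. -/
def TcStar (α : FormSection E M) : FormSection E M := fun x =>
  H.adjoint x (H.JformInv x * H.torsion x * H.Jform x) (α x)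

/-- `dω_c^*`, the metric adjoint of `dω_c = J⁻¹ (dω ∧ ·) J`. -/
def dωcStar (α : FormSection E M) : FormSection E M := fun x =>
  H.adjoint x (H.JformInv x * LinearMap.mulLeft ℝ (H.form.d x) * H.Jform x) (α x)

/-- The operators `d`, `Δ₁ = -(d_c^* + T_c^*)`, `Δ₂ = dω_c^*` and `Δₙ = 0` for `n ≥ 3` of the
almost Hermitian manifold. -/
def hermitianΔ : ℕ → FormSection E M → FormSection E M
  | 0 => fun α => α.d
  | 1 => fun α => -(H.dcStar α + H.TcStar α)
  | 2 => fun α => H.dωcStar α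
  | _ => fun _ => 0

end AlmostHermitian

end Geometry

end

/-! Write `Λ` for the contraction with `π = ω⁻¹`. The core of the proof is that the tuple (1) is the
sequence `d`, `[Λ, d]`, `½ [Λ, [Λ, d]]`, `0`, …, that is, the homogeneous components of `e^{ad Λ}
d`. The `BV_∞` axioms are then formal. The quadratic relations are the components of `e^{ad Λ} (d²)
= 0`; the series stops because `[Λ, Δ₂] = 0`, which is the symplectic adjoint of `[dω ∧ ·, ω ∧ ·] =
0`. The bounds on the order hold because `Λ` has order two, `d` has order one, and a graded
commutator loses one order (`HasOrderLE.commutator`, `contractionTower_multicomplex`).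

The claim is local, and no Darboux coordinates are available since `ω` need not be closed. In a
chart, `ω` is a smooth family of nondegenerate `2`-forms, and `d^ω` differs from `-∑ i(P eⁱ) ∂ᵢ`,
with `P` the inverse of `v ↦ ω(v, ·)`, only through the derivative of `⋆_ω`. By
`SharpFamily.fderiv_starOp` that derivative is `-W ⋆_ω`, where `W = [Λ, ∂ᵥω ∧ ·]` is an operator of
order one that generalizes the weight operator of the Lefschetz `sl₂`. The pointwise identity
`IsSharp.ι_mul_coLefschetz_sub_adjoint` shows that the term `[Λ, [d, L]]^ω` cancels this defect and
leaves `[Λ, d]` (`dω_add_LamdLω`); one more commutator with `Λ` gives `-2 [d, L]^ω` (`dLω_eq`).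

The comparison of (1) and (2) is linear algebra at a point. From `⟨α, β⟩_g = ⟨α, Jβ⟩_ω` one gets `⋆
= ⋆_ω J` and `φ^* = J⁻¹ φ^ω J`. Since `J` preserves `ω`, it commutes with `⋆_ω` and `Λ`, and `J² =
(-1)ᵏ` on `k`-forms produces the sign in the adjoints of odd operators. Hence (2) equals (1) and
involves `ω` only; for `dω = 0` the two correction terms vanish. -/

open scoped Topology

set_option linter.unusedSectionVars false

noncomputable section

namespace FormFibre

variable {E : Type*} [NormedAddCommGroup E] [NormedSpace ℝ E] [FiniteDimensional ℝ E]

/-! ### Contraction, parity and the grading -/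

/-- Exterior multiplication by a covector. -/
def wedge : Module.Dual ℝ E →ₗ[ℝ] Module.End ℝ (FormFibre E) :=
  LinearMap.mul ℝ (FormFibre E) ∘ₗ ExteriorAlgebra.ι ℝ

@[simp] theorem wedge_apply (a : Module.Dual ℝ E) (β : FormFibre E) :
    wedge a β = ExteriorAlgebra.ι ℝ a * β := rfl

/-- The interior product, linear in the vector. -/
def interiorL : E →ₗ[ℝ] Module.End ℝ (FormFibre E) :=
  CliffordAlgebra.contractLeft ∘ₗ Module.Dual.eval ℝ E

@[simp] theorem interiorL_apply (v : E) : interiorL v = interior v := rfl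

theorem interior_add (v w : E) : interior (v + w) = interior v + interior w :=
  map_add interiorL v w

theorem interior_neg (v : E) : interior (-v) = -interior v := map_neg interiorL v

theorem interior_smul (r : ℝ) (v : E) : interior (r • v) = r • interior v :=
  map_smul interiorL r v

theorem interior_sum {ι : Type*} (s : Finset ι) (v : ι → E) :
    interior (∑ i ∈ s, v i) = ∑ i ∈ s, interior (v i) :=
  map_sum interiorL v s

@[simp] theorem interior_one (v : E) : interior v 1 = 0 := CliffordAlgebra.contractLeft_one _ _

@[simp] theorem interior_algebraMap (v : E) (r : ℝ) : interior v (algebraMap ℝ _ r) = 0 :=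
  CliffordAlgebra.contractLeft_algebraMap _ _ _

theorem interior_ι (v : E) (a : Module.Dual ℝ E) :
    interior v (ExteriorAlgebra.ι ℝ a) = algebraMap ℝ _ (a v) :=
  CliffordAlgebra.contractLeft_ι _ _ _

theorem interior_ι_mul (v : E) (a : Module.Dual ℝ E) (β : FormFibre E) :
    interior v (ExteriorAlgebra.ι ℝ a * β) = a v • β - ExteriorAlgebra.ι ℝ a * interior v β :=
  CliffordAlgebra.contractLeft_ι_mul _ _ _

theorem interior_comm (v w : E) (β : FormFibre E) :
    interior v (interior w β) = -interior w (interior v β) :=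
  CliffordAlgebra.contractLeft_comm _ _ _

theorem left_induction {p : FormFibre E → Prop} (h0 : ∀ r : ℝ, p (algebraMap ℝ _ r))
    (hadd : ∀ x y, p x → p y → p (x + y))
    (hmul : ∀ x a, p x → p (ExteriorAlgebra.ι ℝ a * x)) (x : FormFibre E) : p x :=
  CliffordAlgebra.left_induction _ h0 hadd hmul x

theorem right_induction {p : FormFibre E → Prop} (h0 : ∀ r : ℝ, p (algebraMap ℝ _ r))
    (hadd : ∀ x y, p x → p y → p (x + y))
    (hmul : ∀ a x, p x → p (x * ExteriorAlgebra.ι ℝ a)) (x : FormFibre E) : p x :=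
  CliffordAlgebra.right_induction _ h0 hadd hmul x

@[simp] theorem parity_ι (a : Module.Dual ℝ E) :
    parity (ExteriorAlgebra.ι ℝ a) = -ExteriorAlgebra.ι ℝ a := by
  simp [parity]

@[simp] theorem parity_parity (β : FormFibre E) : parity (parity β) = β := by
  induction β using left_induction with
  | h0 r => simp
  | hadd x y hx hy => simp [hx, hy]
  | hmul x a hx => simp [hx]

theorem interior_parity (v : E) (β : FormFibre E) :
    interior v (parity β) = -parity (interior v β) := by
  induction β using left_induction with
  | h0 r => simp
  | hadd x y hx hy => simp [hx, hy]; abel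
  | hmul x a hx => simp [hx, interior_ι_mul]

theorem interior_mul (v : E) (α β : FormFibre E) :
    interior v (α * β) = interior v α * β + parity α * interior v β := by
  induction α using left_induction with
  | h0 r => simp [← Algebra.smul_def]
  | hadd x y hx hy => simp [add_mul, hx, hy]; abel
  | hmul x a hx => simp [mul_assoc, hx, interior_ι_mul, mul_add, sub_mul]; abel

theorem ι_mul_eq (a : Module.Dual ℝ E) (β : FormFibre E) :
    ExteriorAlgebra.ι ℝ a * β = parity β * ExteriorAlgebra.ι ℝ a := by
  induction β using left_induction with
  | h0 r => simp [Algebra.commutes]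
  | hadd x y hx hy => simp [mul_add, add_mul, hx, hy]
  | hmul x b hx =>
    have h := ExteriorAlgebra.ι_add_mul_swap (R := ℝ) a b
    rw [map_mul, parity_ι, mul_assoc, ← hx, neg_mul, ← mul_assoc, ← mul_assoc,
      eq_neg_of_add_eq_zero_left h, neg_mul]

/-- Induction on the degree of a homogeneous element. -/
theorem mem_induction {p : ℕ → FormFibre E → Prop} (h0 : ∀ r : ℝ, p 0 (algebraMap ℝ _ r))
    (hadd : ∀ k x y, p k x → p k y → p k (x + y))
    (hmul : ∀ k a, ∀ x ∈ ⋀[ℝ]^k (Module.Dual ℝ E), p k x → p (k + 1) (ExteriorAlgebra.ι ℝ a * x))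
    {k : ℕ} {x : FormFibre E} (hx : x ∈ ⋀[ℝ]^k (Module.Dual ℝ E)) : p k x := by
  induction hx using Submodule.pow_induction_on_left' with
  | algebraMap r => exact h0 r
  | add x y i hx hy ihx ihy => exact hadd _ _ _ ihx ihy
  | mem_mul m hm i x hx ih =>
    obtain ⟨a, rfl⟩ := hm
    exact hmul _ _ _ hx ih

theorem algebraMap_mem (r : ℝ) :
    algebraMap ℝ (FormFibre E) r ∈ ⋀[ℝ]^0 (Module.Dual ℝ E) := by
  simp only [pow_zero]; exact Submodule.algebraMap_mem r

theorem one_mem_deg : (1 : FormFibre E) ∈ ⋀[ℝ]^0 (Module.Dual ℝ E) := by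
  simp

theorem exists_of_mem_zero {x : FormFibre E} (hx : x ∈ ⋀[ℝ]^0 (Module.Dual ℝ E)) :
    ∃ r : ℝ, algebraMap ℝ (FormFibre E) r = x := by
  simpa [Submodule.mem_one] using hx

theorem ι_mem (a : Module.Dual ℝ E) :
    (ExteriorAlgebra.ι ℝ a : FormFibre E) ∈ ⋀[ℝ]^1 (Module.Dual ℝ E) := by
  simp only [pow_one]; exact LinearMap.mem_range_self _ _

theorem exists_of_mem_one {x : FormFibre E} (hx : x ∈ ⋀[ℝ]^1 (Module.Dual ℝ E)) :
    ∃ a : Module.Dual ℝ E, ExteriorAlgebra.ι ℝ a = x := by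
  simp only [pow_one] at hx
  exact hx

theorem mul_mem_deg {j k : ℕ} {x y : FormFibre E} (hx : x ∈ ⋀[ℝ]^j (Module.Dual ℝ E))
    (hy : y ∈ ⋀[ℝ]^k (Module.Dual ℝ E)) : x * y ∈ ⋀[ℝ]^(j + k) (Module.Dual ℝ E) :=
  SetLike.mul_mem_graded (A := fun i : ℕ => ⋀[ℝ]^i (Module.Dual ℝ E)) hx hy

theorem ι_mul_mem (a : Module.Dual ℝ E) {k : ℕ} {x : FormFibre E}
    (hx : x ∈ ⋀[ℝ]^k (Module.Dual ℝ E)) :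
    ExteriorAlgebra.ι ℝ a * x ∈ ⋀[ℝ]^(k + 1) (Module.Dual ℝ E) := by
  rw [add_comm]; exact mul_mem_deg (ι_mem a) hx

theorem interior_of_mem_zero (v : E) {x : FormFibre E} (hx : x ∈ ⋀[ℝ]^0 (Module.Dual ℝ E)) :
    interior v x = 0 := by
  obtain ⟨r, rfl⟩ := exists_of_mem_zero hx
  simp

theorem interior_mem (v : E) {k : ℕ} {x : FormFibre E} (hx : x ∈ ⋀[ℝ]^(k + 1) (Module.Dual ℝ E)) :
    interior v x ∈ ⋀[ℝ]^k (Module.Dual ℝ E) := by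
  -- The induction on the degree passes through degree `0`, where there is no lower degree to land
  -- in, so that case is carried along separately.
  suffices h : ∀ l, ∀ x ∈ ⋀[ℝ]^l (Module.Dual ℝ E), (l = 0 → interior v x = 0) ∧
      ∀ k, l = k + 1 → interior v x ∈ ⋀[ℝ]^k (Module.Dual ℝ E) from (h _ x hx).2 k rfl
  intro l x hx
  refine mem_induction (p := fun l x => (l = 0 → interior v x = 0) ∧
      ∀ k, l = k + 1 → interior v x ∈ ⋀[ℝ]^k (Module.Dual ℝ E)) ?_ ?_ ?_ hx
  · intro r; simp
  · intro k x y hx hy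
    exact ⟨fun h => by rw [map_add, hx.1 h, hy.1 h, add_zero],
      fun j hj => by rw [map_add]; exact add_mem (hx.2 j hj) (hy.2 j hj)⟩
  · intro k a x hx ih
    refine ⟨by simp, fun j hj => ?_⟩
    obtain rfl : k = j := by omega
    rw [interior_ι_mul]
    refine sub_mem (Submodule.smul_mem _ _ hx) ?_
    cases k with
    | zero => simp [ih.1 rfl]
    | succ k => exact ι_mul_mem a (ih.2 k rfl)

theorem parity_of_mem {k : ℕ} {x : FormFibre E} (hx : x ∈ ⋀[ℝ]^k (Module.Dual ℝ E)) :
    parity x = (-1 : ℝ) ^ k • x := by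
  refine mem_induction (p := fun k x => parity x = (-1 : ℝ) ^ k • x) ?_ ?_ ?_ hx
  · intro r; simp
  · intro k x y hx hy; simp [hx, hy]
  · intro k a x _ ih; simp [ih, pow_succ]

theorem deg_eq_bot {k : ℕ} (hk : Module.finrank ℝ E < k) :
    ⋀[ℝ]^k (Module.Dual ℝ E) = ⊥ := by
  have h := exteriorPower.finrank_eq ℝ (M := Module.Dual ℝ E) (n := k)
  rw [Subspace.dual_finrank_eq, Nat.choose_eq_zero_of_lt hk] at h
  exact Submodule.finrank_eq_zero.mp h

theorem eq_zero_of_mem {k : ℕ} (hk : Module.finrank ℝ E < k) {x : FormFibre E}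
    (hx : x ∈ ⋀[ℝ]^k (Module.Dual ℝ E)) : x = 0 := by
  rw [deg_eq_bot hk] at hx; exact hx

/-- Linear maps that agree on homogeneous elements of degree at most `dim E` are equal. -/
theorem hom_ext_deg {N : Type*} [AddCommGroup N] [Module ℝ N] {f g : FormFibre E →ₗ[ℝ] N}
    (h : ∀ k ≤ Module.finrank ℝ E, ∀ x ∈ ⋀[ℝ]^k (Module.Dual ℝ E), f x = g x) : f = g := by
  refine LinearMap.ext fun x => ?_
  induction x using DirectSum.Decomposition.inductionOn
    (fun i : ℕ => ⋀[ℝ]^i (Module.Dual ℝ E)) with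
  | zero => simp
  | add x y hx hy => simp [hx, hy]
  | @homogeneous k x =>
    by_cases hk : k ≤ Module.finrank ℝ E
    · exact h k hk x x.2
    · simp [eq_zero_of_mem (not_le.mp hk) x.2]

local notation "♮" => Module.finBasis ℝ E

theorem sum_apply_smul_coord (a : Module.Dual ℝ E) : ∑ i, a (♮ i) • ♮.coord i = a := by
  refine ♮.ext fun j => ?_
  simp

theorem sum_coord_smul (v : E) : ∑ i, ♮.coord i v • ♮ i = v := ♮.sum_repr v

/-- Euler's identity: this sum is the derivation that is the identity on covectors, so it counts the
factors. It recovers a form of positive degree from its contractions. -/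
theorem sum_ι_mul_interior {k : ℕ} {x : FormFibre E} (hx : x ∈ ⋀[ℝ]^k (Module.Dual ℝ E)) :
    ∑ i, ExteriorAlgebra.ι ℝ (♮.coord i) * interior (♮ i) x = (k : ℝ) • x := by
  refine mem_induction (p := fun k x =>
    ∑ i, ExteriorAlgebra.ι ℝ (♮.coord i) * interior (♮ i) x = (k : ℝ) • x) ?_ ?_ ?_ hx
  · intro r; simp
  · intro k x y hx hy; simp [mul_add, Finset.sum_add_distrib, hx, hy]
  · intro k a x _ ih
    have h1 : ∀ i, ExteriorAlgebra.ι ℝ (♮.coord i) * interior (♮ i) (ExteriorAlgebra.ι ℝ a * x) =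
        ExteriorAlgebra.ι ℝ (a (♮ i) • ♮.coord i) * x +
          ExteriorAlgebra.ι ℝ a * (ExteriorAlgebra.ι ℝ (♮.coord i) * interior (♮ i) x) := by
      intro i
      have h := eq_neg_of_add_eq_zero_left
        (ExteriorAlgebra.ι_add_mul_swap (R := ℝ) (♮.coord i) a)
      rw [interior_ι_mul, mul_sub, ← mul_assoc, h, map_smul, ← mul_assoc]
      simp
    simp_rw [h1]
    rw [Finset.sum_add_distrib, ← Finset.sum_mul, ← map_sum, sum_apply_smul_coord,
      ← Finset.mul_sum, ih, mul_smul_comm, Nat.cast_succ, add_smul, one_smul, add_comm]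

/-- The dual count, of the missing factors: below the top degree a form is recovered from its
products with covectors. -/
theorem sum_interior_ι_mul {k : ℕ} {x : FormFibre E} (hx : x ∈ ⋀[ℝ]^k (Module.Dual ℝ E)) :
    ∑ i, interior (♮ i) (ExteriorAlgebra.ι ℝ (♮.coord i) * x) =
      ((Module.finrank ℝ E : ℝ) - k) • x := by
  simp_rw [interior_ι_mul]
  rw [Finset.sum_sub_distrib, sum_ι_mul_interior hx, sub_smul]
  simp [Finset.sum_const, ← Nat.cast_smul_eq_nsmul ℝ]

theorem eq_zero_of_interior_eq_zero {k : ℕ} {x : FormFibre E}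
    (hx : x ∈ ⋀[ℝ]^(k + 1) (Module.Dual ℝ E)) (h : ∀ v, interior v x = 0) : x = 0 := by
  have h1 := sum_ι_mul_interior hx
  simp only [h, mul_zero, Finset.sum_const_zero] at h1
  exact (smul_eq_zero.mp h1.symm).resolve_left (by positivity)

theorem eq_zero_of_ι_mul_eq_zero {k : ℕ} {x : FormFibre E} (hk : k < Module.finrank ℝ E)
    (hx : x ∈ ⋀[ℝ]^k (Module.Dual ℝ E)) (h : ∀ a, ExteriorAlgebra.ι ℝ a * x = 0) : x = 0 := by
  have h1 := sum_interior_ι_mul hx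
  simp only [h, map_zero, Finset.sum_const_zero] at h1
  refine (smul_eq_zero.mp h1.symm).resolve_left (sub_ne_zero.mpr ?_)
  exact_mod_cast hk.ne.symm

/-- Nondegeneracy of the wedge product. -/
theorem eq_zero_of_mul_eq_zero {k l : ℕ} (hkl : k + l = Module.finrank ℝ E) {x : FormFibre E}
    (hx : x ∈ ⋀[ℝ]^l (Module.Dual ℝ E))
    (h : ∀ α ∈ ⋀[ℝ]^k (Module.Dual ℝ E), α * x = 0) : x = 0 := by
  induction k generalizing l x with
  | zero => simpa using h 1 one_mem_deg
  | succ k ih =>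
    refine eq_zero_of_ι_mul_eq_zero (by omega) hx fun a => ?_
    refine ih (l := l + 1) (by omega) (ι_mul_mem a hx) fun α hα => ?_
    rw [← mul_assoc]
    exact h _ (mul_mem_deg hα (ι_mem a))

/-! ### The pairing on forms -/

/-- The scalar part of a form. -/
def scalar : FormFibre E →ₗ[ℝ] ℝ := (ExteriorAlgebra.algebraMapInv).toLinearMap

@[simp] theorem scalar_algebraMap (r : ℝ) : scalar (algebraMap ℝ (FormFibre E) r) = r :=
  ExteriorAlgebra.algebraMap_leftInverse _ r

@[simp] theorem scalar_one : scalar (1 : FormFibre E) = 1 := by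
  simpa using scalar_algebraMap (E := E) 1

@[simp] theorem scalar_ι_mul (a : Module.Dual ℝ E) (x : FormFibre E) :
    scalar (ExteriorAlgebra.ι ℝ a * x) = 0 := by
  simp [scalar, ExteriorAlgebra.algebraMapInv]

theorem scalar_of_mem {k : ℕ} {x : FormFibre E} (hx : x ∈ ⋀[ℝ]^(k + 1) (Module.Dual ℝ E)) :
    scalar x = 0 := by
  have h1 := sum_ι_mul_interior hx
  have h2 : scalar (((k + 1 : ℕ) : ℝ) • x) = 0 := by rw [← h1, map_sum]; simp
  rw [map_smul, smul_eq_mul] at h2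
  exact (mul_eq_zero.mp h2).resolve_left (by positivity)

/-- The iterated contraction `a₁ ∧ … ∧ aₖ ↦ i(c aₖ) ⋯ i(c a₁)`. -/
def contraction (c : Module.Dual ℝ E →ₗ[ℝ] Module.Dual ℝ (Module.Dual ℝ E)) :
    FormFibre E →ₐ[ℝ] (Module.End ℝ (FormFibre E))ᵐᵒᵖ :=
  ExteriorAlgebra.lift ℝ ⟨(MulOpposite.opLinearEquiv ℝ).toLinearMap ∘ₗ
      (CliffordAlgebra.contractLeft ∘ₗ c), fun a => by
    apply MulOpposite.unop_injective
    exact LinearMap.ext fun x => CliffordAlgebra.contractLeft_contractLeft (c a) x⟩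

variable (c : Module.Dual ℝ E →ₗ[ℝ] Module.Dual ℝ (Module.Dual ℝ E))

theorem contraction_ι (a : Module.Dual ℝ E) :
    (contraction c (ExteriorAlgebra.ι ℝ a)).unop = CliffordAlgebra.contractLeft (c a) := by
  simp [contraction]

theorem contraction_ι_mul (a : Module.Dual ℝ E) (α β : FormFibre E) :
    (contraction c (ExteriorAlgebra.ι ℝ a * α)).unop β =
      (contraction c α).unop (CliffordAlgebra.contractLeft (c a) β) := by
  rw [map_mul, MulOpposite.unop_mul, contraction_ι]; rfl

/-- The pairing on forms as a bilinear form. -/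
def pairingBilin : LinearMap.BilinForm ℝ (FormFibre E) :=
  LinearMap.mk₂ ℝ (fun α β => scalar ((contraction c α).unop β))
    (by intro α α' β; simp) (by intro r α β; simp) (by intro α β β'; simp)
    (by intro r α β; simp)

/-- This recursion replaces determinants: wedging on the left is adjoint to contracting on the
right, so facts about the pairing follow by induction on `α`. -/
theorem pairingBilin_ι_mul (a : Module.Dual ℝ E) (α β : FormFibre E) :
    pairingBilin c (ExteriorAlgebra.ι ℝ a * α) β =
      pairingBilin c α (CliffordAlgebra.contractLeft (c a) β) :=
  congrArg scalar (contraction_ι_mul c a α β)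

@[simp] theorem pairingBilin_one (β : FormFibre E) : pairingBilin c 1 β = scalar β := by
  simp [pairingBilin]

theorem pairingBilin_algebraMap (r : ℝ) (β : FormFibre E) :
    pairingBilin c (algebraMap ℝ _ r) β = r * scalar β := by
  simp [Algebra.algebraMap_eq_smul_one]

theorem contractLeft_ιMulti (f : Module.Dual ℝ (Module.Dual ℝ E)) {k : ℕ}
    (b : Fin (k + 1) → Module.Dual ℝ E) :
    CliffordAlgebra.contractLeft f (ExteriorAlgebra.ιMulti ℝ (k + 1) b) =
      ∑ j : Fin (k + 1), (-1 : ℝ) ^ (j : ℕ) •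
        f (b j) • ExteriorAlgebra.ιMulti ℝ k (fun i => b (j.succAbove i)) := by
  induction k with
  | zero =>
    simp [ExteriorAlgebra.ιMulti_succ_apply, Algebra.algebraMap_eq_smul_one]
  | succ k ih =>
    rw [ExteriorAlgebra.ιMulti_succ_apply, CliffordAlgebra.contractLeft_ι_mul, ih,
      Fin.sum_univ_succ (n := k + 1), Finset.mul_sum, sub_eq_add_neg, ← Finset.sum_neg_distrib]
    congr 1
    · simp [Matrix.vecTail, Function.comp_def]
    · refine Finset.sum_congr rfl fun j _ => ?_
      rw [ExteriorAlgebra.ιMulti_succ_apply (v := fun i => b (j.succ.succAbove i))]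
      simp [Matrix.vecTail, Function.comp_def, pow_succ]

/-- Contracting with the first covector of `a` is Laplace expansion along the first row. -/
theorem pairingBilin_ιMulti {k : ℕ} (a b : Fin k → Module.Dual ℝ E) :
    pairingBilin c (ExteriorAlgebra.ιMulti ℝ k a) (ExteriorAlgebra.ιMulti ℝ k b) =
      Matrix.det (Matrix.of fun i j => c (a i) (b j)) := by
  induction k with
  | zero => simp
  | succ k ih =>
    rw [ExteriorAlgebra.ιMulti_succ_apply (v := a), pairingBilin_ι_mul, contractLeft_ιMulti,
      map_sum, Matrix.det_succ_row_zero]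
    refine Finset.sum_congr rfl fun j _ => ?_
    rw [map_smul, map_smul, ih]
    simp only [smul_eq_mul, Matrix.of_apply, mul_assoc]
    rfl

theorem contractLeft_mem (f : Module.Dual ℝ (Module.Dual ℝ E)) {k : ℕ} {x : FormFibre E}
    (hx : x ∈ ⋀[ℝ]^(k + 1) (Module.Dual ℝ E)) :
    CliffordAlgebra.contractLeft f x ∈ ⋀[ℝ]^k (Module.Dual ℝ E) := by
  obtain ⟨v, rfl⟩ := (Module.evalEquiv ℝ E).surjective f
  exact interior_mem v hx

theorem pairingBilin_of_ne {k l : ℕ} (hkl : k ≠ l) {x y : FormFibre E}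
    (hx : x ∈ ⋀[ℝ]^k (Module.Dual ℝ E)) (hy : y ∈ ⋀[ℝ]^l (Module.Dual ℝ E)) :
    pairingBilin c x y = 0 := by
  refine mem_induction (p := fun k x => ∀ l ≠ k, ∀ y ∈ ⋀[ℝ]^l (Module.Dual ℝ E),
    pairingBilin c x y = 0) ?_ ?_ ?_ hx l hkl.symm y hy
  · intro r l hl y hy
    obtain ⟨l, rfl⟩ := Nat.exists_eq_succ_of_ne_zero hl
    rw [pairingBilin_algebraMap, scalar_of_mem hy, mul_zero]
  · intro k x y hx hy l hl z hz
    rw [map_add, LinearMap.add_apply, hx l hl z hz, hy l hl z hz, add_zero]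
  · intro k a x _ ih l hl y hy
    rw [pairingBilin_ι_mul]
    cases l with
    | zero =>
      obtain ⟨r, rfl⟩ := exists_of_mem_zero hy
      simp
    | succ l => exact ih l (by omega) _ (contractLeft_mem _ hy)

/-- In each degree both sides are bilinear and agree on decomposable forms; distinct degrees are
orthogonal for `pairingBilin`, and degrees above `dim E` contribute nothing. -/
theorem pairing_eq (α β : FormFibre E) : pairing c α β = pairingBilin c α β := by
  classical
  set D := fun i : ℕ => ⋀[ℝ]^i (Module.Dual ℝ E) with hD
  have key : ∀ k, ∀ x y : ⋀[ℝ]^k (Module.Dual ℝ E),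
      exteriorPower.pairingDual ℝ (Module.Dual ℝ E) k (exteriorPower.map k c x) y =
        pairingBilin c (x : FormFibre E) (y : FormFibre E) := by
    intro k x y
    have h : (exteriorPower.pairingDual ℝ (Module.Dual ℝ E) k ∘ₗ exteriorPower.map k c) =
        (pairingBilin c).compl₁₂ (Submodule.subtype (⋀[ℝ]^k (Module.Dual ℝ E)))
          (Submodule.subtype (⋀[ℝ]^k (Module.Dual ℝ E))) := by
      apply exteriorPower.linearMap_ext
      ext a : 1
      apply exteriorPower.linearMap_ext
      ext b : 1
      simp only [LinearMap.compAlternatingMap_apply, LinearMap.comp_apply,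
        exteriorPower.map_apply_ιMulti, exteriorPower.pairingDual_ιMulti_ιMulti,
        LinearMap.compl₁₂_apply, Submodule.subtype_apply, exteriorPower.ιMulti_apply_coe,
        pairingBilin_ιMulti, Function.comp_apply]
      -- The two determinants are those of transposed matrices.
      rw [← Matrix.det_transpose]
      rfl
    exact congrArg (fun f => f x y) h
  simp only [pairing, key]
  have hα := DirectSum.sum_support_decompose D α
  have hβ := DirectSum.sum_support_decompose D β
  have hz : ∀ (x : FormFibre E) k, Module.finrank ℝ E < k →
      ((DirectSum.decompose D x k : D k) : FormFibre E) = 0 := fun x k hk =>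
    eq_zero_of_mem hk (DirectSum.decompose D x k).2
  have hsum : ∀ x : FormFibre E, x = ∑ k ∈ Finset.range (Module.finrank ℝ E + 1),
      ((DirectSum.decompose D x k : D k) : FormFibre E) := by
    intro x
    conv_lhs => rw [← DirectSum.sum_support_decompose D x]
    refine Finset.sum_subset ?_ ?_
    · intro k hk
      by_contra h
      rw [DFinsupp.mem_support_iff] at hk
      exact hk (Subtype.ext (hz x k (by simpa using h)))
    · intro k _ hk
      rw [DFinsupp.notMem_support_iff] at hk
      simp [hk]
  conv_rhs => rw [hsum β, map_sum]
  refine Finset.sum_congr rfl fun k hk => ?_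
  conv_rhs => rw [hsum α, map_sum, LinearMap.sum_apply]
  rw [Finset.sum_eq_single k]
  · intro l _ hl
    exact pairingBilin_of_ne c hl (DirectSum.decompose D α l).2 (DirectSum.decompose D β k).2
  · intro h; exact absurd hk h

/-- The recursion in the second argument. The form `c` is not assumed to be symmetric or
antisymmetric, hence the flip. -/
theorem pairingBilin_mul_ι (b : Module.Dual ℝ E) (α β : FormFibre E) :
    pairingBilin c α (ExteriorAlgebra.ι ℝ b * β) =
      pairingBilin c (CliffordAlgebra.contractLeft (c.flip b) α) β := by
  induction α using left_induction generalizing β with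
  | h0 r => simp [Algebra.algebraMap_eq_smul_one]
  | hadd x y hx hy => simp [hx, hy]
  | hmul x a hx =>
    rw [pairingBilin_ι_mul, CliffordAlgebra.contractLeft_ι_mul, map_sub, hx,
      CliffordAlgebra.contractLeft_ι_mul, map_sub, LinearMap.sub_apply, pairingBilin_ι_mul]
    simp

/-- As `c` is onto, every contraction of `β` occurs in a pairing `⟨a ∧ α, β⟩`; by induction on the
degree all contractions of `β` vanish, hence so does `β` by Euler's identity. Orthogonality of the
degrees reduces the claim to homogeneous `β`. -/
theorem pairingBilin_left_nondegenerate
    {c : Module.Dual ℝ E →ₗ[ℝ] Module.Dual ℝ (Module.Dual ℝ E)} (hc : Function.Surjective c) {β : FormFibre E}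
    (h : ∀ α, pairingBilin c α β = 0) : β = 0 := by
  classical
  have key : ∀ k, ∀ β ∈ ⋀[ℝ]^k (Module.Dual ℝ E), (∀ α, pairingBilin c α β = 0) → β = 0 := by
    intro k
    induction k with
    | zero =>
      intro β hβ h
      obtain ⟨r, rfl⟩ := exists_of_mem_zero hβ
      have := h 1
      simp at this
      simp [this]
    | succ k ih =>
      intro β hβ h
      refine eq_zero_of_interior_eq_zero hβ fun v => ih _ (interior_mem v hβ) fun α => ?_
      obtain ⟨a, ha⟩ := hc (Module.Dual.eval ℝ E v)
      have := h (ExteriorAlgebra.ι ℝ a * α)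
      rwa [pairingBilin_ι_mul, ha] at this
  rw [← DirectSum.sum_support_decompose (fun i : ℕ => ⋀[ℝ]^i (Module.Dual ℝ E)) β]
  refine Finset.sum_eq_zero fun k _ => key k _ (SetLike.coe_mem _) fun α => ?_
  have h2 := h (DirectSum.decompose (fun i : ℕ => ⋀[ℝ]^i (Module.Dual ℝ E)) α k)
  rw [← DirectSum.sum_support_decompose (fun i : ℕ => ⋀[ℝ]^i (Module.Dual ℝ E)) β, map_sum,
    Finset.sum_eq_single k] at h2
  · rw [← DirectSum.sum_support_decompose (fun i : ℕ => ⋀[ℝ]^i (Module.Dual ℝ E)) α, map_sum,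
      LinearMap.sum_apply, Finset.sum_eq_single k]
    · exact h2
    · intro l _ hl
      exact pairingBilin_of_ne c hl (SetLike.coe_mem _) (SetLike.coe_mem _)
    · intro hk
      rw [DFinsupp.notMem_support_iff] at hk
      simp [hk]
  · intro l _ hl
    exact pairingBilin_of_ne c hl.symm (SetLike.coe_mem _) (SetLike.coe_mem _)
  · intro hk
    rw [DFinsupp.notMem_support_iff] at hk
    simp [hk]

theorem pairingBilin_nondegenerate
    {c : Module.Dual ℝ E →ₗ[ℝ] Module.Dual ℝ (Module.Dual ℝ E)} (hc : Function.Surjective c) :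
    (pairingBilin c).Nondegenerate :=
  LinearMap.BilinForm.Nondegenerate.flip (B := (pairingBilin c).flip) <|
    LinearMap.BilinForm.Nondegenerate.ofSeparatingLeft fun _ h =>
      pairingBilin_left_nondegenerate hc h

/-! ### Adjoints -/

variable {c}

theorem pairing_adjoint (hc : Function.Surjective c) (φ : Module.End ℝ (FormFibre E))
    (α β : FormFibre E) :
    pairingBilin c (φ α) β = pairingBilin c α (adjoint c φ β) := by
  have h : ∃ ψ : Module.End ℝ (FormFibre E),
      ∀ α β, pairing c (φ α) β = pairing c α (ψ β) :=
    -- The right adjoint wanted here is the left adjoint for the flipped form. Its existence makes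
    -- the choice in the definition of `adjoint` meaningful.
    ⟨(pairingBilin c).flip.leftAdjointOfNondegenerate (pairingBilin_nondegenerate hc).flip φ,
      fun α β => by
        rw [pairing_eq, pairing_eq]
        exact ((pairingBilin c).flip.isAdjointPairLeftAdjointOfNondegenerate
          (pairingBilin_nondegenerate hc).flip φ β α).symm⟩
  have h' := Classical.epsilon_spec h α β
  rwa [pairing_eq, pairing_eq] at h'

theorem eq_of_pairing_eq (hc : Function.Surjective c) {β β' : FormFibre E}
    (h : ∀ α, pairingBilin c α β = pairingBilin c α β') : β = β' :=
  sub_eq_zero.mp <| pairingBilin_left_nondegenerate hc fun α => by rw [map_sub, h, sub_self]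

theorem adjoint_eq (hc : Function.Surjective c) {φ ψ : Module.End ℝ (FormFibre E)}
    (h : ∀ α β, pairingBilin c (φ α) β = pairingBilin c α (ψ β)) : adjoint c φ = ψ :=
  LinearMap.ext fun β => eq_of_pairing_eq hc fun α => by rw [← pairing_adjoint hc, h]

theorem adjoint_mul (hc : Function.Surjective c) (φ ψ : Module.End ℝ (FormFibre E)) :
    adjoint c (φ * ψ) = adjoint c ψ * adjoint c φ :=
  adjoint_eq hc fun α β => by
    rw [Module.End.mul_apply, pairing_adjoint hc, pairing_adjoint hc, Module.End.mul_apply]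

theorem adjoint_add (hc : Function.Surjective c) (φ ψ : Module.End ℝ (FormFibre E)) :
    adjoint c (φ + ψ) = adjoint c φ + adjoint c ψ :=
  adjoint_eq hc fun α β => by simp [pairing_adjoint hc]

theorem adjoint_sub (hc : Function.Surjective c) (φ ψ : Module.End ℝ (FormFibre E)) :
    adjoint c (φ - ψ) = adjoint c φ - adjoint c ψ :=
  adjoint_eq hc fun α β => by simp [pairing_adjoint hc]

theorem adjoint_zero (hc : Function.Surjective c) : adjoint c 0 = 0 :=
  adjoint_eq hc fun α β => by simp

theorem adjoint_sum (hc : Function.Surjective c) {ι : Type*} (s : Finset ι)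
    (φ : ι → Module.End ℝ (FormFibre E)) :
    adjoint c (∑ i ∈ s, φ i) = ∑ i ∈ s, adjoint c (φ i) :=
  adjoint_eq hc fun α β => by simp [pairing_adjoint hc]

end FormFibre

end

noncomputable section

namespace FormFibre

variable {E : Type*} [NormedAddCommGroup E] [NormedSpace ℝ E] [FiniteDimensional ℝ E]

local notation "♮" => Module.finBasis ℝ E

/-! ### Elements of degree two -/

theorem graded_comm {j k : ℕ} {x y : FormFibre E} (hx : x ∈ ⋀[ℝ]^j (Module.Dual ℝ E))
    (hy : y ∈ ⋀[ℝ]^k (Module.Dual ℝ E)) : x * y = (-1 : ℝ) ^ (j * k) • (y * x) := by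
  refine mem_induction (p := fun j x => x * y = (-1 : ℝ) ^ (j * k) • (y * x)) ?_ ?_ ?_ hx
  · intro r; simp [Algebra.commutes]
  · intro j x x' hx hx'; simp [add_mul, mul_add, hx, hx']
  · intro j a x _ ih
    rw [mul_assoc, ih, mul_smul_comm, ← mul_assoc, ι_mul_eq, parity_of_mem hy, smul_mul_assoc,
      smul_mul_assoc, smul_smul, mul_assoc, ← pow_add, add_one_mul]

theorem two_comm {τ : FormFibre E} (hτ : τ ∈ ⋀[ℝ]^2 (Module.Dual ℝ E)) (β : FormFibre E) :
    τ * β = β * τ := by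
  induction β using left_induction with
  | h0 r => rw [Algebra.commutes]
  | hadd x y hx hy => rw [mul_add, add_mul, hx, hy]
  | hmul x a hx =>
    have h := graded_comm hτ (ι_mem a)
    norm_num at h
    rw [← mul_assoc, h, mul_assoc, hx, mul_assoc]

theorem two_induction {p : FormFibre E → Prop}
    (hmul : ∀ a b : Module.Dual ℝ E, p (ExteriorAlgebra.ι ℝ a * ExteriorAlgebra.ι ℝ b))
    (hadd : ∀ x y, p x → p y → p (x + y)) {τ : FormFibre E}
    (hτ : τ ∈ ⋀[ℝ]^2 (Module.Dual ℝ E)) : p τ := by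
  simp only [pow_two] at hτ
  induction hτ using Submodule.mul_induction_on' with
  | mem_mul_mem m hm n hn =>
    obtain ⟨a, rfl⟩ := hm
    obtain ⟨b, rfl⟩ := hn
    exact hmul a b
  | add x _ y _ hx hy => exact hadd x y hx hy

theorem parity_of_two {τ : FormFibre E} (hτ : τ ∈ ⋀[ℝ]^2 (Module.Dual ℝ E)) : parity τ = τ := by
  rw [parity_of_mem hτ]; norm_num

theorem flat_apply (τ : FormFibre E) (v : E) : flat τ v = ExteriorAlgebra.ιInv (interior v τ) := rfl

theorem flat_add (τ τ' : FormFibre E) : flat (τ + τ') = flat τ + flat τ' := by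
  ext1 v; simp [flat_apply]

theorem ι_flat {τ : FormFibre E} (hτ : τ ∈ ⋀[ℝ]^2 (Module.Dual ℝ E)) (v : E) :
    ExteriorAlgebra.ι ℝ (flat τ v) = interior v τ := by
  obtain ⟨a, ha⟩ := exists_of_mem_one (interior_mem v hτ)
  rw [flat_apply, ← ha, ExteriorAlgebra.ι_leftInverse]

theorem flat_antisymm {τ : FormFibre E} (hτ : τ ∈ ⋀[ℝ]^2 (Module.Dual ℝ E)) (v w : E) :
    flat τ v w = -flat τ w v := by
  have h := interior_comm w v τ
  rw [← ι_flat hτ, ← ι_flat hτ, interior_ι, interior_ι, ← map_neg] at h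
  exact (ExteriorAlgebra.algebraMap_leftInverse _).injective h

theorem flat_ι_mul_ι (a b : Module.Dual ℝ E) (v : E) :
    flat (ExteriorAlgebra.ι ℝ a * ExteriorAlgebra.ι ℝ b) v = a v • b - b v • a := by
  rw [flat_apply, interior_ι_mul, interior_ι, ← Algebra.commutes, ← Algebra.smul_def, map_sub,
    map_smul, map_smul, ExteriorAlgebra.ι_leftInverse, ExteriorAlgebra.ι_leftInverse]

theorem interior_two_mul {τ : FormFibre E} (hτ : τ ∈ ⋀[ℝ]^2 (Module.Dual ℝ E)) (v : E)
    (β : FormFibre E) :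
    interior v (τ * β) = ExteriorAlgebra.ι ℝ (flat τ v) * β + τ * interior v β := by
  rw [interior_mul, parity_of_two hτ, ι_flat hτ]

/-! ### Contraction with a bivector -/

/-- Contraction with the bivector whose associated map from covectors to vectors is `Q`. -/
def bivector (Q : Module.Dual ℝ E →ₗ[ℝ] E) : Module.End ℝ (FormFibre E) :=
  (1 / 2 : ℝ) • ∑ i, interior (♮ i) * interior (Q (♮.coord i))

theorem bivector_apply (Q : Module.Dual ℝ E →ₗ[ℝ] E) (β : FormFibre E) :
    bivector Q β = (1 / 2 : ℝ) • ∑ i, interior (♮ i) (interior (Q (♮.coord i)) β) := by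
  simp [bivector]

theorem bivector_add (Q Q' : Module.Dual ℝ E →ₗ[ℝ] E) :
    bivector (Q + Q') = bivector Q + bivector Q' := by
  refine LinearMap.ext fun β => ?_
  simp [bivector_apply, interior_add, Finset.sum_add_distrib]

@[simp] theorem bivector_algebraMap (Q : Module.Dual ℝ E →ₗ[ℝ] E) (r : ℝ) :
    bivector Q (algebraMap ℝ _ r) = 0 := by
  simp [bivector_apply]

@[simp] theorem bivector_one (Q : Module.Dual ℝ E →ₗ[ℝ] E) : bivector Q 1 = 0 := by
  simp [bivector_apply]

theorem interior_bivector (Q : Module.Dual ℝ E →ₗ[ℝ] E) (v : E) (β : FormFibre E) :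
    interior v (bivector Q β) = bivector Q (interior v β) := by
  simp only [bivector_apply, map_smul, map_sum]
  congr 1
  refine Finset.sum_congr rfl fun i _ => ?_
  rw [interior_comm v, interior_comm v, map_neg, neg_neg]

theorem bivector_bivector (Q Q' : Module.Dual ℝ E →ₗ[ℝ] E) (β : FormFibre E) :
    bivector Q (bivector Q' β) = bivector Q' (bivector Q β) := by
  rw [bivector_apply, bivector_apply Q β, map_smul, map_sum]
  simp only [interior_bivector]

theorem bivector_parity (Q : Module.Dual ℝ E →ₗ[ℝ] E) (β : FormFibre E) :
    bivector Q (parity β) = parity (bivector Q β) := by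
  simp [bivector_apply, interior_parity]

theorem sum_apply_antisymm {Q : Module.Dual ℝ E →ₗ[ℝ] E} (hQ : ∀ a b : Module.Dual ℝ E, a (Q b) = -b (Q a))
    (a : Module.Dual ℝ E) : ∑ i, a (Q (♮.coord i)) • ♮ i = -Q a := by
  simp_rw [hQ a, neg_smul]
  rw [Finset.sum_neg_distrib, sum_coord_smul]

/-- The commutator of `i_Q` with `a ∧ ·` is `-i(Q a)`: the two first-order terms are equal by
antisymmetry, which absorbs the factor `1/2`. -/
theorem bivector_ι_mul {Q : Module.Dual ℝ E →ₗ[ℝ] E} (hQ : ∀ a b : Module.Dual ℝ E, a (Q b) = -b (Q a))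
    (a : Module.Dual ℝ E) (β : FormFibre E) :
    bivector Q (ExteriorAlgebra.ι ℝ a * β) =
      ExteriorAlgebra.ι ℝ a * bivector Q β - interior (Q a) β := by
  have h : ∀ i, interior (♮ i) (interior (Q (♮.coord i)) (ExteriorAlgebra.ι ℝ a * β)) =
      interior (a (Q (♮.coord i)) • ♮ i) β - interior (Q (a (♮ i) • ♮.coord i)) β +
        ExteriorAlgebra.ι ℝ a * interior (♮ i) (interior (Q (♮.coord i)) β) := by
    intro i
    rw [interior_ι_mul, map_sub, map_smul, interior_ι_mul, map_smul, interior_smul, interior_smul]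
    simp only [LinearMap.smul_apply]
    abel
  simp only [bivector_apply, h, Finset.sum_add_distrib, Finset.sum_sub_distrib,
    ← LinearMap.sum_apply, ← interior_sum, ← map_sum, sum_apply_antisymm hQ,
    sum_apply_smul_coord, interior_neg, LinearMap.neg_apply, mul_smul_comm, Finset.mul_sum]
  module

/-- The operator `(1/2) ∑ᵢ [i_{eᵢ}, (R eⁱ) ∧ ·]`, a difference of ordered products. -/
def weight (R : Module.End ℝ (Module.Dual ℝ E)) : Module.End ℝ (FormFibre E) :=
  (1 / 2 : ℝ) • ∑ i, (interior (♮ i) * wedge (R (♮.coord i)) -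
    wedge (R (♮.coord i)) * interior (♮ i))

theorem weight_one_of_mem {k : ℕ} {β : FormFibre E} (hβ : β ∈ ⋀[ℝ]^k (Module.Dual ℝ E)) :
    weight 1 β = ((Module.finrank ℝ E : ℝ) / 2 - k) • β := by
  simp only [weight, LinearMap.smul_apply, LinearMap.sum_apply, LinearMap.sub_apply,
    Module.End.mul_apply, Module.End.one_apply, wedge_apply, Finset.sum_sub_distrib,
    sum_interior_ι_mul hβ, sum_ι_mul_interior hβ]
  module

/-- The generalized Lefschetz relation `[i_Q, τ ∧ ·] = weight (flat τ ∘ Q)`. When `flat τ ∘ Q` is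
the identity this is the `sl₂` relation `[Λ, L] = n - k` on `k`-forms, with `dim E = 2n`; with `τ` a
derivative of `ω` it measures how the symplectic operators vary. -/
theorem bivector_two_mul {Q : Module.Dual ℝ E →ₗ[ℝ] E} (hQ : ∀ a b : Module.Dual ℝ E, a (Q b) = -b (Q a))
    {τ : FormFibre E} (hτ : τ ∈ ⋀[ℝ]^2 (Module.Dual ℝ E)) (β : FormFibre E) :
    bivector Q (τ * β) = τ * bivector Q β + weight (flat τ ∘ₗ Q) β := by
  have h : ∀ i, interior (♮ i) (interior (Q (♮.coord i)) (τ * β)) =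
      interior (♮ i) (ExteriorAlgebra.ι ℝ (flat τ (Q (♮.coord i))) * β) +
        ExteriorAlgebra.ι ℝ (flat τ (♮ i)) * interior (Q (♮.coord i)) β +
          τ * interior (♮ i) (interior (Q (♮.coord i)) β) := by
    intro i
    rw [interior_two_mul hτ, map_add, interior_two_mul hτ, add_assoc]
  -- In the cross term `Q` moves from the contraction to the covector: after expansion in the dual
  -- basis, the antisymmetry of `Q` and that of `τ` give the same coefficient `i(Q (flat τ eⱼ))` up
  -- to sign.
  have h2 : ∑ i, ExteriorAlgebra.ι ℝ (flat τ (♮ i)) * interior (Q (♮.coord i)) β =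
      -∑ i, ExteriorAlgebra.ι ℝ (flat τ (Q (♮.coord i))) * interior (♮ i) β := by
    have e1 : ∀ i, ExteriorAlgebra.ι ℝ (flat τ (♮ i)) * interior (Q (♮.coord i)) β =
        ∑ j, flat τ (♮ i) (♮ j) • (ExteriorAlgebra.ι ℝ (♮.coord j) *
          interior (Q (♮.coord i)) β) := by
      intro i
      conv_lhs => rw [← sum_apply_smul_coord (flat τ (♮ i)), map_sum, Finset.sum_mul]
      simp
    have e2 : ∀ j, ∑ i, flat τ (♮ i) (♮ j) • interior (Q (♮.coord i)) β =
        -interior (Q (flat τ (♮ j))) β := by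
      intro j
      conv_rhs => rw [← sum_apply_smul_coord (flat τ (♮ j)), map_sum, interior_sum]
      simp [flat_antisymm hτ (♮ j), interior_neg, interior_smul]
    have e3 : ∀ i, ExteriorAlgebra.ι ℝ (flat τ (Q (♮.coord i))) * interior (♮ i) β =
        ∑ j, flat τ (Q (♮.coord i)) (♮ j) • (ExteriorAlgebra.ι ℝ (♮.coord j) *
          interior (♮ i) β) := by
      intro i
      conv_lhs => rw [← sum_apply_smul_coord (flat τ (Q (♮.coord i))), map_sum, Finset.sum_mul]
      simp
    have e4 : ∀ j, ∑ i, flat τ (Q (♮.coord i)) (♮ j) • interior (♮ i) β =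
        interior (Q (flat τ (♮ j))) β := by
      intro j
      have h5 : Q (flat τ (♮ j)) = ∑ i, flat τ (Q (♮.coord i)) (♮ j) • ♮ i := by
        rw [← neg_neg (Q _), ← sum_apply_antisymm hQ, ← Finset.sum_neg_distrib]
        refine Finset.sum_congr rfl fun i _ => ?_
        rw [flat_antisymm hτ, neg_smul, neg_neg]
      rw [h5, interior_sum]
      simp [interior_smul]
    simp_rw [e1, e3]
    rw [Finset.sum_comm, Finset.sum_comm (f := fun i j => flat τ (Q (♮.coord i)) (♮ j) • _),
      ← Finset.sum_neg_distrib]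
    refine Finset.sum_congr rfl fun j _ => ?_
    simp only [← mul_smul_comm, ← Finset.mul_sum]
    rw [e2, e4, mul_neg]
  simp only [bivector_apply, h, Finset.sum_add_distrib, h2, weight, LinearMap.smul_apply,
    LinearMap.sum_apply, LinearMap.sub_apply, Module.End.mul_apply, wedge_apply,
    LinearMap.comp_apply, Finset.sum_sub_distrib, mul_smul_comm, Finset.mul_sum]
  module

/-! ### Nondegenerate elements of degree two -/

/-- `P` is inverse to the map `v ↦ σ(v, ·)` of the nondegenerate `2`-form `σ`. -/
structure IsSharp (σ : FormFibre E) (P : Module.Dual ℝ E →ₗ[ℝ] E) : Prop where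
  mem : σ ∈ ⋀[ℝ]^2 (Module.Dual ℝ E)
  sharp_flat : ∀ v, P (flat σ v) = v
  flat_sharp : ∀ a, flat σ (P a) = a

/-- The bilinear form on covectors with `(a, b) ↦ b (P a)`. -/
def coForm (P : Module.Dual ℝ E →ₗ[ℝ] E) : Module.Dual ℝ E →ₗ[ℝ] Module.Dual ℝ (Module.Dual ℝ E) :=
  Module.Dual.eval ℝ E ∘ₗ P

theorem coForm_apply (P : Module.Dual ℝ E →ₗ[ℝ] E) (a b : Module.Dual ℝ E) :
    coForm P a b = b (P a) := rfl

/-- The contraction with the bivector dual to `τ`; it is the adjoint of `τ ∧ ·`. -/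
def coLefschetz (P : Module.Dual ℝ E →ₗ[ℝ] E) (τ : FormFibre E) : Module.End ℝ (FormFibre E) :=
  bivector (P ∘ₗ flat τ ∘ₗ P)

theorem coLefschetz_add (P : Module.Dual ℝ E →ₗ[ℝ] E) (τ τ' : FormFibre E) :
    coLefschetz P (τ + τ') = coLefschetz P τ + coLefschetz P τ' := by
  rw [coLefschetz, flat_add, LinearMap.add_comp, LinearMap.comp_add, bivector_add]; rfl

/-- The volume form `σⁿ / n!`. -/
def volume (σ : FormFibre E) : FormFibre E :=
  ((Nat.factorial (Module.finrank ℝ E / 2) : ℝ))⁻¹ • σ ^ (Module.finrank ℝ E / 2)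

/-- The explicit star operator, `a₁ ∧ … ∧ aₖ ↦ (-1)ᵏ i(P aₖ) ⋯ i(P a₁) vol`. -/
def starOp (P : Module.Dual ℝ E →ₗ[ℝ] E) (σ : FormFibre E) : Module.End ℝ (FormFibre E) where
  toFun β := (contraction (-coForm P) β).unop (volume σ)
  map_add' := by simp
  map_smul' := by simp

theorem starOp_algebraMap (P : Module.Dual ℝ E →ₗ[ℝ] E) (σ : FormFibre E) (r : ℝ) :
    starOp P σ (algebraMap ℝ _ r) = r • volume σ := by
  simp [starOp, Algebra.algebraMap_eq_smul_one]

theorem starOp_mul_ι (P : Module.Dual ℝ E →ₗ[ℝ] E) (σ β : FormFibre E) (b : Module.Dual ℝ E) :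
    starOp P σ (β * ExteriorAlgebra.ι ℝ b) = -interior (P b) (starOp P σ β) := by
  change (contraction (-coForm P) (β * ExteriorAlgebra.ι ℝ b)).unop (volume σ) = _
  rw [map_mul, MulOpposite.unop_mul, Module.End.mul_apply, contraction_ι, LinearMap.neg_apply,
    map_neg]
  rfl

theorem starOp_ι_mul (P : Module.Dual ℝ E →ₗ[ℝ] E) (σ β : FormFibre E) (b : Module.Dual ℝ E) :
    starOp P σ (ExteriorAlgebra.ι ℝ b * β) = -interior (P b) (starOp P σ (parity β)) := by
  rw [ι_mul_eq, starOp_mul_ι]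

namespace IsSharp

variable {σ : FormFibre E} {P : Module.Dual ℝ E →ₗ[ℝ] E} (h : IsSharp σ P)
include h

theorem antisymm (a b : Module.Dual ℝ E) : a (P b) = -b (P a) := by
  conv_lhs => rw [← h.flat_sharp a, flat_antisymm h.mem, h.flat_sharp]

theorem antisymm_comp {τ : FormFibre E} (hτ : τ ∈ ⋀[ℝ]^2 (Module.Dual ℝ E))
    (a b : Module.Dual ℝ E) : a ((P ∘ₗ flat τ ∘ₗ P) b) = -b ((P ∘ₗ flat τ ∘ₗ P) a) := by
  simp only [LinearMap.comp_apply]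
  rw [h.antisymm, flat_antisymm hτ, neg_neg, h.antisymm]

theorem surjective_coForm : Function.Surjective (coForm P) :=
  (Module.evalEquiv ℝ E).surjective.comp fun v => ⟨_, h.sharp_flat v⟩

theorem pow_mem (r : ℕ) : σ ^ r ∈ ⋀[ℝ]^(2 * r) (Module.Dual ℝ E) := by
  have := SetLike.pow_mem_graded (A := fun i : ℕ => ⋀[ℝ]^i (Module.Dual ℝ E)) r h.mem
  rwa [smul_eq_mul, mul_comm] at this

/-- The `sl₂` computation: with `n = dim E / 2`, the coefficient is the sum of the weights `n - 2s`
of `σˢ` for `s ≤ r`. -/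
theorem bivector_pow (r : ℕ) : bivector P (σ ^ (r + 1)) =
    (((r : ℝ) + 1) * ((Module.finrank ℝ E : ℝ) / 2 - r)) • σ ^ r := by
  have h1 : flat σ ∘ₗ P = 1 := LinearMap.ext h.flat_sharp
  induction r with
  | zero =>
    rw [pow_succ', bivector_two_mul h.antisymm h.mem, h1, weight_one_of_mem (h.pow_mem 0)]
    simp
  | succ r ih =>
    rw [pow_succ', bivector_two_mul h.antisymm h.mem, h1, weight_one_of_mem (h.pow_mem _), ih,
      mul_smul_comm, ← pow_succ', ← add_smul]
    congr 1; push_cast; ring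

/-- If `dim E` were odd, the coefficient in `bivector_pow` would never vanish, so no power of `σ`
would be zero; but powers of degree above `dim E` are. -/
theorem even_finrank : Even (Module.finrank ℝ E) := by
  by_contra hodd
  have hne : ∀ r : ℕ, σ ^ r ≠ 0 := by
    intro r
    induction r with
    | zero => simp
    | succ r ih =>
      intro h0
      have h1 := h.bivector_pow r
      rw [h0, map_zero, eq_comm, smul_eq_zero] at h1
      refine h1.elim (fun h2 => ?_) ih
      rcases mul_eq_zero.mp h2 with h3 | h3
      · linarith [(Nat.cast_nonneg r : (0 : ℝ) ≤ r)]
      · apply hodd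
        refine ⟨r, ?_⟩
        have : (Module.finrank ℝ E : ℝ) = ((r + r : ℕ) : ℝ) := by push_cast; linarith
        exact_mod_cast this
  exact hne _ (eq_zero_of_mem (by omega) (h.pow_mem (Module.finrank ℝ E + 1)))

theorem two_mul_half : 2 * (Module.finrank ℝ E / 2) = Module.finrank ℝ E :=
  Nat.two_mul_div_two_of_even h.even_finrank

theorem volume_mem : volume σ ∈ ⋀[ℝ]^(Module.finrank ℝ E) (Module.Dual ℝ E) := by
  have := h.pow_mem (Module.finrank ℝ E / 2)
  rw [h.two_mul_half] at this
  exact Submodule.smul_mem _ _ this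

theorem mul_volume {k : ℕ} {x : FormFibre E} (hx : x ∈ ⋀[ℝ]^(k + 1) (Module.Dual ℝ E)) :
    x * volume σ = 0 :=
  eq_zero_of_mem (k := k + 1 + Module.finrank ℝ E) (by omega) (mul_mem_deg hx h.volume_mem)

theorem half_eq : ((Module.finrank ℝ E / 2 : ℕ) : ℝ) = (Module.finrank ℝ E : ℝ) / 2 := by
  have : ((2 * (Module.finrank ℝ E / 2) : ℕ) : ℝ) = Module.finrank ℝ E := by rw [h.two_mul_half]
  push_cast at this
  linarith

theorem bivector_iterate (r : ℕ) (hr : r ≤ Module.finrank ℝ E / 2) :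
    (bivector P ^ r) (σ ^ (Module.finrank ℝ E / 2)) =
      ((Nat.descFactorial (Module.finrank ℝ E / 2) r : ℝ) * Nat.factorial r) •
        σ ^ (Module.finrank ℝ E / 2 - r) := by
  induction r with
  | zero => simp
  | succ r ih =>
    obtain ⟨s, hs⟩ : ∃ s, Module.finrank ℝ E / 2 = s + r + 1 := ⟨Module.finrank ℝ E / 2 - r - 1, by omega⟩
    have e1 : Module.finrank ℝ E / 2 - r = s + 1 := by omega
    have e2 : Module.finrank ℝ E / 2 - (r + 1) = s := by omega
    rw [pow_succ', Module.End.mul_apply, ih (by omega), map_smul, e1, e2, h.bivector_pow, smul_smul,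
      ← h.half_eq, Nat.descFactorial_succ, Nat.factorial_succ, e1]
    congr 1
    rw [hs]; push_cast; ring

theorem starOp_parity (β : FormFibre E) : starOp P σ (parity β) = parity (starOp P σ β) := by
  induction β using left_induction with
  | h0 r =>
    have : parity (volume σ) = volume σ := by
      rw [parity_of_mem h.volume_mem, h.even_finrank.neg_one_pow, one_smul]
    simp [starOp_algebraMap, this]
  | hadd x y hx hy => simp [hx, hy]
  | hmul x a hx =>
    rw [map_mul, parity_ι, neg_mul, map_neg, starOp_ι_mul, starOp_ι_mul, parity_parity, map_neg,
      hx, neg_neg, interior_parity, map_neg, parity_parity, neg_neg]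

/-- By construction the star turns wedge products into contractions; this is the converse. It rests
on the vanishing of products of covectors with the volume form, and is what makes the star an
involution. -/
theorem starOp_interior (v : E) (β : FormFibre E) :
    starOp P σ (interior v β) = -(ExteriorAlgebra.ι ℝ (flat σ v) * starOp P σ (parity β)) := by
  induction β using left_induction with
  | h0 r =>
    simp only [interior_algebraMap, map_zero, AlgHom.commutes, starOp_algebraMap, mul_smul_comm]
    rw [h.mul_volume (k := 0) (ι_mem _), smul_zero, neg_zero]
  | hadd x y hx hy => simp [mul_add, hx, hy]; abel
  | hmul x a hx =>
    have h1 : starOp P σ (parity (ExteriorAlgebra.ι ℝ a * x)) =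
        interior (P a) (starOp P σ x) := by
      rw [map_mul, parity_ι, neg_mul, map_neg, starOp_ι_mul, parity_parity, neg_neg]
    have h2 : parity (ExteriorAlgebra.ι ℝ (flat σ v) * starOp P σ (parity x)) =
        -(ExteriorAlgebra.ι ℝ (flat σ v) * starOp P σ x) := by
      rw [map_mul, ← h.starOp_parity, parity_parity, parity_ι, neg_mul]
    rw [h1, interior_ι_mul, map_sub, map_smul, starOp_ι_mul, h.starOp_parity, hx, map_neg, h2,
      neg_neg, interior_ι_mul, flat_antisymm h.mem, h.flat_sharp]
    simp

theorem starOp_mem {k : ℕ} (hk : k ≤ Module.finrank ℝ E) {β : FormFibre E}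
    (hβ : β ∈ ⋀[ℝ]^k (Module.Dual ℝ E)) :
    starOp P σ β ∈ ⋀[ℝ]^(Module.finrank ℝ E - k) (Module.Dual ℝ E) := by
  refine mem_induction (p := fun k β => k ≤ Module.finrank ℝ E →
    starOp P σ β ∈ ⋀[ℝ]^(Module.finrank ℝ E - k) (Module.Dual ℝ E)) ?_ ?_ ?_ hβ hk
  · intro r _
    rw [starOp_algebraMap]
    exact Submodule.smul_mem _ _ h.volume_mem
  · intro k x y hx hy hk
    rw [map_add]
    exact add_mem (hx hk) (hy hk)
  · intro k a x hx ih hk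
    rw [starOp_ι_mul, parity_of_mem hx, map_smul, map_smul]
    refine neg_mem (Submodule.smul_mem _ _ (interior_mem _ ?_))
    have := ih (by omega)
    rwa [show Module.finrank ℝ E - k = Module.finrank ℝ E - (k + 1) + 1 by omega] at this

/-- Induction on `β`: the relation `i(P b)(α ∧ ⋆x) = 0` moves the contraction from `⋆x` to `α`,
where it is the adjoint of `b ∧ ·`. -/
theorem mul_starOp {k : ℕ} (hk : k ≤ Module.finrank ℝ E) {α β : FormFibre E}
    (hα : α ∈ ⋀[ℝ]^k (Module.Dual ℝ E)) (hβ : β ∈ ⋀[ℝ]^k (Module.Dual ℝ E)) :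
    α * starOp P σ β = pairingBilin (coForm P) α β • volume σ := by
  refine mem_induction (p := fun k β => k ≤ Module.finrank ℝ E → ∀ α ∈ ⋀[ℝ]^k (Module.Dual ℝ E),
    α * starOp P σ β = pairingBilin (coForm P) α β • volume σ) ?_ ?_ ?_ hβ hk α hα
  · intro r _ α hα
    obtain ⟨s, rfl⟩ := exists_of_mem_zero hα
    rw [starOp_algebraMap, pairingBilin_algebraMap, scalar_algebraMap, ← Algebra.smul_def,
      smul_smul]
  · intro k x y hx hy hk α hα
    rw [map_add, mul_add, hx hk α hα, hy hk α hα, map_add, add_smul]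
  · intro k b x hx ih hk α hα
    have h1 : CliffordAlgebra.contractLeft ((coForm P).flip b) α = -interior (P b) α := by
      have h0 : (coForm P).flip b = Module.Dual.eval ℝ E (-P b) :=
        LinearMap.ext fun a => by simp [coForm_apply, h.antisymm a b]
      rw [← LinearMap.neg_apply, ← interior_neg, h0]
      rfl
    -- The product has degree `(k + 1) + (dim E - k)`, one more than the dimension.
    have h2 : interior (P b) (α * starOp P σ x) = 0 := by
      rw [eq_zero_of_mem (k := k + 1 + (Module.finrank ℝ E - k)) (by omega)
        (mul_mem_deg hα (h.starOp_mem (by omega) hx)), map_zero]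
    rw [interior_mul, parity_of_mem hα, smul_mul_assoc] at h2
    rw [pairingBilin_mul_ι, h1, ← ih (by omega) _ (neg_mem (interior_mem _ hα)), starOp_ι_mul,
      parity_of_mem hx, map_smul, map_smul, neg_mul, eq_neg_of_add_eq_zero_left h2, pow_succ,
      mul_neg, mul_smul_comm]
    simp

end IsSharp

end FormFibre

end

/-! ### Star operator and adjoints for a nondegenerate `2`-form -/

noncomputable section

namespace FormFibre

variable {E : Type*} [NormedAddCommGroup E] [NormedSpace ℝ E] [FiniteDimensional ℝ E]

local notation "♮" => Module.finBasis ℝ E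

theorem weight_parity (R : Module.End ℝ (Module.Dual ℝ E)) (β : FormFibre E) :
    weight R (parity β) = parity (weight R β) := by
  have h : ∀ (a : Module.Dual ℝ E) (γ : FormFibre E),
      ExteriorAlgebra.ι ℝ a * parity γ = -parity (ExteriorAlgebra.ι ℝ a * γ) := fun a γ => by
    rw [map_mul, parity_ι, neg_mul, neg_neg]
  simp only [weight, LinearMap.smul_apply, LinearMap.sum_apply, LinearMap.sub_apply,
    Module.End.mul_apply, wedge_apply, interior_parity, h, map_smul, map_sum, map_sub, map_neg,
    neg_neg]

/-- The property that characterizes star operators. -/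
def IsStar (c : Module.Dual ℝ E →ₗ[ℝ] Module.Dual ℝ (Module.Dual ℝ E)) (vol : FormFibre E)
    (s : Module.End ℝ (FormFibre E)) : Prop :=
  ∀ k ≤ Module.finrank ℝ E, ∀ β ∈ ⋀[ℝ]^k (Module.Dual ℝ E),
    s β ∈ ⋀[ℝ]^(Module.finrank ℝ E - k) (Module.Dual ℝ E) ∧
    ∀ α ∈ ⋀[ℝ]^k (Module.Dual ℝ E), α * s β = pairingBilin c α β • vol

/-- Uniqueness comes from the nondegeneracy of the wedge product into the top degree. -/
theorem star_eq {c : Module.Dual ℝ E →ₗ[ℝ] Module.Dual ℝ (Module.Dual ℝ E)} {vol : FormFibre E}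
    {s : Module.End ℝ (FormFibre E)} (hs : IsStar c vol s) : star c vol = s := by
  have h1 : IsStar c vol (star c vol) := by
    have h2 := Classical.epsilon_spec (p := fun s : Module.End ℝ (FormFibre E) =>
      ∀ k ≤ Module.finrank ℝ E, ∀ β ∈ ⋀[ℝ]^k (Module.Dual ℝ E),
        s β ∈ ⋀[ℝ]^(Module.finrank ℝ E - k) (Module.Dual ℝ E) ∧
        ∀ α ∈ ⋀[ℝ]^k (Module.Dual ℝ E), α * s β = pairing c α β • vol)
      ⟨s, by simpa only [IsStar, ← pairing_eq] using hs⟩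
    simp only [IsStar, ← pairing_eq]
    exact h2
  refine hom_ext_deg fun k hk β hβ => sub_eq_zero.mp ?_
  refine eq_zero_of_mul_eq_zero (k := k) (l := Module.finrank ℝ E - k) (by omega)
    (sub_mem (h1 k hk β hβ).1 (hs k hk β hβ).1) fun α hα => ?_
  rw [mul_sub, (h1 k hk β hβ).2 α hα, (hs k hk β hβ).2 α hα, sub_self]

theorem adjoint_wedge {P : Module.Dual ℝ E →ₗ[ℝ] E} (hP : Function.Surjective (coForm P))
    (a : Module.Dual ℝ E) : adjoint (coForm P) (wedge a) = interior (P a) :=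
  adjoint_eq hP fun α β => pairingBilin_ι_mul _ a α β

namespace IsSharp

variable {σ : FormFibre E} {P : Module.Dual ℝ E →ₗ[ℝ] E} (h : IsSharp σ P)
include h

theorem isStar : IsStar (coForm P) (volume σ) (starOp P σ) := fun _ hk _ hβ =>
  ⟨h.starOp_mem hk hβ, fun _ hα => h.mul_starOp hk hα hβ⟩

theorem star_eq_starOp : star (coForm P) (volume σ) = starOp P σ := star_eq h.isStar

theorem coLefschetz_ι_mul_ι (a b : Module.Dual ℝ E) :
    coLefschetz P (ExteriorAlgebra.ι ℝ a * ExteriorAlgebra.ι ℝ b) =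
      interior (P b) * interior (P a) := by
  refine LinearMap.ext fun β => ?_
  have h1 : ∀ i, interior (♮ i) (interior ((P ∘ₗ flat (ExteriorAlgebra.ι ℝ a *
      ExteriorAlgebra.ι ℝ b) ∘ₗ P) (♮.coord i)) β) =
      interior (a (P (♮.coord i)) • ♮ i) (interior (P b) β) -
        interior (b (P (♮.coord i)) • ♮ i) (interior (P a) β) := by
    intro i
    simp only [LinearMap.comp_apply, flat_ι_mul_ι, map_smul, sub_eq_add_neg, interior_add,
      interior_neg, interior_smul, LinearMap.add_apply, LinearMap.neg_apply, LinearMap.smul_apply,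
      map_add, map_neg]
  rw [coLefschetz, bivector_apply]
  simp only [h1, Finset.sum_sub_distrib, ← LinearMap.sum_apply, ← interior_sum,
    sum_apply_antisymm h.antisymm, interior_neg, LinearMap.neg_apply, Module.End.mul_apply]
  rw [interior_comm (P a) (P b)]
  module

theorem coLefschetz_self : coLefschetz P σ = bivector P := by
  rw [coLefschetz]
  congr 1
  exact LinearMap.ext fun a => by simp [h.flat_sharp]

theorem adjoint_mulLeft {τ : FormFibre E} (hτ : τ ∈ ⋀[ℝ]^2 (Module.Dual ℝ E)) :
    adjoint (coForm P) (LinearMap.mulLeft ℝ τ) = coLefschetz P τ := by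
  refine two_induction (p := fun τ => adjoint (coForm P) (LinearMap.mulLeft ℝ τ) =
    coLefschetz P τ) (fun a b => ?_) (fun x y hx hy => ?_) hτ
  · have h1 : LinearMap.mulLeft ℝ (ExteriorAlgebra.ι ℝ a * ExteriorAlgebra.ι ℝ b : FormFibre E) =
        wedge a * wedge b := LinearMap.ext fun β => mul_assoc _ _ _
    rw [h1, adjoint_mul h.surjective_coForm, adjoint_wedge h.surjective_coForm,
      adjoint_wedge h.surjective_coForm, h.coLefschetz_ι_mul_ι]
  · have h1 : LinearMap.mulLeft ℝ (x + y) = LinearMap.mulLeft ℝ x + LinearMap.mulLeft ℝ y :=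
      LinearMap.ext fun β => add_mul _ _ _
    rw [h1, adjoint_add h.surjective_coForm, hx, hy, coLefschetz_add]

theorem adjoint_interior (v : E) :
    adjoint (coForm P) (interior v) = wedge (-flat σ v) := by
  refine adjoint_eq h.surjective_coForm fun α β => ?_
  have h1 : (coForm P).flip (-flat σ v) = Module.Dual.eval ℝ E v :=
    LinearMap.ext fun a => by
      simp [coForm_apply, flat_antisymm h.mem, h.flat_sharp]
  rw [wedge_apply, pairingBilin_mul_ι, h1]
  rfl

/-- Taking adjoints turns `½ ∑ i(eᵢ) i(P eⁱ)` into multiplication by `½ ∑ eⁱ ∧ i(eᵢ)σ`, which is `σ`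
by Euler's identity in degree two. -/
theorem adjoint_bivector : adjoint (coForm P) (bivector P) = LinearMap.mulLeft ℝ σ := by
  have h1 := h.surjective_coForm
  refine adjoint_eq h1 fun α β => ?_
  have h2 : ∀ i, pairingBilin (coForm P) (interior (♮ i) (interior (P (♮.coord i)) α)) β =
      pairingBilin (coForm P) α (ExteriorAlgebra.ι ℝ (♮.coord i) *
        interior (♮ i) σ * β) := by
    intro i
    rw [pairing_adjoint h1, pairing_adjoint h1, h.adjoint_interior, h.adjoint_interior,
      h.flat_sharp, ← ι_flat h.mem]
    simp [mul_assoc]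
  rw [bivector_apply, map_smul, LinearMap.smul_apply, map_sum, LinearMap.sum_apply]
  simp only [h2]
  rw [← map_sum, ← Finset.sum_mul, sum_ι_mul_interior h.mem, smul_mul_assoc, map_smul, smul_smul]
  norm_num

theorem coLefschetz_two_mul {τ : FormFibre E} (hτ : τ ∈ ⋀[ℝ]^2 (Module.Dual ℝ E))
    (β : FormFibre E) :
    coLefschetz P τ (σ * β) = σ * coLefschetz P τ β + weight (flat τ ∘ₗ P) β := by
  rw [coLefschetz, bivector_two_mul (h.antisymm_comp hτ) h.mem]
  congr 3
  exact LinearMap.ext fun a => by simp [h.flat_sharp]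

/-- The star conjugates the product with `τ` into contraction with the dual bivector; on
decomposable `τ` this is two applications of `starOp_ι_mul`. -/
theorem starOp_two_mul {τ : FormFibre E} (hτ : τ ∈ ⋀[ℝ]^2 (Module.Dual ℝ E)) (β : FormFibre E) :
    starOp P σ (τ * β) = coLefschetz P τ (starOp P σ β) := by
  refine two_induction (p := fun τ => starOp P σ (τ * β) = coLefschetz P τ (starOp P σ β))
    (fun a b => ?_) (fun x y hx hy => ?_) hτ
  · rw [mul_assoc, starOp_ι_mul, map_mul, parity_ι, neg_mul, map_neg, starOp_ι_mul, parity_parity,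
      neg_neg, h.coLefschetz_ι_mul_ι, interior_comm, neg_neg]
    rfl
  · rw [add_mul, map_add, hx, hy, coLefschetz_add, LinearMap.add_apply]

/-- With `n = dim E / 2`, the star of `σⁿ` is `Λⁿ` applied to the volume, and `Λⁿ σⁿ = (n!)²`
cancels the two normalizing factors `1 / n!`. -/
theorem starOp_volume : starOp P σ (volume σ) = 1 := by
  have h1 : ∀ r : ℕ, starOp P σ (σ ^ r) = (bivector P ^ r) (volume σ) := by
    intro r
    induction r with
    | zero => simpa using starOp_algebraMap P σ 1
    | succ r ih =>
      rw [pow_succ', h.starOp_two_mul h.mem, ih, h.coLefschetz_self, pow_succ',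
        Module.End.mul_apply]
  have h2 : starOp P σ (volume σ) = ((Nat.factorial (Module.finrank ℝ E / 2) : ℝ))⁻¹ •
      (bivector P ^ (Module.finrank ℝ E / 2)) (volume σ) := by
    conv_lhs => rw [volume, map_smul, h1]
  rw [h2, volume, map_smul, h.bivector_iterate _ le_rfl, Nat.descFactorial_self, smul_smul,
    smul_smul]
  have := Nat.factorial_ne_zero (Module.finrank ℝ E / 2)
  simp
  field_simp
  simp

theorem starOp_starOp (β : FormFibre E) : starOp P σ (starOp P σ β) = β := by
  induction β using left_induction with
  | h0 r =>
    rw [starOp_algebraMap, map_smul, h.starOp_volume, Algebra.algebraMap_eq_smul_one]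
  | hadd x y hx hy => rw [map_add, map_add, hx, hy]
  | hmul x a hx =>
    rw [starOp_ι_mul, map_neg, h.starOp_interior, h.flat_sharp, ← h.starOp_parity, parity_parity,
      hx, neg_neg]

theorem starOp_bivector (β : FormFibre E) :
    starOp P σ (bivector P β) = σ * starOp P σ β := by
  have h1 := h.starOp_two_mul h.mem (starOp P σ β)
  rw [h.starOp_starOp, h.coLefschetz_self] at h1
  rw [← h1, h.starOp_starOp]

/-- `weight (flat τ ∘ P)` is `[Λ, τ ∧ ·]` and also `[Λ_τ, σ ∧ ·]`. The star exchanges `Λ` with `σ ∧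
·` and `τ ∧ ·` with `Λ_τ`, which carries the first commutator to minus the second. -/
theorem starOp_weight {τ : FormFibre E} (hτ : τ ∈ ⋀[ℝ]^2 (Module.Dual ℝ E)) (β : FormFibre E) :
    starOp P σ (weight (flat τ ∘ₗ P) β) = -weight (flat τ ∘ₗ P) (starOp P σ β) := by
  have h1 := bivector_two_mul h.antisymm hτ β
  have h2 := h.coLefschetz_two_mul hτ (starOp P σ β)
  rw [eq_sub_of_add_eq' h1.symm, map_sub, h.starOp_bivector, h.starOp_two_mul hτ,
    h.starOp_two_mul hτ, h.starOp_bivector, h2]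
  abel

theorem starOp_ι_mul_starOp (a : Module.Dual ℝ E) (β : FormFibre E) :
    starOp P σ (ExteriorAlgebra.ι ℝ a * starOp P σ (parity β)) = -interior (P a) β := by
  rw [starOp_ι_mul, ← h.starOp_parity, parity_parity, h.starOp_starOp]

theorem starOp_ι_mul_weight {τ : FormFibre E} (hτ : τ ∈ ⋀[ℝ]^2 (Module.Dual ℝ E))
    (a : Module.Dual ℝ E) (β : FormFibre E) :
    starOp P σ (ExteriorAlgebra.ι ℝ a * weight (flat τ ∘ₗ P) (starOp P σ (parity β))) =
      interior (P a) (weight (flat τ ∘ₗ P) β) := by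
  rw [starOp_ι_mul, ← weight_parity, ← h.starOp_parity, parity_parity, h.starOp_weight hτ,
    h.starOp_starOp, map_neg, neg_neg]

/-- Commute `i(v)` past `[Λ, τ ∧ ·]`: it commutes with `Λ`, and its commutator with `τ ∧ ·` is the
product with `flat τ v`, whose commutator with `Λ` is a contraction. -/
theorem interior_weight {τ : FormFibre E} (hτ : τ ∈ ⋀[ℝ]^2 (Module.Dual ℝ E)) (v : E)
    (β : FormFibre E) :
    interior v (weight (flat τ ∘ₗ P) β) =
      weight (flat τ ∘ₗ P) (interior v β) - interior (P (flat τ v)) β := by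
  have h1 := bivector_two_mul h.antisymm hτ β
  have h2 := bivector_two_mul h.antisymm hτ (interior v β)
  rw [eq_sub_of_add_eq' h1.symm, eq_sub_of_add_eq' h2.symm, map_sub, interior_bivector,
    interior_two_mul hτ, interior_two_mul hτ, map_add, bivector_ι_mul h.antisymm,
    interior_bivector]
  abel

theorem adjoint_ι_mul {τ : FormFibre E} (hτ : τ ∈ ⋀[ℝ]^2 (Module.Dual ℝ E))
    (a : Module.Dual ℝ E) :
    adjoint (coForm P) (LinearMap.mulLeft ℝ (ExteriorAlgebra.ι ℝ a * τ)) =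
      coLefschetz P τ * interior (P a) := by
  have h1 : LinearMap.mulLeft ℝ (ExteriorAlgebra.ι ℝ a * τ : FormFibre E) =
      wedge a * LinearMap.mulLeft ℝ τ := LinearMap.ext fun β => mul_assoc _ _ _
  rw [h1, adjoint_mul h.surjective_coForm, adjoint_wedge h.surjective_coForm, h.adjoint_mulLeft hτ]

/-- The pointwise content of `d^ω + [Λ, [d, L]]^ω = [i_π, d]`, for `a = eⁱ` and `τ = ∂ᵢω`: `a ∧ Λ_τ`
comes from the derivative of `π`, the adjoint from the correction term, and the right-hand side from
the derivative of `⋆_ω`. -/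
theorem ι_mul_coLefschetz_sub_adjoint {τ : FormFibre E} (hτ : τ ∈ ⋀[ℝ]^2 (Module.Dual ℝ E))
    (a : Module.Dual ℝ E) (β : FormFibre E) :
    ExteriorAlgebra.ι ℝ a * coLefschetz P τ β -
      adjoint (coForm P) (bivector P * LinearMap.mulLeft ℝ (ExteriorAlgebra.ι ℝ a * τ) -
        LinearMap.mulLeft ℝ (ExteriorAlgebra.ι ℝ a * τ) * bivector P) β =
      -interior (P a) (weight (flat τ ∘ₗ P) β) := by
  rw [adjoint_sub h.surjective_coForm, adjoint_mul h.surjective_coForm,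
    adjoint_mul h.surjective_coForm, h.adjoint_ι_mul hτ, h.adjoint_bivector,
    LinearMap.sub_apply, Module.End.mul_apply, Module.End.mul_apply, Module.End.mul_apply,
    Module.End.mul_apply, LinearMap.mulLeft_apply, LinearMap.mulLeft_apply,
    interior_two_mul h.mem, h.flat_sharp, map_add, h.coLefschetz_two_mul hτ,
    h.interior_weight hτ]
  rw [coLefschetz, bivector_ι_mul (h.antisymm_comp hτ)]
  simp only [LinearMap.comp_apply]
  abel

end IsSharp

end FormFibre

end

noncomputable section

namespace FormFibre

variable {E : Type*} [NormedAddCommGroup E] [NormedSpace ℝ E] [FiniteDimensional ℝ E]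

/-! ### Pullback -/

@[simp] theorem pullback_ι (A : E →ₗ[ℝ] E) (a : Module.Dual ℝ E) :
    pullback A (ExteriorAlgebra.ι ℝ a) = ExteriorAlgebra.ι ℝ (a ∘ₗ A) := by
  simp [pullback]; rfl

theorem pullback_pullback (A B : E →ₗ[ℝ] E) (β : FormFibre E) :
    pullback A (pullback B β) = pullback (B ∘ₗ A) β := by
  induction β using left_induction with
  | h0 r => simp
  | hadd x y hx hy => simp [hx, hy]
  | hmul x a hx => simp [hx, LinearMap.comp_assoc]

theorem pullback_id (β : FormFibre E) : pullback LinearMap.id β = β := by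
  induction β using left_induction with
  | h0 r => simp
  | hadd x y hx hy => simp [hx, hy]
  | hmul x a hx => simp [hx]

theorem pullback_neg_id (β : FormFibre E) : pullback (-LinearMap.id) β = parity β := by
  induction β using left_induction with
  | h0 r => simp
  | hadd x y hx hy => simp [hx, hy]
  | hmul x a hx => rw [map_mul, map_mul, hx, pullback_ι, parity_ι, LinearMap.comp_neg, map_neg]; rfl

theorem pullback_parity (A : E →ₗ[ℝ] E) (β : FormFibre E) :
    pullback A (parity β) = parity (pullback A β) := by
  rw [← pullback_neg_id, ← pullback_neg_id, pullback_pullback, pullback_pullback]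
  congr 2
  ext v; simp

theorem pullback_mem (A : E →ₗ[ℝ] E) {k : ℕ} {β : FormFibre E}
    (hβ : β ∈ ⋀[ℝ]^k (Module.Dual ℝ E)) : pullback A β ∈ ⋀[ℝ]^k (Module.Dual ℝ E) := by
  refine mem_induction (p := fun k β => pullback A β ∈ ⋀[ℝ]^k (Module.Dual ℝ E)) ?_ ?_ ?_ hβ
  · intro r; rw [AlgHom.commutes]; exact algebraMap_mem r
  · intro k x y hx hy; rw [map_add]; exact add_mem hx hy
  · intro k a x _ ih; rw [map_mul, pullback_ι]; exact ι_mul_mem _ ih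

theorem interior_pullback (A : E →ₗ[ℝ] E) (v : E) (β : FormFibre E) :
    interior v (pullback A β) = pullback A (interior (A v) β) := by
  induction β using left_induction with
  | h0 r => simp
  | hadd x y hx hy => simp [hx, hy]
  | hmul x a hx => simp [interior_ι_mul, hx]

theorem scalar_pullback (A : E →ₗ[ℝ] E) (β : FormFibre E) : scalar (pullback A β) = scalar β := by
  induction β using left_induction with
  | h0 r => simp
  | hadd x y hx hy => simp [hx, hy]
  | hmul x a hx => simp

theorem flat_pullback (A : E →ₗ[ℝ] E) {τ : FormFibre E} (hτ : τ ∈ ⋀[ℝ]^2 (Module.Dual ℝ E))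
    (v : E) : flat (pullback A τ) v = flat τ (A v) ∘ₗ A := by
  rw [flat_apply, interior_pullback, ← ι_flat hτ, pullback_ι, ExteriorAlgebra.ι_leftInverse]

theorem volume_pullback (A : E →ₗ[ℝ] E) (σ : FormFibre E) :
    volume (pullback A σ) = pullback A (volume σ) := by
  simp [volume]

theorem eq_of_flat_eq {τ τ' : FormFibre E} (hτ : τ ∈ ⋀[ℝ]^2 (Module.Dual ℝ E))
    (hτ' : τ' ∈ ⋀[ℝ]^2 (Module.Dual ℝ E)) (h : ∀ v w, flat τ v w = flat τ' v w) : τ = τ' := by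
  refine sub_eq_zero.mp (eq_zero_of_interior_eq_zero (k := 1) (sub_mem hτ hτ') fun v => ?_)
  rw [map_sub, ← ι_flat hτ, ← ι_flat hτ', LinearMap.ext (h v), sub_self]

namespace IsSharp

variable {σ : FormFibre E} {P P' : Module.Dual ℝ E →ₗ[ℝ] E} (h : IsSharp σ P)
include h

theorem of_pullback {A B : E →ₗ[ℝ] E} (hAB : ∀ v, A (B v) = v) (hBA : ∀ v, B (A v) = v) :
    IsSharp (pullback A σ) (B ∘ₗ P ∘ₗ B.dualMap) where
  mem := pullback_mem A h.mem
  sharp_flat v := by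
    have : B.dualMap (flat σ (A v) ∘ₗ A) = flat σ (A v) := LinearMap.ext fun w => by simp [hAB]
    rw [flat_pullback A h.mem, LinearMap.comp_apply, LinearMap.comp_apply, this, h.sharp_flat, hBA]
  flat_sharp a := by
    rw [flat_pullback A h.mem]
    exact LinearMap.ext fun w => by simp [hAB, hBA, h.flat_sharp]

variable {A : E →ₗ[ℝ] E}

/-- Naturality of the inverse bivector. It makes contraction with the bivector and the star commute
with pullback, hence independent of the chart. -/
theorem map_sharp_comp (hA : Function.Surjective A) (h' : IsSharp (pullback A σ) P')
    (b : Module.Dual ℝ E) : A (P' (b ∘ₗ A)) = P b := by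
  have h1 := h'.flat_sharp (b ∘ₗ A)
  rw [flat_pullback A h.mem] at h1
  have h2 : flat σ (A (P' (b ∘ₗ A))) = b := LinearMap.ext fun w => by
    obtain ⟨v, rfl⟩ := hA w
    exact LinearMap.congr_fun h1 v
  rw [← h2, h.sharp_flat, h2]

theorem bivector_pullback (hA : Function.Surjective A) (h' : IsSharp (pullback A σ) P')
    (β : FormFibre E) : bivector P' (pullback A β) = pullback A (bivector P β) := by
  induction β using left_induction with
  | h0 r => simp
  | hadd x y hx hy => simp [hx, hy]
  | hmul x a hx =>
    rw [map_mul, pullback_ι, bivector_ι_mul h'.antisymm, hx, interior_pullback,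
      h.map_sharp_comp hA h', bivector_ι_mul h.antisymm, map_sub, map_mul, pullback_ι]

theorem starOp_pullback (hA : Function.Surjective A) (h' : IsSharp (pullback A σ) P')
    (β : FormFibre E) :
    starOp P' (pullback A σ) (pullback A β) = pullback A (starOp P σ β) := by
  induction β using left_induction with
  | h0 r => simp [starOp_algebraMap, volume_pullback]
  | hadd x y hx hy => simp [hx, hy]
  | hmul x a hx =>
    rw [map_mul, pullback_ι, starOp_ι_mul, h'.starOp_parity, hx, ← pullback_parity,
      interior_pullback, h.map_sharp_comp hA h', starOp_ι_mul, map_neg, h.starOp_parity]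

end IsSharp

/-! ### Compatible almost complex structures -/

/-- `J` is a complex structure for which `σ(·, J ·)` is symmetric. -/
structure IsCompatible (σ : FormFibre E) (J : E →ₗ[ℝ] E) : Prop where
  sq : ∀ v, J (J v) = -v
  symm : ∀ v w, flat σ v (J w) = flat σ w (J v)

namespace IsCompatible

variable {σ : FormFibre E} {P : Module.Dual ℝ E →ₗ[ℝ] E} {J : E →ₗ[ℝ] E}
  (hJ : IsCompatible σ J) (h : IsSharp σ P)
include hJ

theorem surjective : Function.Surjective J := fun v => ⟨-J v, by rw [map_neg, hJ.sq, neg_neg]⟩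

theorem pullback_sq (β : FormFibre E) : pullback J (pullback J β) = parity β := by
  rw [pullback_pullback, ← pullback_neg_id]
  congr 2
  exact LinearMap.ext hJ.sq

theorem pullback_neg_pullback (β : FormFibre E) : pullback (-J) (pullback J β) = β := by
  rw [pullback_pullback]
  conv_rhs => rw [← pullback_id β]
  congr 2
  exact LinearMap.ext fun v => by simp [hJ.sq]

theorem pullback_pullback_neg (β : FormFibre E) : pullback J (pullback (-J) β) = β := by
  rw [pullback_pullback]
  conv_rhs => rw [← pullback_id β]
  congr 2
  exact LinearMap.ext fun v => by simp [hJ.sq]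

theorem pullback_neg_sq (β : FormFibre E) : pullback (-J) (pullback (-J) β) = parity β := by
  rw [pullback_pullback, ← pullback_neg_id]
  congr 2
  exact LinearMap.ext fun v => by simp [hJ.sq]

include h

/-- Symmetry of `σ(·, J ·)` gives `σ(Jv, Jw) = σ(w, J²v) = -σ(w, v)`. So `J` is symplectic and
commutes with everything built from `σ`. -/
theorem pullback_form : pullback J σ = σ := by
  refine eq_of_flat_eq (pullback_mem J h.mem) h.mem fun v w => ?_
  rw [flat_pullback J h.mem, LinearMap.comp_apply, hJ.symm, hJ.sq, map_neg,
    flat_antisymm h.mem, neg_neg]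

theorem bivector_pullback (β : FormFibre E) :
    bivector P (pullback J β) = pullback J (bivector P β) := by
  refine h.bivector_pullback hJ.surjective ?_ β
  rw [hJ.pullback_form h]; exact h

theorem starOp_pullback (β : FormFibre E) :
    starOp P σ (pullback J β) = pullback J (starOp P σ β) := by
  have h1 := h.starOp_pullback (P' := P) hJ.surjective (by rw [hJ.pullback_form h]; exact h) β
  rwa [hJ.pullback_form h] at h1

/-- The source of every comparison between metric and symplectic operators: the metric is inverted
by `J ∘ P`, and contraction with `J (P a)` becomes contraction with `P a` after pulling back by `J`.
-/
theorem pairing_metric (α β : FormFibre E) :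
    pairingBilin (coForm (J ∘ₗ P)) α β = pairingBilin (coForm P) α (pullback J β) := by
  induction α using left_induction generalizing β with
  | h0 r => rw [pairingBilin_algebraMap, pairingBilin_algebraMap, scalar_pullback]
  | hadd x y hx hy => simp [hx, hy]
  | hmul x a hx =>
    rw [pairingBilin_ι_mul, pairingBilin_ι_mul, hx]
    exact congrArg _ (interior_pullback J (P a) β).symm

theorem pairing_pullback (α β : FormFibre E) :
    pairingBilin (coForm P) (pullback J α) (pullback J β) = pairingBilin (coForm P) α β := by
  induction α using left_induction generalizing β with
  | h0 r => rw [AlgHom.commutes, pairingBilin_algebraMap, pairingBilin_algebraMap, scalar_pullback]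
  | hadd x y hx hy => simp [hx, hy]
  | hmul x a hx =>
    have h1 : CliffordAlgebra.contractLeft (coForm P (a ∘ₗ J)) (pullback J β) =
        pullback J (CliffordAlgebra.contractLeft (coForm P a) β) := by
      refine (interior_pullback J (P (a ∘ₗ J)) β).trans ?_
      rw [h.map_sharp_comp hJ.surjective (P' := P) (by rw [hJ.pullback_form h]; exact h)]
      rfl
    rw [map_mul, pullback_ι, pairingBilin_ι_mul, pairingBilin_ι_mul, h1, hx]

theorem surjective_coForm : Function.Surjective (coForm (J ∘ₗ P)) :=
  (Module.evalEquiv ℝ E).surjective.comp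
    (hJ.surjective.comp fun v => ⟨_, h.sharp_flat v⟩)

theorem star_metric :
    star (coForm (J ∘ₗ P)) (volume σ) = starOp P σ * (pullback J).toLinearMap :=
  star_eq fun k hk β hβ =>
    ⟨h.starOp_mem hk (pullback_mem J hβ), fun α hα =>
      (h.mul_starOp hk hα (pullback_mem J hβ)).trans (by rw [hJ.pairing_metric h])⟩

theorem adjoint_metric (φ : Module.End ℝ (FormFibre E)) :
    adjoint (coForm (J ∘ₗ P)) φ =
      (pullback (-J)).toLinearMap * adjoint (coForm P) φ * (pullback J).toLinearMap := by
  refine adjoint_eq (hJ.surjective_coForm h) fun α β => ?_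
  rw [hJ.pairing_metric h, hJ.pairing_metric h, pairing_adjoint h.surjective_coForm]
  simp [Module.End.mul_apply, hJ.pullback_pullback_neg]

theorem adjoint_pullback :
    adjoint (coForm P) (pullback J).toLinearMap = (pullback (-J)).toLinearMap :=
  adjoint_eq h.surjective_coForm fun α β => by
    conv_lhs => rw [← hJ.pullback_pullback_neg β]
    exact hJ.pairing_pullback h _ _

theorem adjoint_pullback_neg :
    adjoint (coForm P) (pullback (-J)).toLinearMap = (pullback J).toLinearMap :=
  adjoint_eq h.surjective_coForm fun α β => by
    rw [← hJ.pairing_pullback h]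
    simp [hJ.pullback_pullback_neg]

theorem adjoint_metric_mulLeft :
    adjoint (coForm (J ∘ₗ P)) (LinearMap.mulLeft ℝ σ) = bivector P := by
  rw [hJ.adjoint_metric h, h.adjoint_mulLeft h.mem, h.coLefschetz_self]
  refine LinearMap.ext fun β => ?_
  simp [Module.End.mul_apply, hJ.bivector_pullback h, hJ.pullback_neg_pullback]

/-- The metric adjoint of `J⁻¹ φ J` for an odd operator `φ`. -/
theorem adjoint_metric_conj {φ : Module.End ℝ (FormFibre E)}
    (hφ : ∀ β, φ (parity β) = -parity (φ β)) :
    adjoint (coForm (J ∘ₗ P)) ((pullback (-J)).toLinearMap * φ * (pullback J).toLinearMap) =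
      -adjoint (coForm P) φ := by
  have h1 := h.surjective_coForm
  -- The symplectic adjoint of `J` is `J⁻¹`, so the two conjugations, by `J` and from the metric,
  -- have the same direction and compose to `J⁻² φ^ω J²`, where `J²` and `J⁻²` are the parity
  -- operator.
  have h2 : adjoint (coForm (J ∘ₗ P))
      ((pullback (-J)).toLinearMap * φ * (pullback J).toLinearMap) =
      parity.toLinearMap * adjoint (coForm P) φ * parity.toLinearMap := by
    rw [hJ.adjoint_metric h, adjoint_mul h1, adjoint_mul h1, hJ.adjoint_pullback h,
      hJ.adjoint_pullback_neg h]
    refine LinearMap.ext fun β => ?_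
    simp [Module.End.mul_apply, hJ.pullback_sq, hJ.pullback_neg_sq]
  have h3 : parity.toLinearMap = (pullback J).toLinearMap * (pullback J).toLinearMap :=
    LinearMap.ext fun β => (hJ.pullback_sq β).symm
  have h4 : adjoint (coForm P) parity.toLinearMap = parity.toLinearMap := by
    conv_lhs => rw [h3]
    rw [adjoint_mul h1, hJ.adjoint_pullback h]
    exact LinearMap.ext fun β => hJ.pullback_neg_sq β
  have h5 : parity.toLinearMap * φ * parity.toLinearMap = -φ := LinearMap.ext fun β => by
    simp [Module.End.mul_apply, hφ]
  have h6 : adjoint (coForm P) (-φ) = -adjoint (coForm P) φ := by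
    rw [← zero_sub, adjoint_sub h1, adjoint_zero h1, zero_sub]
  rw [h2, ← h6, ← h5, adjoint_mul h1, adjoint_mul h1, h4, mul_assoc]

end IsCompatible

end FormFibre

end

noncomputable section

/-! ### Calculus of families of linear maps -/

section Family

variable {E V W : Type*} [NormedAddCommGroup E] [NormedSpace ℝ E]
  [NormedAddCommGroup V] [NormedSpace ℝ V] [FiniteDimensional ℝ V]
  [NormedAddCommGroup W] [NormedSpace ℝ W]

/-- A product rule that uses only the derivatives of `z ↦ T z x` for fixed `x`, obtained by
expanding `f` in a basis. Families of operators can thus be differentiated on constant forms alone.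
-/
theorem hasFDerivAt_family {T : E → V →ₗ[ℝ] W} {f : E → V} {y : E}
    (hT : ∀ x, DifferentiableAt ℝ (fun z => T z x) y) (hf : DifferentiableAt ℝ f y) :
    DifferentiableAt ℝ (fun z => T z (f z)) y ∧ ∀ v, fderiv ℝ (fun z => T z (f z)) y v =
      T y (fderiv ℝ f y v) + fderiv ℝ (fun z => T z (f y)) y v := by
  set b := Module.finBasis ℝ V
  have hexp : ∀ (L : V →ₗ[ℝ] W) x, L x = ∑ s, b.coord s x • L (b s) := fun L x => by
    conv_lhs => rw [← b.sum_repr x, map_sum]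
    simp
  have hc : ∀ s, HasFDerivAt (fun z => b.coord s (f z))
      ((LinearMap.toContinuousLinearMap (b.coord s)).comp (fderiv ℝ f y)) y := fun s =>
    (LinearMap.toContinuousLinearMap (b.coord s)).hasFDerivAt.comp y hf.hasFDerivAt
  have h1 : HasFDerivAt (fun z => T z (f z)) _ y :=
    (HasFDerivAt.fun_sum fun s (_ : s ∈ Finset.univ) =>
      (hc s).smul (hT (b s)).hasFDerivAt).congr_of_eventuallyEq
        (Filter.Eventually.of_forall fun z => hexp (T z) (f z))
  have h2 : HasFDerivAt (fun z => T z (f y)) _ y :=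
    (HasFDerivAt.fun_sum fun s (_ : s ∈ Finset.univ) =>
      (hT (b s)).hasFDerivAt.const_smul (b.coord s (f y))).congr_of_eventuallyEq
        (Filter.Eventually.of_forall fun z => hexp (T z) (f y))
  refine ⟨h1.differentiableAt, fun v => ?_⟩
  rw [h1.fderiv, h2.fderiv, hexp (T y) (fderiv ℝ f y v)]
  simp [Finset.sum_add_distrib, add_comm]

theorem contDiffOn_family {T : E → V →ₗ[ℝ] W} {f : E → V} {s : Set E} {n : WithTop ℕ∞}
    (hT : ∀ x, ContDiffOn ℝ n (fun z => T z x) s) (hf : ContDiffOn ℝ n f s) :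
    ContDiffOn ℝ n (fun z => T z (f z)) s := by
  set b := Module.finBasis ℝ V
  have hexp : ∀ z, T z (f z) = ∑ i, b.coord i (f z) • T z (b i) := fun z => by
    conv_lhs => rw [← b.sum_repr (f z), map_sum]
    simp
  simp only [hexp]
  exact ContDiffOn.sum fun i _ =>
    ((LinearMap.toContinuousLinearMap (b.coord i)).contDiff.comp_contDiffOn hf).smul (hT (b i))

variable {U : Type*} [NormedAddCommGroup U] [NormedSpace ℝ U] [FiniteDimensional ℝ U]

theorem fderiv_linear (L : U →ₗ[ℝ] W) {f : E → U} {y : E} (hf : DifferentiableAt ℝ f y) :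
    DifferentiableAt ℝ (fun z => L (f z)) y ∧
      ∀ v, fderiv ℝ (fun z => L (f z)) y v = L (fderiv ℝ f y v) := by
  have h : HasFDerivAt (fun z => L (f z)) _ y :=
    (LinearMap.toContinuousLinearMap L).hasFDerivAt.comp y hf.hasFDerivAt
  exact ⟨h.differentiableAt, fun v => by rw [h.fderiv]; rfl⟩

theorem fderiv_bilin (B : U →ₗ[ℝ] V →ₗ[ℝ] W) {f : E → U} {g : E → V} {y : E}
    (hf : DifferentiableAt ℝ f y) (hg : DifferentiableAt ℝ g y) :
    DifferentiableAt ℝ (fun z => B (f z) (g z)) y ∧ ∀ v,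
      fderiv ℝ (fun z => B (f z) (g z)) y v = B (fderiv ℝ f y v) (g y) + B (f y) (fderiv ℝ g y v) := by
  obtain ⟨h1, h2⟩ := hasFDerivAt_family (T := fun z => B (f z))
    (fun x => (fderiv_linear (B.flip x) hf).1) hg
  exact ⟨h1, fun v => by rw [h2, add_comm]; congr 1; exact (fderiv_linear (B.flip (g y)) hf).2 v⟩

theorem contDiffOn_linear (L : U →ₗ[ℝ] W) {f : E → U} {s : Set E} {n : WithTop ℕ∞}
    (hf : ContDiffOn ℝ n f s) : ContDiffOn ℝ n (fun z => L (f z)) s :=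
  (LinearMap.toContinuousLinearMap L).contDiff.comp_contDiffOn hf

theorem contDiffOn_bilin (B : U →ₗ[ℝ] V →ₗ[ℝ] W) {f : E → U} {g : E → V} {s : Set E}
    {n : WithTop ℕ∞} (hf : ContDiffOn ℝ n f s) (hg : ContDiffOn ℝ n g s) :
    ContDiffOn ℝ n (fun z => B (f z) (g z)) s :=
  contDiffOn_family (T := fun z => B (f z)) (fun x => contDiffOn_linear (B.flip x) hf) hg

/-- A subspace is cut out by functionals, and each of them vanishes along `f` near `y`. -/
theorem fderiv_mem_of_eventually {f : E → V} {y : E} (hf : DifferentiableAt ℝ f y)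
    (K : Submodule ℝ V) (h : ∀ᶠ z in 𝓝 y, f z ∈ K) (v : E) : fderiv ℝ f y v ∈ K := by
  rw [← Subspace.forall_mem_dualAnnihilator_apply_eq_zero_iff]
  intro φ hφ
  rw [← (fderiv_linear φ hf).2 v]
  have h1 : (fun z => φ (f z)) =ᶠ[𝓝 y] fun _ => 0 := by
    filter_upwards [h] with z hz
    exact (Submodule.mem_dualAnnihilator φ).mp hφ _ hz
  rw [h1.fderiv_eq]
  simp

end Family

namespace FormFibre

variable {E : Type*} [NormedAddCommGroup E] [NormedSpace ℝ E] [FiniteDimensional ℝ E]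

local notation "♮" => Module.finBasis ℝ E

/-! ### The exterior derivative on a vector space -/

/-- The exterior derivative `∑ᵢ eⁱ ∧ ∂ᵢ f` on a vector space. -/
def extd (f : E → FormFibre E) (y : E) : FormFibre E :=
  ∑ i, ExteriorAlgebra.ι ℝ (♮.coord i) * fderiv ℝ f y (♮ i)

theorem fderiv_mul {f g : E → FormFibre E} {y : E}
    (hf : DifferentiableAt ℝ f y) (hg : DifferentiableAt ℝ g y) :
    DifferentiableAt ℝ (fun z => f z * g z) y ∧ ∀ v,
      fderiv ℝ (fun z => f z * g z) y v = fderiv ℝ f y v * g y + f y * fderiv ℝ g y v :=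
  fderiv_bilin (LinearMap.mul ℝ (FormFibre E)) hf hg

theorem extd_congr {f g : E → FormFibre E} {y : E} (h : f =ᶠ[𝓝 y] g) : extd f y = extd g y := by
  rw [extd, extd, h.fderiv_eq]

theorem extd_mul {f g : E → FormFibre E} {y : E}
    (hf : DifferentiableAt ℝ f y) (hg : DifferentiableAt ℝ g y) :
    extd (fun z => f z * g z) y = extd f y * g y + parity (f y) * extd g y := by
  simp only [extd, (fderiv_mul hf hg).2, mul_add, Finset.sum_add_distrib, Finset.sum_mul,
    Finset.mul_sum, ← mul_assoc, ι_mul_eq _ (f y)]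

theorem extd_add {f g : E → FormFibre E} {y : E}
    (hf : DifferentiableAt ℝ f y) (hg : DifferentiableAt ℝ g y) :
    extd (fun z => f z + g z) y = extd f y + extd g y := by
  simp only [extd, fderiv_fun_add hf hg, add_apply, mul_add,
    Finset.sum_add_distrib]

theorem extd_smul (r : ℝ) {f : E → FormFibre E} {y : E} (hf : DifferentiableAt ℝ f y) :
    extd (fun z => r • f z) y = r • extd f y := by
  simp only [extd, fderiv_fun_const_smul hf, smul_apply, mul_smul_comm,
    Finset.smul_sum]

/-- A symmetric array is summed against the antisymmetric `eⁱ ∧ eʲ`; with second partial derivatives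
for `D` this is `d² = 0`. -/
theorem sum_ι_mul_ι_eq_zero {D : Fin (Module.finrank ℝ E) → Fin (Module.finrank ℝ E) → FormFibre E}
    (hD : ∀ i j, D i j = D j i) :
    ∑ i, ∑ j, ExteriorAlgebra.ι ℝ (♮.coord i) * (ExteriorAlgebra.ι ℝ (♮.coord j) * D i j) = 0 := by
  suffices h : ∑ i, ∑ j, ExteriorAlgebra.ι ℝ (♮.coord i) *
      (ExteriorAlgebra.ι ℝ (♮.coord j) * D i j) =
      -∑ i, ∑ j, ExteriorAlgebra.ι ℝ (♮.coord i) * (ExteriorAlgebra.ι ℝ (♮.coord j) * D i j) by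
    have h2 := add_eq_zero_iff_eq_neg.mpr h
    rw [← two_smul ℝ] at h2
    exact (smul_eq_zero.mp h2).resolve_left two_ne_zero
  conv_lhs => rw [Finset.sum_comm]
  simp only [← Finset.sum_neg_distrib]
  refine Finset.sum_congr rfl fun i _ => Finset.sum_congr rfl fun j _ => ?_
  have h := eq_neg_of_add_eq_zero_left
    (ExteriorAlgebra.ι_add_mul_swap (R := ℝ) (♮.coord j) (♮.coord i))
  rw [← mul_assoc, h, hD, neg_mul, mul_assoc]

theorem fderiv_fderiv_comm {V : Type*} [NormedAddCommGroup V] [NormedSpace ℝ V] {f : E → V} {y : E}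
    (hf : ContDiffAt ℝ 2 f y) (v w : E) :
    DifferentiableAt ℝ (fun z => fderiv ℝ f z v) y ∧
    fderiv ℝ (fun z => fderiv ℝ f z v) y w = fderiv ℝ (fun z => fderiv ℝ f z w) y v := by
  have h1 : DifferentiableAt ℝ (fderiv ℝ f) y :=
    (hf.fderiv_right (m := 1) (by norm_num)).differentiableAt (by norm_num)
  have h2 : ∀ v, HasFDerivAt (fun z => fderiv ℝ f z v)
      ((fderiv ℝ (fderiv ℝ f) y).flip v) y := fun v => by
    have := h1.hasFDerivAt.clm_apply (hasFDerivAt_const v y)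
    simpa using this
  refine ⟨(h2 v).differentiableAt, ?_⟩
  rw [(h2 v).fderiv, (h2 w).fderiv]
  exact (hf.isSymmSndFDerivAt (by simp)).eq w v

theorem extd_extd {f : E → FormFibre E} {y : E} (hf : ContDiffAt ℝ 2 f y) :
    extd (extd f) y = 0 := by
  have h1 : ∀ v i, fderiv ℝ (fun z => ExteriorAlgebra.ι ℝ (♮.coord i) * fderiv ℝ f z (♮ i)) y v =
      ExteriorAlgebra.ι ℝ (♮.coord i) * fderiv ℝ (fun z => fderiv ℝ f z (♮ i)) y v := fun v i =>
    (fderiv_linear (wedge (♮.coord i)) (fderiv_fderiv_comm hf (♮ i) 0).1).2 v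
  have h2 : ∀ i, DifferentiableAt ℝ
      (fun z => ExteriorAlgebra.ι ℝ (♮.coord i) * fderiv ℝ f z (♮ i)) y := fun i =>
    (fderiv_linear (wedge (♮.coord i)) (fderiv_fderiv_comm hf (♮ i) 0).1).1
  rw [extd]
  have h3 : ∀ v, fderiv ℝ (extd f) y v = ∑ i, ExteriorAlgebra.ι ℝ (♮.coord i) *
      fderiv ℝ (fun z => fderiv ℝ f z (♮ i)) y v := by
    intro v
    have : extd f = fun z => ∑ i, ExteriorAlgebra.ι ℝ (♮.coord i) * fderiv ℝ f z (♮ i) := rfl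
    rw [this, fderiv_fun_sum fun i _ => h2 i]
    simp [h1]
  simp only [h3, Finset.mul_sum]
  exact sum_ι_mul_ι_eq_zero fun i j => (fderiv_fderiv_comm hf _ _).2

/-- The pullback of a constant covector `a` is the differential of `a ∘ F`, hence closed by symmetry
of second derivatives; products follow from the Leibniz rule. -/
theorem extd_pullback_const {F : E → E} {y : E} (hF : ContDiffAt ℝ 2 F y) (γ : FormFibre E) :
    DifferentiableAt ℝ (fun z => pullback (fderiv ℝ F z).toLinearMap γ) y ∧
      extd (fun z => pullback (fderiv ℝ F z).toLinearMap γ) y = 0 := by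
  induction γ using left_induction with
  | h0 r => simp [extd]
  | hadd x x' hx hx' =>
    simp only [map_add]
    exact ⟨hx.1.add hx'.1, by rw [extd_add hx.1 hx'.1, hx.2, hx'.2, add_zero]⟩
  | hmul x a hx =>
    have h1 : ∀ z, ExteriorAlgebra.ι ℝ (a ∘ₗ (fderiv ℝ F z).toLinearMap) =
        ∑ j, a (fderiv ℝ F z (♮ j)) • (ExteriorAlgebra.ι ℝ (♮.coord j) : FormFibre E) := by
      intro z
      conv_lhs => rw [← sum_apply_smul_coord (a ∘ₗ (fderiv ℝ F z).toLinearMap), map_sum]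
      simp
    have h2 : ∀ j, DifferentiableAt ℝ (fun z => a (fderiv ℝ F z (♮ j)) •
        (ExteriorAlgebra.ι ℝ (♮.coord j) : FormFibre E)) y ∧ ∀ v,
        fderiv ℝ (fun z => a (fderiv ℝ F z (♮ j)) •
          (ExteriorAlgebra.ι ℝ (♮.coord j) : FormFibre E)) y v =
          a (fderiv ℝ (fun z => fderiv ℝ F z (♮ j)) y v) • ExteriorAlgebra.ι ℝ (♮.coord j) :=
      fun j => fderiv_linear
        (a.smulRight (ExteriorAlgebra.ι ℝ (♮.coord j) : FormFibre E))
        (fderiv_fderiv_comm hF (♮ j) 0).1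
    have h3 : DifferentiableAt ℝ (fun z => (ExteriorAlgebra.ι ℝ
        (a ∘ₗ (fderiv ℝ F z).toLinearMap) : FormFibre E)) y := by
      simp only [h1]
      exact DifferentiableAt.fun_sum fun j _ => (h2 j).1
    have h4 : extd (fun z => (ExteriorAlgebra.ι ℝ
        (a ∘ₗ (fderiv ℝ F z).toLinearMap) : FormFibre E)) y = 0 := by
      simp only [h1, extd]
      rw [fderiv_fun_sum fun j _ => (h2 j).1]
      simp only [sum_apply, (h2 _).2, Finset.mul_sum]
      have := sum_ι_mul_ι_eq_zero (E := E) (D := fun i j =>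
        algebraMap ℝ (FormFibre E) (a (fderiv ℝ (fun z => fderiv ℝ F z (♮ j)) y (♮ i))))
        (fun i j => by rw [(fderiv_fderiv_comm hF _ _).2])
      simpa only [← Algebra.commutes, ← Algebra.smul_def] using this
    simp only [map_mul, pullback_ι]
    exact ⟨(fderiv_mul h3 hx.1).1, by rw [extd_mul h3 hx.1, h4, hx.2, zero_mul, mul_zero, add_zero]⟩

/-- The derivative splits into that of the pullback with `β` frozen, which contributes nothing by
`extd_pullback_const`, and that of `β ∘ F`, which the chain rule handles. -/
theorem extd_pullback {F : E → E} {β : E → FormFibre E} {y : E} (hF : ContDiffAt ℝ 2 F y)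
    (hβ : DifferentiableAt ℝ β (F y)) :
    extd (fun z => pullback (fderiv ℝ F z).toLinearMap (β (F z))) y =
      pullback (fderiv ℝ F y).toLinearMap (extd β (F y)) := by
  have hF1 : DifferentiableAt ℝ F y := hF.differentiableAt (by norm_num)
  have hβF : HasFDerivAt (fun z => β (F z)) _ y := hβ.hasFDerivAt.comp y hF1.hasFDerivAt
  have h1 := (hasFDerivAt_family (T := fun z => (pullback (fderiv ℝ F z).toLinearMap).toLinearMap)
    (fun x => (extd_pullback_const hF x).1) hβF.differentiableAt).2
  have h2 := (extd_pullback_const hF (β (F y))).2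
  simp only [AlgHom.toLinearMap_apply, hβF.fderiv, ContinuousLinearMap.comp_apply] at h1
  simp only [extd] at h2 ⊢
  simp only [h1, mul_add, Finset.sum_add_distrib]
  rw [h2, add_zero, map_sum]
  have h3 : ∀ w, fderiv ℝ β (F y) w = ∑ j, ♮.coord j w • fderiv ℝ β (F y) (♮ j) := fun w => by
    conv_lhs => rw [← sum_coord_smul w, map_sum]
    simp
  have h4 : ∀ j, (ExteriorAlgebra.ι ℝ (♮.coord j ∘ₗ (fderiv ℝ F y).toLinearMap) : FormFibre E) =
      ∑ i, ♮.coord j (fderiv ℝ F y (♮ i)) • ExteriorAlgebra.ι ℝ (♮.coord i) := fun j => by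
    conv_lhs => rw [← sum_apply_smul_coord (♮.coord j ∘ₗ (fderiv ℝ F y).toLinearMap), map_sum]
    simp
  simp only [map_mul, pullback_ι, h4, Finset.sum_mul]
  rw [Finset.sum_comm]
  refine Finset.sum_congr rfl fun i _ => ?_
  conv_lhs => rw [h3, map_sum, Finset.mul_sum]
  exact Finset.sum_congr rfl fun j _ => by rw [map_smul, mul_smul_comm, smul_mul_assoc]

end FormFibre

end

/-! ### Derivatives of symplectic operators for a varying `2`-form -/

noncomputable section

namespace FormFibre

variable {E : Type*} [NormedAddCommGroup E] [NormedSpace ℝ E] [FiniteDimensional ℝ E]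

local notation "♮" => Module.finBasis ℝ E

theorem flat_smul (r : ℝ) (τ : FormFibre E) : flat (r • τ) = r • flat τ := by
  ext1 v; simp [flat_apply]

/-- A smooth family of nondegenerate `2`-forms on an open set, with their inverses. -/
structure SharpFamily (U : Set E) (σ : E → FormFibre E) (P : E → Module.Dual ℝ E →ₗ[ℝ] E) :
    Prop where
  isOpen : IsOpen U
  smooth : ContDiffOn ℝ ∞ σ U
  sharp : ∀ z ∈ U, IsSharp (σ z) (P z)

namespace SharpFamily

variable {U : Set E} {σ : E → FormFibre E} {P : E → Module.Dual ℝ E →ₗ[ℝ] E}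
  (h : SharpFamily U σ P) {y : E} (hy : y ∈ U)
include h

/-- Inversion of invertible operators is smooth. The auxiliary identification `T` of `E*` with `E`
turns `flat σ` into an endomorphism of `E`. -/
theorem contDiffOn_sharp (a : Module.Dual ℝ E) : ContDiffOn ℝ ∞ (fun z => P z a) U := by
  let T : E ≃ₗ[ℝ] Module.Dual ℝ E := ♮.toDualEquiv
  let L : FormFibre E →ₗ[ℝ] (E →L[ℝ] E) :=
    { toFun := fun τ => LinearMap.toContinuousLinearMap (T.symm.toLinearMap ∘ₗ flat τ)
      map_add' := fun τ τ' => by rw [flat_add, LinearMap.comp_add, map_add]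
      map_smul' := fun r τ => by rw [flat_smul, LinearMap.comp_smul, map_smul]; rfl }
  have hL : ContDiffOn ℝ ∞ (fun z => L (σ z)) U := contDiffOn_linear L h.smooth
  intro z hz
  have hz' := h.sharp z hz
  let e : ∀ w ∈ U, E ≃L[ℝ] E := fun w hw => LinearEquiv.toContinuousLinearEquiv
    { T.symm.toLinearMap ∘ₗ flat (σ w) with
      invFun := fun v => P w (T v)
      left_inv := fun v => by simp [(h.sharp w hw).sharp_flat]
      right_inv := fun v => by simp [(h.sharp w hw).flat_sharp] }
  have he : ∀ w (hw : w ∈ U), L (σ w) = (e w hw : E →L[ℝ] E) := fun w hw => rfl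
  have h1 : ContDiffWithinAt ℝ ∞ (fun w => ContinuousLinearMap.inverse (L (σ w)) (T.symm a)) U z := by
    have h2 : ContDiffAt ℝ ∞ ContinuousLinearMap.inverse (L (σ z)) := by
      rw [he z hz]
      exact contDiffAt_map_inverse (e z hz)
    exact (h2.comp_contDiffWithinAt z (hL z hz)).clm_apply contDiffWithinAt_const
  refine h1.congr (fun w hw => ?_) ?_
  · rw [he w hw, ContinuousLinearMap.inverse_equiv]
    exact congrArg (P w) (T.apply_symm_apply a).symm
  · rw [he z hz, ContinuousLinearMap.inverse_equiv]
    exact congrArg (P z) (T.apply_symm_apply a).symm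

theorem contDiffOn_bivector {f : E → FormFibre E} (hf : ContDiffOn ℝ ∞ f U) :
    ContDiffOn ℝ ∞ (fun z => bivector (P z) (f z)) U := by
  simp only [bivector_apply]
  exact ContDiffOn.const_smul _ (ContDiffOn.sum fun i _ =>
    contDiffOn_linear (interior (♮ i))
      (contDiffOn_bilin (interiorL (E := E)) (h.contDiffOn_sharp (♮.coord i)) hf))

include hy

theorem mem_nhds : U ∈ 𝓝 y := h.isOpen.mem_nhds hy

theorem differentiableAt : DifferentiableAt ℝ σ y :=
  (h.smooth.contDiffAt (h.mem_nhds hy)).differentiableAt (by simp)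

theorem fderiv_mem (v : E) : fderiv ℝ σ y v ∈ ⋀[ℝ]^2 (Module.Dual ℝ E) :=
  fderiv_mem_of_eventually (h.differentiableAt hy) _
    (Filter.eventually_of_mem (h.mem_nhds hy) fun z hz => (h.sharp z hz).mem) v

theorem differentiableAt_sharp (a : Module.Dual ℝ E) : DifferentiableAt ℝ (fun z => P z a) y :=
  ((h.contDiffOn_sharp a).contDiffAt (h.mem_nhds hy)).differentiableAt (by simp)

/-- The derivative of an inverse, obtained by differentiating the constant `i(P a) σ = a`. -/
theorem fderiv_sharp (a : Module.Dual ℝ E) (v : E) :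
    fderiv ℝ (fun z => P z a) y v = -P y (flat (fderiv ℝ σ y v) (P y a)) := by
  have hs := h.sharp y hy
  have h1 := (fderiv_bilin (interiorL (E := E)) (h.differentiableAt_sharp hy a)
    (h.differentiableAt hy)).2 v
  have h2 : (fun z => interiorL (P z a) (σ z)) =ᶠ[𝓝 y] fun _ => ExteriorAlgebra.ι ℝ a := by
    filter_upwards [h.mem_nhds hy] with z hz
    rw [interiorL_apply, ← ι_flat (h.sharp z hz).mem, (h.sharp z hz).flat_sharp]
  rw [h2.fderiv_eq] at h1
  simp only [fderiv_fun_const, Pi.zero_apply, zero_apply, interiorL_apply] at h1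
  rw [← ι_flat hs.mem, ← ι_flat (h.fderiv_mem hy v), ← map_add, eq_comm,
    ExteriorAlgebra.ι_eq_zero_iff] at h1
  rw [← hs.sharp_flat (fderiv ℝ (fun z => P z a) y v), eq_neg_of_add_eq_zero_left h1, map_neg]

theorem fderiv_bivector (γ : FormFibre E) :
    DifferentiableAt ℝ (fun z => bivector (P z) γ) y ∧ ∀ v,
      fderiv ℝ (fun z => bivector (P z) γ) y v = -coLefschetz (P y) (fderiv ℝ σ y v) γ := by
  have h1 := fun i => fderiv_linear (interior (♮ i) ∘ₗ (interiorL (E := E)).flip γ)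
    (h.differentiableAt_sharp hy (♮.coord i))
  simp only [LinearMap.comp_apply, LinearMap.flip_apply, interiorL_apply] at h1
  simp only [bivector_apply]
  have h2 := DifferentiableAt.fun_sum fun i (_ : i ∈ Finset.univ) => (h1 i).1
  refine ⟨h2.fun_const_smul _, fun v => ?_⟩
  rw [fderiv_fun_const_smul h2, fderiv_fun_sum fun i _ => (h1 i).1, coLefschetz, bivector_apply]
  simp only [smul_apply, sum_apply, (h1 _).2, h.fderiv_sharp hy, interior_neg,
    LinearMap.neg_apply, map_neg, Finset.sum_neg_distrib, LinearMap.comp_apply, smul_neg]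

theorem fderiv_pow (r : ℕ) :
    DifferentiableAt ℝ (fun z => σ z ^ (r + 1)) y ∧ ∀ v,
      fderiv ℝ (fun z => σ z ^ (r + 1)) y v = ((r : ℝ) + 1) • (fderiv ℝ σ y v * σ y ^ r) := by
  have hd := h.differentiableAt hy
  induction r with
  | zero => simp [hd]
  | succ r ih =>
    obtain ⟨h1, h2⟩ := fderiv_mul ih.1 hd
    simp only [pow_succ _ (r + 1)]
    refine ⟨h1, fun v => ?_⟩
    rw [h2, ih.2, ← two_comm (h.fderiv_mem hy v), smul_mul_assoc, mul_assoc, ← pow_succ]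
    push_cast
    module

theorem fderiv_volume :
    DifferentiableAt ℝ (fun z => volume (σ z)) y ∧ ∀ v,
      fderiv ℝ (fun z => volume (σ z)) y v =
        -weight (flat (fderiv ℝ σ y v) ∘ₗ P y) (volume (σ y)) := by
  have hs := h.sharp y hy
  -- For a `2`-form `τ` the product `τ ∧ vol` vanishes by degree, so `[Λ, τ ∧ ·] vol` reduces to `-τ
  -- ∧ Λ vol`, a multiple of `τ ∧ σⁿ⁻¹` when `dim E = 2n > 0`.
  have h1 : ∀ v, -weight (flat (fderiv ℝ σ y v) ∘ₗ P y) (volume (σ y)) =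
      fderiv ℝ σ y v * bivector (P y) (volume (σ y)) := by
    intro v
    have hv := h.fderiv_mem hy v
    have h2 := bivector_two_mul hs.antisymm hv (volume (σ y))
    rw [hs.mul_volume hv, map_zero] at h2
    exact neg_eq_of_add_eq_zero_left h2.symm
  simp only [h1]
  unfold volume
  have hhalf := hs.half_eq
  generalize Module.finrank ℝ E / 2 = n at hhalf
  cases n with
  -- In dimension zero the volume is the constant `1`, and both sides vanish.
  | zero => simp
  | succ r =>
    obtain ⟨h3, h4⟩ := h.fderiv_pow hy r
    refine ⟨h3.fun_const_smul _, fun v => ?_⟩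
    rw [fderiv_fun_const_smul h3, smul_apply, h4, map_smul, hs.bivector_pow, ← hhalf,
      mul_smul_comm, mul_smul_comm]
    congr 2
    push_cast; ring

/-- Starting from the volume form, each covector adds a contraction with `P b`; the derivative of `P
b` is exactly what `interior_weight` produces when that contraction passes the weight operator.
Peeling covectors off on the right avoids parity signs. -/
theorem fderiv_starOp (γ : FormFibre E) :
    DifferentiableAt ℝ (fun z => starOp (P z) (σ z) γ) y ∧ ∀ v,
      fderiv ℝ (fun z => starOp (P z) (σ z) γ) y v =
        -weight (flat (fderiv ℝ σ y v) ∘ₗ P y) (starOp (P y) (σ y) γ) := by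
  induction γ using right_induction with
  | h0 r =>
    obtain ⟨h1, h2⟩ := h.fderiv_volume hy
    simp only [starOp_algebraMap]
    refine ⟨h1.fun_const_smul r, fun v => ?_⟩
    rw [fderiv_fun_const_smul h1, smul_apply, h2, map_smul, smul_neg]
  | hadd x x' hx hx' =>
    simp only [map_add]
    refine ⟨hx.1.add hx'.1, fun v => ?_⟩
    rw [fderiv_fun_add hx.1 hx'.1, add_apply, hx.2, hx'.2, neg_add]
  | hmul b x hx =>
    simp only [starOp_mul_ι]
    obtain ⟨h1, h2⟩ := fderiv_bilin (interiorL (E := E)) (h.differentiableAt_sharp hy b) hx.1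
    simp only [interiorL_apply] at h1 h2
    refine ⟨h1.neg, fun v => ?_⟩
    rw [fderiv_fun_neg, neg_apply, h2, hx.2, h.fderiv_sharp hy, map_neg, map_neg,
      (h.sharp y hy).interior_weight (h.fderiv_mem hy v), interior_neg, LinearMap.neg_apply]
    abel

theorem adjoint_extd :
    adjoint (coForm (P y)) (LinearMap.mulLeft ℝ (extd σ y)) =
      ∑ i, coLefschetz (P y) (fderiv ℝ σ y (♮ i)) * interior (P y (♮.coord i)) := by
  have hs := h.sharp y hy
  have h1 : LinearMap.mulLeft ℝ (extd σ y) = ∑ i, LinearMap.mulLeft ℝ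
      (ExteriorAlgebra.ι ℝ (♮.coord i) * fderiv ℝ σ y (♮ i)) := LinearMap.ext fun β => by
    simp [extd, Finset.sum_mul, mul_assoc]
  rw [h1, adjoint_sum hs.surjective_coForm]
  exact Finset.sum_congr rfl fun i _ => hs.adjoint_ι_mul (h.fderiv_mem hy _) _

variable {f : E → FormFibre E} (hf : DifferentiableAt ℝ f y)
include hf

theorem fderiv_bivector_apply :
    DifferentiableAt ℝ (fun z => bivector (P z) (f z)) y ∧ ∀ v,
      fderiv ℝ (fun z => bivector (P z) (f z)) y v =
        bivector (P y) (fderiv ℝ f y v) - coLefschetz (P y) (fderiv ℝ σ y v) (f y) := by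
  obtain ⟨h1, h2⟩ := hasFDerivAt_family (fun γ => (h.fderiv_bivector hy γ).1) hf
  exact ⟨h1, fun v => by rw [h2, (h.fderiv_bivector hy _).2, sub_eq_add_neg]⟩

/-- The commutator of contraction with `σ⁻¹` and the exterior derivative. -/
theorem bivector_extd_sub :
    bivector (P y) (extd f y) - extd (fun z => bivector (P z) (f z)) y =
      ∑ i, (ExteriorAlgebra.ι ℝ (♮.coord i) * coLefschetz (P y) (fderiv ℝ σ y (♮ i)) (f y) -
        interior (P y (♮.coord i)) (fderiv ℝ f y (♮ i))) := by
  simp only [extd, map_sum, (h.fderiv_bivector_apply hy hf).2,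
    bivector_ι_mul (h.sharp y hy).antisymm, ← Finset.sum_sub_distrib]
  exact Finset.sum_congr rfl fun i _ => by rw [mul_sub]; abel

/-- The symplectic adjoint of the exterior derivative. -/
theorem starOp_extd_starOp :
    starOp (P y) (σ y) (extd (fun z => starOp (P z) (σ z) (parity (f z))) y) =
      bivector (P y) (extd f y) - extd (fun z => bivector (P z) (f z)) y -
        adjoint (coForm (P y)) (bivector (P y) * LinearMap.mulLeft ℝ (extd σ y) -
          LinearMap.mulLeft ℝ (extd σ y) * bivector (P y)) (f y) := by
  have hs := h.sharp y hy
  have hp := fderiv_linear parity.toLinearMap hf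
  have h1 := (hasFDerivAt_family (fun γ => (h.fderiv_starOp hy γ).1) hp.1).2
  simp only [AlgHom.toLinearMap_apply] at h1 hp
  simp only [(h.fderiv_starOp hy _).2, hp.2] at h1
  have h2 : bivector (P y) * LinearMap.mulLeft ℝ (extd σ y) -
      LinearMap.mulLeft ℝ (extd σ y) * bivector (P y) =
      ∑ i, (bivector (P y) * LinearMap.mulLeft ℝ
        (ExteriorAlgebra.ι ℝ (♮.coord i) * fderiv ℝ σ y (♮ i)) - LinearMap.mulLeft ℝ
        (ExteriorAlgebra.ι ℝ (♮.coord i) * fderiv ℝ σ y (♮ i)) * bivector (P y)) :=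
    LinearMap.ext fun β => by
      simp [extd, Finset.sum_mul, Finset.sum_sub_distrib, Module.End.mul_apply, mul_assoc]
  rw [h.bivector_extd_sub hy hf, h2, adjoint_sum hs.surjective_coForm, LinearMap.sum_apply,
    ← Finset.sum_sub_distrib]
  conv_lhs => rw [extd]
  rw [map_sum]
  refine Finset.sum_congr rfl fun i _ => ?_
  -- In direction `eᵢ` the derivative of `f` gives `-i(P eⁱ) ∂ᵢf`, as in `[i_π, d]`; the derivative
  -- of the star gives the weight term, matched by the pointwise identity.
  rw [h1, mul_add, map_add, hs.starOp_ι_mul_starOp, mul_neg, map_neg,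
    hs.starOp_ι_mul_weight (h.fderiv_mem hy _), sub_right_comm,
    hs.ι_mul_coLefschetz_sub_adjoint (h.fderiv_mem hy _)]
  abel

end SharpFamily

end FormFibre

end

/-! ### Charts and the exterior derivative on a manifold -/

noncomputable section

section Charts

variable {E : Type*} [NormedAddCommGroup E] [NormedSpace ℝ E] [FiniteDimensional ℝ E]
  {M : Type*} [TopologicalSpace M] [ChartedSpace E M]

/-- The coordinate change from the chart at `x` to the chart at `q`. -/
def transition (E : Type*) [NormedAddCommGroup E] [NormedSpace ℝ E] {M : Type*}
    [TopologicalSpace M] [ChartedSpace E M] (x q : M) : E → E :=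
  extChartAt 𝓘(ℝ, E) q ∘ (extChartAt 𝓘(ℝ, E) x).symm

theorem eventually_mem_overlap {x q : M} {y : E} (hy : y ∈ (extChartAt 𝓘(ℝ, E) x).target)
    (hq : (extChartAt 𝓘(ℝ, E) x).symm y ∈ (extChartAt 𝓘(ℝ, E) q).source) :
    ∀ᶠ z in 𝓝 y, z ∈ (extChartAt 𝓘(ℝ, E) x).target ∧
      (extChartAt 𝓘(ℝ, E) x).symm z ∈ (extChartAt 𝓘(ℝ, E) q).source :=
  (Filter.eventually_of_mem (extChartAt_target_mem_nhds' hy) fun _ h => h).and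
    ((continuousAt_extChartAt_symm'' hy).eventually_mem
      ((isOpen_extChartAt_source q).mem_nhds hq))

theorem symm_transition {x q : M} {y : E}
    (hq : (extChartAt 𝓘(ℝ, E) x).symm y ∈ (extChartAt 𝓘(ℝ, E) q).source) :
    (extChartAt 𝓘(ℝ, E) q).symm (transition E x q y) = (extChartAt 𝓘(ℝ, E) x).symm y :=
  (extChartAt 𝓘(ℝ, E) q).left_inv hq

theorem transition_mem {x q : M} {y : E}
    (hq : (extChartAt 𝓘(ℝ, E) x).symm y ∈ (extChartAt 𝓘(ℝ, E) q).source) :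
    transition E x q y ∈ (extChartAt 𝓘(ℝ, E) q).target :=
  (extChartAt 𝓘(ℝ, E) q).map_source hq

theorem fderiv_transition_self (x : M) {y : E} (hy : y ∈ (extChartAt 𝓘(ℝ, E) x).target) :
    fderiv ℝ (transition E x x) y = ContinuousLinearMap.id ℝ E := by
  have h : transition E x x =ᶠ[𝓝 y] id := by
    filter_upwards [extChartAt_target_mem_nhds' hy] with z hz
    exact (extChartAt 𝓘(ℝ, E) x).right_inv hz
  rw [h.fderiv_eq, fderiv_id]

theorem FormSection.inChart_eq (x : M) (α : FormSection E M) (y : E) :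
    α.inChart x y = FormFibre.pullback
      (fderiv ℝ (transition E x ((extChartAt 𝓘(ℝ, E) x).symm y)) y).toLinearMap
      (α ((extChartAt 𝓘(ℝ, E) x).symm y)) := rfl

theorem FormSection.inChart_self (x : M) (α : FormSection E M) :
    α.inChart x (extChartAt 𝓘(ℝ, E) x x) = α x := by
  have h := fderiv_transition_self (E := E) x (mem_extChartAt_target x)
  rw [FormSection.inChart_eq, extChartAt_to_inv x, h]
  exact FormFibre.pullback_id _

theorem FormSection.d_eq (x : M) (α : FormSection E M) :
    α.d x = FormFibre.extd (α.inChart x) (extChartAt 𝓘(ℝ, E) x x) := rfl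

variable [IsManifold 𝓘(ℝ, E) ∞ M]

theorem contDiffAt_transition {x q : M} {y : E} (hy : y ∈ (extChartAt 𝓘(ℝ, E) x).target)
    (hq : (extChartAt 𝓘(ℝ, E) x).symm y ∈ (extChartAt 𝓘(ℝ, E) q).source) :
    ContDiffAt ℝ ∞ (transition E x q) y := by
  have h := contDiffWithinAt_ext_coord_change (I := 𝓘(ℝ, E)) (n := ∞) q x (y := y)
    (by rw [PartialEquiv.trans_source]; exact ⟨hy, hq⟩)
  rwa [ModelWithCorners.range_eq_univ, contDiffWithinAt_univ] at h

theorem fderiv_transition_comp {x p q : M} {y : E} (hy : y ∈ (extChartAt 𝓘(ℝ, E) x).target)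
    (hp : (extChartAt 𝓘(ℝ, E) x).symm y ∈ (extChartAt 𝓘(ℝ, E) p).source)
    (hq : (extChartAt 𝓘(ℝ, E) x).symm y ∈ (extChartAt 𝓘(ℝ, E) q).source) :
    fderiv ℝ (transition E x q) y =
      (fderiv ℝ (transition E p q) (transition E x p y)).comp (fderiv ℝ (transition E x p) y) := by
  have h : transition E x q =ᶠ[𝓝 y] transition E p q ∘ transition E x p := by
    filter_upwards [eventually_mem_overlap hy hp] with z hz
    simp only [transition, Function.comp_apply]
    rw [(extChartAt 𝓘(ℝ, E) p).left_inv hz.2]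
  rw [h.fderiv_eq]
  refine fderiv_comp y ?_ ?_
  · refine (contDiffAt_transition (transition_mem hp) ?_).differentiableAt (by simp)
    rwa [symm_transition hp]
  · exact (contDiffAt_transition hy hp).differentiableAt (by simp)

theorem fderiv_transition_inverse {x q : M} {y : E} (hy : y ∈ (extChartAt 𝓘(ℝ, E) x).target)
    (hq : (extChartAt 𝓘(ℝ, E) x).symm y ∈ (extChartAt 𝓘(ℝ, E) q).source) (v : E) :
    fderiv ℝ (transition E q x) (transition E x q y) (fderiv ℝ (transition E x q) y v) = v ∧
    fderiv ℝ (transition E x q) y (fderiv ℝ (transition E q x) (transition E x q y) v) = v := by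
  have hx := (extChartAt 𝓘(ℝ, E) x).map_target hy
  have h1 := fderiv_transition_comp hy hq hx
  have h2 := fderiv_transition_comp (q := q) (transition_mem hq)
    (by rwa [symm_transition hq]) (by rwa [symm_transition hq])
  have h3 : transition E q x (transition E x q y) = y := by
    have := symm_transition hq
    simp only [transition, Function.comp_apply] at this ⊢
    rw [this, (extChartAt 𝓘(ℝ, E) x).right_inv hy]
  rw [fderiv_transition_self x hy] at h1
  rw [fderiv_transition_self q (transition_mem hq), h3] at h2
  exact ⟨(DFunLike.congr_fun h1 v).symm, (DFunLike.congr_fun h2 v).symm⟩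

namespace FormSection

/-- The cocycle rule for coordinate changes: two local representatives of one section differ by
pullback along the transition map. -/
theorem inChart_transition {x p : M} {y : E} (hy : y ∈ (extChartAt 𝓘(ℝ, E) x).target)
    (hp : (extChartAt 𝓘(ℝ, E) x).symm y ∈ (extChartAt 𝓘(ℝ, E) p).source) (α : FormSection E M) :
    α.inChart x y = FormFibre.pullback (fderiv ℝ (transition E x p) y).toLinearMap
      (α.inChart p (transition E x p y)) := by
  rw [inChart_eq, inChart_eq, symm_transition hp, FormFibre.pullback_pullback,
    fderiv_transition_comp hy hp (mem_extChartAt_source _)]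
  rfl

variable {α β : FormSection E M}

theorem IsSmooth.contDiffAt (hα : α.IsSmooth) {x : M} {y : E}
    (hy : y ∈ (extChartAt 𝓘(ℝ, E) x).target) : ContDiffAt ℝ ∞ (α.inChart x) y :=
  (hα x).contDiffAt (extChartAt_target_mem_nhds' hy)

theorem IsSmooth.differentiableAt (hα : α.IsSmooth) {x : M} {y : E}
    (hy : y ∈ (extChartAt 𝓘(ℝ, E) x).target) : DifferentiableAt ℝ (α.inChart x) y :=
  (hα.contDiffAt hy).differentiableAt (by simp)

/-- At each point `d` is defined in the preferred chart of that point, which varies with the point;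
naturality of `extd` shows that the single chart at `x` computes it throughout. -/
theorem IsSmooth.inChart_d (hα : α.IsSmooth) {x : M} {y : E}
    (hy : y ∈ (extChartAt 𝓘(ℝ, E) x).target) :
    α.d.inChart x y = FormFibre.extd (α.inChart x) y := by
  have hp := mem_extChartAt_source (I := 𝓘(ℝ, E)) ((extChartAt 𝓘(ℝ, E) x).symm y)
  rw [inChart_eq, d_eq, FormFibre.extd_congr (y := y)
    ((eventually_mem_overlap hy hp).mono fun z hz => inChart_transition hz.1 hz.2 α)]
  exact (FormFibre.extd_pullback ((contDiffAt_transition hy hp).of_le (WithTop.coe_le_coe.mpr le_top))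
    (hα.differentiableAt (transition_mem hp))).symm

theorem IsSmooth.d (hα : α.IsSmooth) : α.d.IsSmooth := fun x => by
  have h1 : ContDiffOn ℝ ∞ (fderiv ℝ (α.inChart x)) (extChartAt 𝓘(ℝ, E) x).target :=
    (hα x).fderiv_of_isOpen (isOpen_extChartAt_target x) (by simp)
  refine ContDiffOn.congr ?_ fun y hy => hα.inChart_d hy
  unfold FormFibre.extd
  exact ContDiffOn.sum fun i _ => contDiffOn_linear (FormFibre.wedge _)
    (h1.clm_apply contDiffOn_const)

theorem IsSmooth.d_d (hα : α.IsSmooth) : α.d.d = 0 := by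
  funext x
  rw [d_eq, FormFibre.extd_congr (g := FormFibre.extd (α.inChart x)),
    FormFibre.extd_extd]
  · rfl
  · exact (hα.contDiffAt (mem_extChartAt_target x)).of_le (WithTop.coe_le_coe.mpr le_top)
  · filter_upwards [extChartAt_target_mem_nhds (I := 𝓘(ℝ, E)) x] with y hy
    exact hα.inChart_d hy

end FormSection

end Charts

end

/-! ### The operators of an almost symplectic manifold -/

noncomputable section

namespace FormFibre

variable {E : Type*} [NormedAddCommGroup E] [NormedSpace ℝ E] [FiniteDimensional ℝ E]

open Classical in
/-- The inverse of `v ↦ σ(v, ·)` for a nondegenerate `2`-form `σ`, and zero otherwise. -/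
def sharp (σ : FormFibre E) : Module.Dual ℝ E →ₗ[ℝ] E :=
  if h : Function.Bijective (flat σ) then (LinearEquiv.ofBijective (flat σ) h).symm else 0

theorem isSharp_sharp {σ : FormFibre E} (hσ : σ ∈ ⋀[ℝ]^2 (Module.Dual ℝ E))
    (h : Function.Bijective (flat σ)) : IsSharp σ (sharp σ) where
  mem := hσ
  sharp_flat v := by
    rw [sharp, dif_pos h]; exact (LinearEquiv.ofBijective (flat σ) h).symm_apply_apply v
  flat_sharp a := by
    rw [sharp, dif_pos h]; exact (LinearEquiv.ofBijective (flat σ) h).apply_symm_apply a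

theorem IsSharp.eq_sharp {σ : FormFibre E} {P : Module.Dual ℝ E →ₗ[ℝ] E} (h : IsSharp σ P) :
    IsSharp σ (sharp σ) :=
  isSharp_sharp h.mem ⟨Function.LeftInverse.injective h.sharp_flat,
    Function.RightInverse.surjective h.flat_sharp⟩

end FormFibre

open FormFibre

variable {E : Type*} [NormedAddCommGroup E] [NormedSpace ℝ E] [FiniteDimensional ℝ E]
  {M : Type*} [TopologicalSpace M] [ChartedSpace E M]

namespace AlmostSymplectic

variable (S : AlmostSymplectic E M)

theorem isSharp (x : M) : IsSharp (S.form x) (sharp (S.form x)) :=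
  isSharp_sharp (S.degree_two x) (S.nondegenerate x)

theorem inverse_eq (x : M) : S.inverse x = coForm (sharp (S.form x)) := by
  rw [inverse, inverseForm, coForm, sharp, dif_pos (S.nondegenerate x)]

theorem vol_eq (x : M) : S.vol x = volume (S.form x) := rfl

theorem starω_eq (x : M) : S.starω x = starOp (sharp (S.form x)) (S.form x) := by
  rw [starω, inverse_eq, vol_eq, (S.isSharp x).star_eq_starOp]

theorem adjointω_eq (x : M) : S.adjointω x = adjoint (coForm (sharp (S.form x))) := by
  funext φ
  rw [adjointω, inverse_eq]

theorem Lam_eq (x : M) : S.Lam x = bivector (sharp (S.form x)) := by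
  rw [Lam, adjointω_eq, L, (S.isSharp x).adjoint_mulLeft (S.degree_two x),
    (S.isSharp x).coLefschetz_self]

theorem contractPoisson_apply (α : FormSection E M) (x : M) :
    S.contractPoisson α x = bivector (sharp (S.form x)) (α x) := by
  rw [contractPoisson, bivector_apply]
  congr 1
  refine Finset.sum_congr rfl fun i _ => ?_
  rw [← LinearMap.congr_fun (congrArg FormFibre.interior (sum_coord_smul
    (sharp (S.form x) ((Module.finBasis ℝ E).coord i)))) (α x), interior_sum]
  simp only [LinearMap.sum_apply, map_sum, FormFibre.interior_smul, LinearMap.smul_apply, map_smul,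
    inverse_eq, coForm_apply]

theorem dω_apply (α : FormSection E M) (x : M) :
    S.dω α x = starOp (sharp (S.form x)) (S.form x) (FormSection.d (fun y =>
      starOp (sharp (S.form y)) (S.form y) (parity (α y))) x) := by
  simp only [dω, starω_eq]

variable [IsManifold 𝓘(ℝ, E) ∞ M]

theorem isSharp_inChart (x : M) {y : E} (hy : y ∈ (extChartAt 𝓘(ℝ, E) x).target) :
    IsSharp (S.form.inChart x y) (sharp (S.form.inChart x y)) := by
  have hq := mem_extChartAt_source (I := 𝓘(ℝ, E)) ((extChartAt 𝓘(ℝ, E) x).symm y)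
  refine ((S.isSharp ((extChartAt 𝓘(ℝ, E) x).symm y)).of_pullback
    (A := (fderiv ℝ (transition E x ((extChartAt 𝓘(ℝ, E) x).symm y)) y).toLinearMap)
    (B := (fderiv ℝ (transition E ((extChartAt 𝓘(ℝ, E) x).symm y) x)
      (transition E x ((extChartAt 𝓘(ℝ, E) x).symm y) y)).toLinearMap) ?_ ?_).eq_sharp
  · exact fun v => (fderiv_transition_inverse hy hq v).2
  · exact fun v => (fderiv_transition_inverse hy hq v).1

theorem sharpFamily (x : M) : SharpFamily (extChartAt 𝓘(ℝ, E) x).target (S.form.inChart x)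
    (fun y => sharp (S.form.inChart x y)) where
  isOpen := isOpen_extChartAt_target x
  smooth := S.smooth x
  sharp _ hz := S.isSharp_inChart x hz

theorem surjective_fderiv_transition {x : M} {y : E} (hy : y ∈ (extChartAt 𝓘(ℝ, E) x).target) :
    Function.Surjective
      (fderiv ℝ (transition E x ((extChartAt 𝓘(ℝ, E) x).symm y)) y).toLinearMap :=
  fun v => ⟨_, (fderiv_transition_inverse hy (mem_extChartAt_source _) v).2⟩

theorem inChart_contractPoisson (α : FormSection E M) {x : M} {y : E}
    (hy : y ∈ (extChartAt 𝓘(ℝ, E) x).target) :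
    (S.contractPoisson α).inChart x y =
      bivector (sharp (S.form.inChart x y)) (α.inChart x y) := by
  rw [FormSection.inChart_eq, contractPoisson_apply]
  exact ((S.isSharp _).bivector_pullback (surjective_fderiv_transition hy)
    (S.isSharp_inChart x hy) _).symm

theorem inChart_star (α : FormSection E M) {x : M} {y : E}
    (hy : y ∈ (extChartAt 𝓘(ℝ, E) x).target) :
    FormSection.inChart x (fun y => starOp (sharp (S.form y)) (S.form y) (parity (α y))) y =
      starOp (sharp (S.form.inChart x y)) (S.form.inChart x y) (parity (α.inChart x y)) := by
  rw [FormSection.inChart_eq, FormSection.inChart_eq x α, ← pullback_parity]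
  exact ((S.isSharp _).starOp_pullback (surjective_fderiv_transition hy)
    (S.isSharp_inChart x hy) _).symm

variable {α : FormSection E M} (hα : α.IsSmooth)
include hα

theorem isSmooth_contractPoisson : (S.contractPoisson α).IsSmooth := fun x =>
  ((S.sharpFamily x).contDiffOn_bivector (hα x)).congr fun _ hy => S.inChart_contractPoisson α hy

theorem extd_inChart_contractPoisson (x : M) : (S.contractPoisson α).d x =
    extd (fun z => bivector (sharp (S.form.inChart x z)) (α.inChart x z))
      (extChartAt 𝓘(ℝ, E) x x) := by
  rw [FormSection.d_eq]
  refine extd_congr ?_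
  filter_upwards [extChartAt_target_mem_nhds (I := 𝓘(ℝ, E)) x] with z hz
  exact S.inChart_contractPoisson α hz

/-- `d^ω + [Λ, [d, L]]^ω = [i_π, d]`. -/
theorem dω_add_LamdLω :
    S.dω α + S.LamdLω α = S.contractPoisson α.d - (S.contractPoisson α).d := by
  funext x
  have hx := mem_extChartAt_target (I := 𝓘(ℝ, E)) x
  have h := (S.sharpFamily x).starOp_extd_starOp hx (hα.differentiableAt hx)
  have h1 : FormSection.d (fun y => starOp (sharp (S.form y)) (S.form y) (parity (α y))) x =
      extd (fun z => starOp (sharp (S.form.inChart x z)) (S.form.inChart x z)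
        (parity (α.inChart x z))) (extChartAt 𝓘(ℝ, E) x x) := by
    rw [FormSection.d_eq]
    refine extd_congr ?_
    filter_upwards [extChartAt_target_mem_nhds (I := 𝓘(ℝ, E)) x] with z hz
    exact S.inChart_star α hz
  rw [← h1] at h
  simp only [FormSection.inChart_self, ← FormSection.d_eq,
    ← S.extd_inChart_contractPoisson hα x] at h
  simp only [Pi.add_apply, Pi.sub_apply, dω_apply, h, contractPoisson_apply, LamdLω, LamdL, Lam_eq,
    dL, adjointω_eq]
  abel

/-- `-[d, L]^ω` is half the commutator of `i_π` with `[i_π, d]`. -/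
theorem dLω_eq :
    S.contractPoisson (S.contractPoisson α.d - (S.contractPoisson α).d) -
      (S.contractPoisson (S.contractPoisson α).d -
        (S.contractPoisson (S.contractPoisson α)).d) = (-2 : ℝ) • S.dLω α := by
  funext x
  have hx := mem_extChartAt_target (I := 𝓘(ℝ, E)) x
  have hF := S.sharpFamily x
  have hΛα := S.isSmooth_contractPoisson hα
  have h1 := hF.bivector_extd_sub hx (hα.differentiableAt hx)
  have h2 := hF.bivector_extd_sub hx (hΛα.differentiableAt hx)
  have h3 := hF.adjoint_extd hx
  have h4 : fderiv ℝ ((S.contractPoisson α).inChart x) (extChartAt 𝓘(ℝ, E) x x) =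
      fderiv ℝ (fun z => bivector (sharp (S.form.inChart x z)) (α.inChart x z))
        (extChartAt 𝓘(ℝ, E) x x) := by
    refine Filter.EventuallyEq.fderiv_eq ?_
    filter_upwards [extChartAt_target_mem_nhds (I := 𝓘(ℝ, E)) x] with z hz
    exact S.inChart_contractPoisson α hz
  simp only [h4, (hF.fderiv_bivector_apply hx (hα.differentiableAt hx)).2] at h2
  simp only [FormSection.inChart_self, ← FormSection.d_eq,
    ← S.extd_inChart_contractPoisson hα x] at h1
  simp only [FormSection.inChart_self, ← FormSection.d_eq,
    ← S.extd_inChart_contractPoisson hΛα x] at h2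
  simp only [FormSection.inChart_self, ← FormSection.d_eq] at h3
  simp only [Pi.sub_apply, Pi.smul_apply, contractPoisson_apply, dLω, dL, adjointω_eq, h3] at h1 h2 ⊢
  rw [h1, h2, map_sum, ← Finset.sum_sub_distrib, LinearMap.sum_apply, Finset.smul_sum]
  refine Finset.sum_congr rfl fun i _ => ?_
  -- In direction `eᵢ`, with `τ = ∂ᵢω`, one has `[Λ, eⁱ ∧ ·] = -i(P eⁱ)` and `[Λ, ∂ᵢ] = Λ_τ`, while
  -- contractions commute with `Λ`. The two summands of `[i_π, d]` therefore contribute `-i(P eⁱ)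
  -- Λ_τ` each, whence the factor `-2`.
  have h5 := (S.isSharp x).antisymm
  simp only [coLefschetz, map_sub, bivector_ι_mul h5, Module.End.mul_apply, interior_bivector,
    bivector_bivector (sharp (S.form x)) (sharp (S.form x) ∘ₗ _)]
  module

end AlmostSymplectic

end

/-! ### Comparison with the almost Hermitian operators -/

noncomputable section

open FormFibre

variable {E : Type*} [NormedAddCommGroup E] [NormedSpace ℝ E] [FiniteDimensional ℝ E]
  {M : Type*} [TopologicalSpace M] [ChartedSpace E M] [IsManifold 𝓘(ℝ, E) ∞ M]

theorem FormSection.IsSmooth.d_mem {α : FormSection E M} (hα : α.IsSmooth) {k : ℕ}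
    (hk : ∀ x, α x ∈ ⋀[ℝ]^k (Module.Dual ℝ E)) (x : M) :
    α.d x ∈ ⋀[ℝ]^(k + 1) (Module.Dual ℝ E) := by
  rw [FormSection.d_eq]
  refine Submodule.sum_mem _ fun i _ => ι_mul_mem _ ?_
  exact fderiv_mem_of_eventually (hα.differentiableAt (mem_extChartAt_target x)) _
    (Filter.Eventually.of_forall fun y => pullback_mem _ (hk _)) _

namespace AlmostHermitian

variable (H : AlmostHermitian E M)

theorem isCompatible (x : M) : IsCompatible (H.form x) (H.Jlin x) where
  sq := H.J_sq x
  symm := H.symm x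

/-- The metric sends `v` to `ω(v, J ·)`; at `v = J (P a)` this is the pullback by `J` of `ω`,
contracted with `P a`, hence `a`. -/
theorem inverseMetric_eq (x : M) :
    H.inverseMetric x = coForm (H.Jlin x ∘ₗ sharp (H.form x)) := by
  have hs := H.isSharp x
  rw [inverseMetric, inverseForm, coForm]
  congr 1
  refine LinearMap.ext fun a => ?_
  rw [LinearEquiv.coe_coe, LinearEquiv.symm_apply_eq]
  refine LinearMap.ext fun w => ?_
  have h1 := flat_pullback (H.Jlin x) hs.mem (sharp (H.form x) a)
  rw [(H.isCompatible x).pullback_form hs, hs.flat_sharp] at h1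
  exact LinearMap.congr_fun h1 w

theorem hodgeStar_eq (x : M) : H.hodgeStar x =
    starOp (sharp (H.form x)) (H.form x) * (pullback (H.Jlin x)).toLinearMap := by
  rw [hodgeStar, inverseMetric_eq]
  exact (H.isCompatible x).star_metric (H.isSharp x)

theorem adjoint_eq (x : M) :
    H.adjoint x = FormFibre.adjoint (coForm (H.Jlin x ∘ₗ sharp (H.form x))) := by
  funext φ
  rw [adjoint, inverseMetric_eq]

theorem metricLam_eq (x : M) : H.metricLam x = bivector (sharp (H.form x)) := by
  rw [metricLam, adjoint_eq]
  exact (H.isCompatible x).adjoint_metric_mulLeft (H.isSharp x)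

theorem torsion_eq (x : M) : H.torsion x = H.LamdL x := by
  rw [torsion, metricLam_eq, AlmostSymplectic.LamdL, AlmostSymplectic.Lam_eq]; rfl

theorem d_form_mul_parity (x : M) (β : FormFibre E) :
    H.form.d x * parity β = -parity (H.form.d x * β) := by
  rw [map_mul, parity_of_mem (H.smooth.d_mem H.degree_two x)]
  norm_num

/-- `d_c^* = -d^ω`. -/
theorem dcStar_eq (α : FormSection E M) : H.dcStar α = -H.dω α := by
  funext x
  -- `J ⋆ = J ⋆_ω J = ⋆_ω J²`, and `J² = (-1)ᵏ` is the sign in the definition of `d^ω`. The outer `⋆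
  -- J⁻¹` reduces to `⋆_ω` in the same way.
  have h1 : (fun y => H.Jform y (H.hodgeStar y (α y))) =
      fun y => starOp (sharp (H.form y)) (H.form y) (parity (α y)) := by
    funext y
    rw [hodgeStar_eq, Jform, Module.End.mul_apply, AlgHom.toLinearMap_apply,
      AlgHom.toLinearMap_apply, ← (H.isCompatible y).starOp_pullback (H.isSharp y),
      (H.isCompatible y).pullback_sq]
  rw [dcStar, dc, h1, hodgeStar_eq, Pi.neg_apply, AlmostSymplectic.dω_apply, JformInv,
    Module.End.mul_apply, AlgHom.toLinearMap_apply, AlgHom.toLinearMap_apply,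
    (H.isCompatible x).pullback_pullback_neg]

/-- `dω_c^* = -[d, L]^ω`. -/
theorem dωcStar_eq (α : FormSection E M) : H.dωcStar α = -H.dLω α := by
  funext x
  rw [dωcStar, adjoint_eq, JformInv, Jform,
    (H.isCompatible x).adjoint_metric_conj (H.isSharp x) (H.d_form_mul_parity x),
    ← AlmostSymplectic.adjointω_eq]
  rfl

/-- `T_c^* = -[Λ, [d, L]]^ω`. -/
theorem TcStar_eq (α : FormSection E M) : H.TcStar α = -H.LamdLω α := by
  funext x
  have h1 : ∀ β, H.torsion x (parity β) = -parity (H.torsion x β) := fun β => by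
    simp only [torsion, metricLam_eq, LinearMap.sub_apply, Module.End.mul_apply,
      LinearMap.mulLeft_apply, bivector_parity, H.d_form_mul_parity, map_neg, map_sub]
    abel
  rw [TcStar, adjoint_eq, JformInv, Jform,
    (H.isCompatible x).adjoint_metric_conj (H.isSharp x) h1,
    ← AlmostSymplectic.adjointω_eq, torsion_eq]
  rfl

theorem hermitianΔ_eq (n : ℕ) (α : FormSection E M) :
    H.hermitianΔ n α = H.toAlmostSymplectic.Δ n α := by
  match n with
  | 0 => rfl
  | 1 => simp only [hermitianΔ, AlmostSymplectic.Δ, dcStar_eq, TcStar_eq]; abel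
  | 2 => simp only [hermitianΔ, AlmostSymplectic.Δ, dωcStar_eq]
  | n + 3 => rfl

end AlmostHermitian

end

noncomputable section

/-! ### Operators of finite order -/

section Order

variable {A : Type*} [Ring A] [Algebra ℝ A] {𝒜 : ℤ → Submodule ℝ A}

theorem neg_one_zpow_sq (n : ℤ) : (-1 : ℝ) ^ n * (-1 : ℝ) ^ n = 1 := by
  rw [← zpow_add₀ (by norm_num), Even.neg_one_zpow ⟨n, rfl⟩]

theorem gradedCommutator_add (p q : ℤ) (f g g' : Module.End ℝ A) :
    gradedCommutator p q f (g + g') = gradedCommutator p q f g + gradedCommutator p q f g' := by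
  simp only [gradedCommutator, mul_add, add_mul, smul_add]; abel

theorem gradedCommutator_smul (p q : ℤ) (f : Module.End ℝ A) (r : ℝ) (g : Module.End ℝ A) :
    gradedCommutator p q f (r • g) = r • gradedCommutator p q f g := by
  simp only [gradedCommutator, mul_smul_comm, smul_mul_assoc, smul_sub, smul_comm r]

theorem gradedCommutator_swap (p q : ℤ) (f g : Module.End ℝ A) :
    gradedCommutator p q f g = (-(-1 : ℝ) ^ (p * q)) • gradedCommutator q p g f := by
  simp only [gradedCommutator, smul_sub, smul_smul, neg_mul, mul_comm q p, neg_one_zpow_sq]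
  module

theorem gradedCommutator_mul (j p q : ℤ) (a f g : Module.End ℝ A) :
    gradedCommutator j (p + q) a (f * g) =
      gradedCommutator j p a f * g + (-1 : ℝ) ^ (j * p) • (f * gradedCommutator j q a g) := by
  simp only [gradedCommutator, mul_add, zpow_add₀ (show (-1 : ℝ) ≠ 0 by norm_num), sub_mul,
    mul_sub, smul_mul_assoc, mul_smul_comm, mul_assoc, smul_sub, smul_smul]
  abel

theorem gradedCommutator_jacobi (j p q : ℤ) (a f g : Module.End ℝ A) :
    gradedCommutator j (p + q) a (gradedCommutator p q f g) =
      gradedCommutator (j + p) q (gradedCommutator j p a f) g +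
        (-1 : ℝ) ^ (j * p) • gradedCommutator p (j + q) f (gradedCommutator j q a g) := by
  have h := neg_one_zpow_sq (j * p)
  simp only [gradedCommutator, mul_add, add_mul, zpow_add₀ (show (-1 : ℝ) ≠ 0 by norm_num),
    mul_comm p j]
  generalize (-1 : ℝ) ^ (j * p) = x at *
  generalize (-1 : ℝ) ^ (j * q) = y at *
  generalize (-1 : ℝ) ^ (p * q) = z at *
  simp only [sub_mul, mul_sub, smul_mul_assoc, mul_smul_comm, mul_assoc, smul_sub, smul_smul]
  rw [← mul_assoc x x z, h, ← mul_assoc x x (z * y), h, one_mul, one_mul]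
  module

namespace HasOrderLE

theorem zero (r : ℕ) (k : ℤ) : HasOrderLE 𝒜 r k (0 : Module.End ℝ A) := by
  induction r generalizing k with
  | zero => exact ⟨0, zero_mem _, by simp⟩
  | succ r ih =>
    refine ⟨fun j a _ => by simp, fun j a _ => ?_⟩
    simpa [gradedCommutator] using ih (j + k)

theorem add {r : ℕ} {k : ℤ} {f g : Module.End ℝ A} (hf : HasOrderLE 𝒜 r k f)
    (hg : HasOrderLE 𝒜 r k g) : HasOrderLE 𝒜 r k (f + g) := by
  induction r generalizing k f g with
  | zero =>
    obtain ⟨c, hc, rfl⟩ := hf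
    obtain ⟨c', hc', rfl⟩ := hg
    exact ⟨c + c', add_mem hc hc', LinearMap.ext fun x => (add_mul c c' x).symm⟩
  | succ r ih =>
    refine ⟨fun j a ha => add_mem (hf.1 j a ha) (hg.1 j a ha), fun j a ha => ?_⟩
    rw [gradedCommutator_add]
    exact ih (hf.2 j a ha) (hg.2 j a ha)

theorem smul {r : ℕ} {k : ℤ} {f : Module.End ℝ A} (hf : HasOrderLE 𝒜 r k f) (t : ℝ) :
    HasOrderLE 𝒜 r k (t • f) := by
  induction r generalizing k f with
  | zero =>
    obtain ⟨c, hc, rfl⟩ := hf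
    exact ⟨t • c, Submodule.smul_mem _ t hc, LinearMap.ext fun x => (smul_mul_assoc t c x).symm⟩
  | succ r ih =>
    refine ⟨fun j a ha => Submodule.smul_mem _ t (hf.1 j a ha), fun j a ha => ?_⟩
    rw [gradedCommutator_smul]
    exact ih (hf.2 j a ha)

theorem sum {ι : Type*} (s : Finset ι) {r : ℕ} {k : ℤ} {f : ι → Module.End ℝ A}
    (hf : ∀ i, HasOrderLE 𝒜 r k (f i)) : HasOrderLE 𝒜 r k (∑ i ∈ s, f i) :=
  Finset.sum_induction f (HasOrderLE 𝒜 r k) (fun _ _ => add) (zero r k) fun i _ => hf i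

variable (hmul : ∀ j k, ∀ a ∈ 𝒜 j, ∀ b ∈ 𝒜 k, a * b ∈ 𝒜 (j + k))
  (hcomm : ∀ j k, ∀ a ∈ 𝒜 j, ∀ b ∈ 𝒜 k, a * b = ((-1 : ℝ) ^ (j * k)) • (b * a))

include hmul in
theorem map_mem {r : ℕ} {k : ℤ} {f : Module.End ℝ A} (hf : HasOrderLE 𝒜 r k f) {j : ℤ} {a : A}
    (ha : a ∈ 𝒜 j) : f a ∈ 𝒜 (j + k) := by
  cases r with
  | zero =>
    obtain ⟨c, hc, rfl⟩ := hf
    rw [add_comm]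
    exact hmul _ _ c hc a ha
  | succ r => exact hf.1 j a ha

include hcomm in
theorem gradedCommutator_mulLeft {j k : ℤ} {a c : A} (ha : a ∈ 𝒜 j) (hc : c ∈ 𝒜 k) :
    gradedCommutator j k (LinearMap.mulLeft ℝ a) (LinearMap.mulLeft ℝ c) = 0 :=
  LinearMap.ext fun x => by
    simp only [gradedCommutator, LinearMap.sub_apply, LinearMap.smul_apply, Module.End.mul_apply,
      LinearMap.mulLeft_apply, ← mul_assoc, hcomm j k a ha c hc, smul_mul_assoc, sub_self,
      LinearMap.zero_apply]

include hmul hcomm in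
theorem mul {r s : ℕ} {p q : ℤ} {f g : Module.End ℝ A} (hf : HasOrderLE 𝒜 r p f)
    (hg : HasOrderLE 𝒜 s q g) : HasOrderLE 𝒜 (r + s) (p + q) (f * g) := by
  induction hn : r + s generalizing r s p q f g with
  | zero =>
    obtain ⟨rfl, rfl⟩ : r = 0 ∧ s = 0 := by omega
    obtain ⟨c, hc, rfl⟩ := hf
    obtain ⟨c', hc', rfl⟩ := hg
    exact ⟨c * c', hmul _ _ c hc c' hc', LinearMap.ext fun x => (mul_assoc c c' x).symm⟩
  | succ n ih =>
    refine ⟨fun j a ha => ?_, fun j a ha => ?_⟩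
    · rw [add_comm p q, ← add_assoc]
      exact hf.map_mem hmul (hg.map_mem hmul ha)
    · rw [gradedCommutator_mul]
      refine add ?_ (smul ?_ _)
      · cases r with
        | zero =>
          obtain ⟨c, hc, rfl⟩ := hf
          rw [gradedCommutator_mulLeft hcomm ha hc, zero_mul]
          exact zero _ _
        | succ r =>
          rw [← add_assoc]
          exact ih (hf.2 j a ha) hg (by omega)
      · cases s with
        | zero =>
          obtain ⟨c, hc, rfl⟩ := hg
          rw [gradedCommutator_mulLeft hcomm ha hc, mul_zero]
          exact zero _ _
        | succ s =>
          rw [add_left_comm]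
          exact ih hf (hg.2 j a ha) (by omega)

include hmul hcomm in
-- By the Jacobi identity, bracketing with a multiplication lowers the order of one of the two
-- factors, so induction on the sum of the orders applies.
theorem commutator {r s : ℕ} {p q : ℤ} {f g : Module.End ℝ A}
    (hf : HasOrderLE 𝒜 (r + 1) p f) (hg : HasOrderLE 𝒜 (s + 1) q g) :
    HasOrderLE 𝒜 (r + s + 1) (p + q) (_root_.gradedCommutator p q f g) := by
  induction hn : r + s using Nat.strong_induction_on generalizing r s p q f g with
  | _ n ih =>
  refine ⟨fun j a ha => ?_, fun j a ha => ?_⟩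
  · refine sub_mem ?_ (Submodule.smul_mem _ _ ?_)
    · rw [add_comm p q, ← add_assoc]
      exact hf.1 _ _ (hg.1 _ _ ha)
    · rw [← add_assoc]
      exact hg.1 _ _ (hf.1 _ _ ha)
  · rw [gradedCommutator_jacobi]
    refine add ?_ (smul ?_ _)
    · rw [← add_assoc]
      have h := hf.2 j a ha
      cases r with
      | zero =>
        -- For `f` of order one, `[a, f]` is multiplication by some `c`, and `[c, g]` has the
        -- required order by the definition of the order of `g`.
        obtain ⟨c, hc, hf'⟩ := h
        rw [hf', ← hn, zero_add]
        exact hg.2 _ c hc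
      | succ r =>
        have := ih (r + s) (by omega) h hg rfl
        rwa [show r + s + 1 = n by omega] at this
    · rw [add_left_comm]
      have h := hg.2 j a ha
      cases s with
      | zero =>
        obtain ⟨c, hc, hg'⟩ := h
        rw [hg', gradedCommutator_swap, ← hn, add_zero, add_comm p]
        exact smul (hf.2 _ c hc) _
      | succ s =>
        have := ih (r + s) (by omega) hf h rfl
        rwa [show r + s + 1 = n by omega] at this

end HasOrderLE

end Order

end

/-! ### The de Rham algebra: grading and fibrewise operators -/

noncomputable section

/-- A derivation of degree `k` is an operator of order at most one. -/
theorem HasOrderLE.of_leibniz {A : Type*} [Ring A] [Algebra ℝ A] {𝒜 : ℤ → Submodule ℝ A} {k : ℤ}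
    {f : Module.End ℝ A} (hf : ∀ j, ∀ a ∈ 𝒜 j, f a ∈ 𝒜 (j + k))
    (h : ∀ j, ∀ a ∈ 𝒜 j, ∀ b, f (a * b) = f a * b + (-1 : ℝ) ^ (j * k) • (a * f b)) :
    HasOrderLE 𝒜 1 k f := by
  refine ⟨hf, fun j a ha => ⟨(-(-1 : ℝ) ^ (j * k)) • f a, Submodule.smul_mem _ _ (hf j a ha),
    LinearMap.ext fun b => ?_⟩⟩
  simp only [gradedCommutator, LinearMap.sub_apply, LinearMap.smul_apply, Module.End.mul_apply,
    LinearMap.mulLeft_apply, h j a ha, smul_add, smul_smul, neg_one_zpow_sq, smul_mul_assoc]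
  module

namespace FormFibre

variable {E : Type*} [NormedAddCommGroup E] [NormedSpace ℝ E] [FiniteDimensional ℝ E]

theorem deg_cases {k : ℤ} {x : FormFibre E} (hx : x ∈ deg k) :
    x = 0 ∨ ∃ n : ℕ, k = n ∧ x ∈ ⋀[ℝ]^n (Module.Dual ℝ E) := by
  match k with
  | Int.ofNat n => exact Or.inr ⟨n, rfl, hx⟩
  | Int.negSucc n => exact Or.inl hx

theorem parity_of_mem_deg {k : ℤ} {x : FormFibre E} (hx : x ∈ deg k) :
    parity x = (-1 : ℝ) ^ k • x := by
  obtain rfl | ⟨n, rfl, hx⟩ := deg_cases hx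
  · simp
  · rw [parity_of_mem hx, zpow_natCast]

theorem mul_mem_deg_add {j k : ℤ} {x y : FormFibre E} (hx : x ∈ deg j) (hy : y ∈ deg k) :
    x * y ∈ deg (j + k) := by
  obtain rfl | ⟨n, rfl, hx⟩ := deg_cases hx
  · rw [zero_mul]; exact zero_mem _
  obtain rfl | ⟨m, rfl, hy⟩ := deg_cases hy
  · rw [mul_zero]; exact zero_mem _
  exact mul_mem_deg hx hy

theorem deg_comm {j k : ℤ} {x y : FormFibre E} (hx : x ∈ deg j) (hy : y ∈ deg k) :
    x * y = (-1 : ℝ) ^ (j * k) • (y * x) := by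
  obtain rfl | ⟨n, rfl, hx⟩ := deg_cases hx
  · simp
  obtain rfl | ⟨m, rfl, hy⟩ := deg_cases hy
  · simp
  rw [graded_comm hx hy]
  norm_cast

theorem interior_mem_deg (v : E) {k : ℤ} {x : FormFibre E} (hx : x ∈ deg k) :
    interior v x ∈ deg (k + -1) := by
  obtain rfl | ⟨n, rfl, hx⟩ := deg_cases hx
  · rw [map_zero]; exact zero_mem _
  cases n with
  | zero => rw [interior_of_mem_zero v hx]; exact zero_mem _
  | succ n =>
    rw [Nat.cast_succ, add_neg_cancel_right]
    exact interior_mem v hx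

theorem hasOrderLE_interior (v : E) : HasOrderLE (deg (E := E)) 1 (-1) (interior v) := by
  refine .of_leibniz (fun j a ha => interior_mem_deg v ha) fun j a ha b => ?_
  rw [interior_mul, parity_of_mem_deg ha, smul_mul_assoc, mul_neg_one, zpow_neg, ← inv_zpow, inv_neg,
    inv_one]

theorem hasOrderLE_bivector (Q : Module.Dual ℝ E →ₗ[ℝ] E) :
    HasOrderLE (deg (E := E)) 2 (-2) (bivector Q) :=
  .smul (.sum _ fun _ => .mul (fun _ _ _ ha _ hb => mul_mem_deg_add ha hb)
    (fun _ _ _ ha _ hb => deg_comm ha hb) (hasOrderLE_interior _) (hasOrderLE_interior _)) _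

/-- The projection to the component of degree `k`. -/
def proj (k : ℕ) : Module.End ℝ (FormFibre E) :=
  GradedAlgebra.proj (fun i : ℕ => ⋀[ℝ]^i (Module.Dual ℝ E)) k

theorem proj_mem (k : ℕ) (x : FormFibre E) : proj k x ∈ ⋀[ℝ]^k (Module.Dual ℝ E) :=
  (DirectSum.decompose (fun i : ℕ => ⋀[ℝ]^i (Module.Dual ℝ E)) x k).2

theorem proj_of_mem {k n : ℕ} {x : FormFibre E} (hx : x ∈ ⋀[ℝ]^n (Module.Dual ℝ E)) :
    proj k x = if k = n then x else 0 := by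
  rw [proj, GradedAlgebra.proj_apply]
  split_ifs with h
  · subst h; exact DirectSum.decompose_of_mem_same _ hx
  · exact DirectSum.decompose_of_mem_ne _ hx (Ne.symm h)

theorem sum_proj (x : FormFibre E) :
    ∑ k ∈ Finset.range (Module.finrank ℝ E + 1), proj k x = x := by
  have h : ∑ k ∈ Finset.range (Module.finrank ℝ E + 1), proj k =
      (LinearMap.id : Module.End ℝ (FormFibre E)) := by
    refine hom_ext_deg fun n hn x hx => ?_
    rw [LinearMap.sum_apply, LinearMap.id_apply]
    simp only [proj_of_mem hx]
    rw [Finset.sum_ite_eq', if_pos (Finset.mem_range.mpr (by omega))]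
  rw [← LinearMap.sum_apply, h, LinearMap.id_apply]

theorem proj_pullback (A : E →ₗ[ℝ] E) (k : ℕ) (x : FormFibre E) :
    proj k (pullback A x) = pullback A (proj k x) := by
  have h : proj k ∘ₗ (pullback A).toLinearMap = (pullback A).toLinearMap ∘ₗ proj k := by
    refine hom_ext_deg fun n hn x hx => ?_
    simp only [LinearMap.comp_apply, AlgHom.toLinearMap_apply, proj_of_mem hx,
      proj_of_mem (pullback_mem A hx)]
    split_ifs <;> simp
  exact LinearMap.congr_fun h x

end FormFibre

open FormFibre

variable {E : Type*} [NormedAddCommGroup E] [NormedSpace ℝ E] [FiniteDimensional ℝ E]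
  {M : Type*} [TopologicalSpace M] [ChartedSpace E M]

namespace FormSection

theorem inChart_add (x : M) (α β : FormSection E M) :
    (α + β).inChart x = fun y => α.inChart x y + β.inChart x y := by
  funext y; simp [inChart]

theorem inChart_smul (x : M) (r : ℝ) (α : FormSection E M) :
    FormSection.inChart x (r • α) = fun y => r • α.inChart x y := by
  funext y; simp [inChart]

theorem inChart_mul (x : M) (α β : FormSection E M) :
    FormSection.inChart x (α * β) = fun y => α.inChart x y * β.inChart x y := by
  funext y; simp [inChart]

variable [IsManifold 𝓘(ℝ, E) ∞ M] {α β : FormSection E M}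

theorem IsSmooth.d_add (hα : α.IsSmooth) (hβ : β.IsSmooth) :
    FormSection.d (α + β) = α.d + β.d := by
  funext x
  have hx := mem_extChartAt_target (I := 𝓘(ℝ, E)) x
  rw [d_eq, inChart_add, extd_add (hα.differentiableAt hx) (hβ.differentiableAt hx)]
  rfl

theorem IsSmooth.d_smul (hα : α.IsSmooth) (r : ℝ) : FormSection.d (r • α) = r • α.d := by
  funext x
  rw [d_eq, inChart_smul, extd_smul r (hα.differentiableAt (mem_extChartAt_target x))]
  rfl

theorem IsSmooth.d_mul (hα : α.IsSmooth) (hβ : β.IsSmooth) (x : M) :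
    FormSection.d (α * β) x = α.d x * β x + parity (α x) * β.d x := by
  have hx := mem_extChartAt_target (I := 𝓘(ℝ, E)) x
  rw [d_eq, inChart_mul, extd_mul (hα.differentiableAt hx) (hβ.differentiableAt hx), inChart_self,
    inChart_self]
  rfl

theorem IsSmooth.d_mem_deg (hα : α.IsSmooth) {k : ℤ} (hk : ∀ x, α x ∈ deg k) (x : M) :
    α.d x ∈ deg (k + 1) := by
  match k with
  | Int.ofNat n => exact hα.d_mem hk x
  | Int.negSucc n =>
    -- There are no nonzero forms of negative degree, so `α` is zero.
    have h : FormSection.d ((0 : ℝ) • α) = α.d := by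
      congr 1; funext y; rw [zero_smul]; exact (hk y).symm
    rw [← h, hα.d_smul, zero_smul]; exact zero_mem _

end FormSection

namespace DeRham

/-- The operator on the de Rham algebra given by operators on the fibres. -/
def fibrewise (τ : M → Module.End ℝ (FormFibre E))
    (h : ∀ α : FormSection E M, α.IsSmooth → FormSection.IsSmooth fun x => τ x (α x)) :
    Module.End ℝ (DeRham E M) where
  toFun α := ⟨fun x => τ x ((α : FormSection E M) x), h α α.2⟩
  map_add' _ _ := Subtype.ext <| funext fun x => map_add (τ x) _ _
  map_smul' r _ := Subtype.ext <| funext fun x => map_smul (τ x) r _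

/-- A bracket with a multiplication is again fibrewise. In order zero the multiplier has to be a
smooth form, and `T 1` provides it. -/
theorem hasOrderLE_of_fibrewise {τ : M → Module.End ℝ (FormFibre E)} {T : Module.End ℝ (DeRham E M)}
    (hT : ∀ α x, (T α : FormSection E M) x = τ x ((α : FormSection E M) x)) {r : ℕ} {k : ℤ}
    (h : ∀ x, HasOrderLE FormFibre.deg r k (τ x)) : HasOrderLE (DeRham.deg E M) r k T := by
  induction r generalizing k τ T with
  | zero =>
    choose c hc hτ using h
    have h1 : ∀ x, (T 1 : FormSection E M) x = c x := fun x => by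
      rw [hT, hτ]; exact mul_one _
    refine ⟨T 1, fun x => by rw [h1]; exact hc x, LinearMap.ext fun α => Subtype.ext ?_⟩
    funext x
    rw [hT, hτ]
    exact congrArg (· * (α : FormSection E M) x) (h1 x).symm
  | succ r ih =>
    refine ⟨fun j α hα x => ?_, fun j α hα => ?_⟩
    · rw [hT]; exact (h x).1 j _ (hα x)
    · refine ih (τ := fun x => gradedCommutator j k (LinearMap.mulLeft ℝ ((α : FormSection E M) x))
        (τ x)) (fun β x => ?_) fun x => (h x).2 j _ (hα x)
      change (α : FormSection E M) x * (T β : FormSection E M) x -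
        (-1 : ℝ) ^ (j * k) • (T (α * β) : FormSection E M) x = _
      rw [hT, hT]
      rfl

theorem mul_mem_deg (j k : ℤ) (α : DeRham E M) (hα : α ∈ DeRham.deg E M j) (β : DeRham E M)
    (hβ : β ∈ DeRham.deg E M k) : α * β ∈ DeRham.deg E M (j + k) :=
  fun x => mul_mem_deg_add (hα x) (hβ x)

theorem deg_comm (j k : ℤ) (α : DeRham E M) (hα : α ∈ DeRham.deg E M j) (β : DeRham E M)
    (hβ : β ∈ DeRham.deg E M k) : α * β = ((-1 : ℝ) ^ (j * k)) • (β * α) :=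
  Subtype.ext <| funext fun x => FormFibre.deg_comm (hα x) (hβ x)

/-- The projection to the component of degree `k`. -/
def proj (k : ℕ) : Module.End ℝ (DeRham E M) :=
  fibrewise (fun _ => FormFibre.proj k) fun _ hα x =>
    (contDiffOn_linear (FormFibre.proj k) (hα x)).congr fun _ _ => (proj_pullback _ k _).symm

theorem proj_mem (k : ℕ) (α : DeRham E M) : proj k α ∈ DeRham.deg E M k :=
  fun _ => FormFibre.proj_mem k _

theorem sum_proj (α : DeRham E M) :
    ∑ k ∈ Finset.range (Module.finrank ℝ E + 1), proj k α = α := by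
  refine Subtype.ext <| funext fun x => ?_
  rw [AddSubmonoidClass.coe_finsetSum, Finset.sum_apply]
  exact FormFibre.sum_proj _

theorem proj_of_mem {k n : ℕ} {α : DeRham E M} (hα : α ∈ DeRham.deg E M n) :
    proj k α = if k = n then α else 0 := by
  refine Subtype.ext <| funext fun x => (FormFibre.proj_of_mem (hα x)).trans ?_
  split_ifs <;> rfl

theorem eq_zero_of_mem_negSucc {n : ℕ} {α : DeRham E M}
    (hα : α ∈ DeRham.deg E M (Int.negSucc n)) : α = 0 :=
  Subtype.ext <| funext hα

theorem isInternal : DirectSum.IsInternal (DeRham.deg E M) := by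
  refine DirectSum.isInternal_submodule_of_iSupIndep_of_iSup_eq_top (fun i => ?_)
    (eq_top_iff.mpr fun α _ => ?_)
  · rw [Submodule.disjoint_def]
    intro α hα hα'
    match i with
    | Int.negSucc n => exact eq_zero_of_mem_negSucc hα
    | Int.ofNat n =>
      have h : ⨆ (j : ℤ) (_ : j ≠ n), DeRham.deg E M j ≤ LinearMap.ker (proj n) := by
        refine iSup₂_le fun j hj β hβ => ?_
        match j with
        | Int.negSucc l => rw [eq_zero_of_mem_negSucc hβ]; exact zero_mem _
        | Int.ofNat l =>
          rw [LinearMap.mem_ker, proj_of_mem hβ, if_neg]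
          rintro rfl
          exact hj rfl
      rw [← LinearMap.mem_ker.mp (h hα'), proj_of_mem hα, if_pos rfl]
  · rw [← sum_proj α]
    exact Submodule.sum_mem _ fun k _ => Submodule.mem_iSup_of_mem (k : ℤ) (proj_mem k α)

end DeRham

end

/-! ### The `BV_∞` relations for iterated commutators with a contraction -/

noncomputable section

section Multicomplex

variable {A : Type*} [AddCommGroup A] [Module ℝ A]

/-- The operators `d`, `[Λ, d]`, `[Λ, [Λ, d]] / 2`, `0`, …. -/
def contractionTower (D Λ : Module.End ℝ A) : ℕ → Module.End ℝ A
  | 0 => D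
  | 1 => Λ * D - D * Λ
  | 2 => (1 / 2 : ℝ) • (Λ * (Λ * D - D * Λ) - (Λ * D - D * Λ) * Λ)
  | _ => 0

/-- Each relation is the commutator of `Λ` with the preceding one, starting from `D² = 0`, up to a
nonzero factor: `ad Λ` is a derivation with `D ↦ X`, `X ↦ 2Y`, `Y ↦ 0`. -/
theorem contractionTower_multicomplex {D Λ : Module.End ℝ A} (hD : D * D = 0)
    (hΛ : Λ * contractionTower D Λ 2 = contractionTower D Λ 2 * Λ) (n : ℕ) :
    ∑ i ∈ Finset.range (n + 1), contractionTower D Λ i * contractionTower D Λ (n - i) = 0 := by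
  have h0 : ∀ n, contractionTower D Λ (n + 3) = 0 := fun _ => rfl
  have hX : Λ * D - D * Λ = contractionTower D Λ 1 := rfl
  have hY : Λ * contractionTower D Λ 1 - contractionTower D Λ 1 * Λ =
      (2 : ℝ) • contractionTower D Λ 2 := by
    simp only [contractionTower, smul_smul]; norm_num
  have hd : contractionTower D Λ 0 = D := rfl
  have hZ := sub_eq_zero.mpr hΛ
  generalize hX' : contractionTower D Λ 1 = X at *
  generalize hY' : contractionTower D Λ 2 = Y at *
  have had : ∀ f g : Module.End ℝ A,
      Λ * (f * g) - f * g * Λ = (Λ * f - f * Λ) * g + f * (Λ * g - g * Λ) := fun f g => by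
    noncomm_ring
  have h1 : X * D + D * X = 0 := by
    rw [← hX, ← had, hD, mul_zero, zero_mul, sub_zero]
  have h2 : D * Y + X * X + Y * D = 0 := by
    have h : (2 : ℝ) • (D * Y + X * X + Y * D) =
        Λ * (X * D + D * X) - (X * D + D * X) * Λ := by
      rw [mul_add, add_mul, add_sub_add_comm, had, had, hX, hY]
      simp only [smul_mul_assoc, mul_smul_comm]
      module
    rw [h1, mul_zero, zero_mul, sub_zero] at h
    exact (smul_eq_zero.mp h).resolve_left two_ne_zero
  have h3 : X * Y + Y * X = 0 := by
    -- `D Y + Y D` contributes once and `X²` twice.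
    have h : (3 : ℝ) • (X * Y + Y * X) =
        Λ * (D * Y + X * X + Y * D) - (D * Y + X * X + Y * D) * Λ := by
      rw [mul_add, mul_add, add_mul, add_mul, add_sub_add_comm, add_sub_add_comm, had, had, had, hX,
        hY, hZ]
      simp only [smul_mul_assoc, mul_smul_comm, mul_zero, zero_mul]
      module
    rw [h2, mul_zero, zero_mul, sub_zero] at h
    exact (smul_eq_zero.mp h).resolve_left three_ne_zero
  have h4 : Y * Y = 0 := by
    have h : (4 : ℝ) • (Y * Y) = Λ * (X * Y + Y * X) - (X * Y + Y * X) * Λ := by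
      rw [mul_add, add_mul, add_sub_add_comm, had, had, hY, hZ]
      simp only [smul_mul_assoc, mul_smul_comm, mul_zero, zero_mul]
      module
    rw [h3, mul_zero, zero_mul, sub_zero] at h
    exact (smul_eq_zero.mp h).resolve_left four_ne_zero
  match n with
  | 0 => simpa [hd] using hD
  | 1 => simpa [Finset.sum_range_succ, hd, hX', add_comm] using h1
  | 2 => simpa [Finset.sum_range_succ, hd, hX', hY'] using h2
  | 3 => simpa [Finset.sum_range_succ, hd, hX', hY', h0 0] using h3
  | 4 => simpa [Finset.sum_range_succ, hd, hX', hY', h0 0, h0 1] using h4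
  | n + 5 =>
    -- The indices add up to at least five, so one of them is at least three.
    refine Finset.sum_eq_zero fun i _ => ?_
    rcases le_or_gt 3 i with hi | hi
    · rw [← Nat.sub_add_cancel hi, h0, zero_mul]
    · rw [← Nat.sub_add_cancel (show 3 ≤ n + 5 - i by omega), h0, mul_zero]

end Multicomplex

/-- Each commutator with `Λ`, of order two and degree `-2`, raises the order by one and lowers the
degree by two. As `Λ` is even, the graded commutator is the ordinary one. -/
theorem hasOrderLE_contractionTower {A : Type*} [Ring A] [Algebra ℝ A] {𝒜 : ℤ → Submodule ℝ A}
    (hmul : ∀ j k, ∀ a ∈ 𝒜 j, ∀ b ∈ 𝒜 k, a * b ∈ 𝒜 (j + k))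
    (hcomm : ∀ j k, ∀ a ∈ 𝒜 j, ∀ b ∈ 𝒜 k, a * b = ((-1 : ℝ) ^ (j * k)) • (b * a))
    {D Λ : Module.End ℝ A} (hD : HasOrderLE 𝒜 1 1 D) (hΛ : HasOrderLE 𝒜 2 (-2) Λ) (n : ℕ) :
    HasOrderLE 𝒜 (n + 1) (1 - 2 * n) (contractionTower D Λ n) := by
  have h : ∀ {s : ℕ} {q : ℤ} {g : Module.End ℝ A}, HasOrderLE 𝒜 (s + 1) q g →
      HasOrderLE 𝒜 (s + 2) (q - 2) (Λ * g - g * Λ) := by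
    intro s q g hg
    have h := HasOrderLE.commutator (r := 1) hmul hcomm hΛ hg
    rw [gradedCommutator, Even.neg_one_zpow ((even_two.neg).mul_right q), one_smul] at h
    rwa [show s + 2 = 1 + s + 1 by omega, show q - 2 = -2 + q by omega]
  have h1 := h (s := 0) hD
  match n with
  | 0 => exact hD
  | 1 => exact h1
  | 2 => exact (h (s := 1) h1).smul _
  | n + 3 => exact .zero _ _

open FormFibre

variable {E : Type*} [NormedAddCommGroup E] [NormedSpace ℝ E] [FiniteDimensional ℝ E]
  {M : Type*} [TopologicalSpace M] [ChartedSpace E M] [IsManifold 𝓘(ℝ, E) ∞ M]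

namespace DeRham

variable (E M) in
/-- The exterior derivative on the de Rham algebra. -/
def d : Module.End ℝ (DeRham E M) where
  toFun α := ⟨FormSection.d (α : FormSection E M), FormSection.IsSmooth.d α.2⟩
  map_add' α β := Subtype.ext <| FormSection.IsSmooth.d_add α.2 β.2
  map_smul' r α := Subtype.ext <| FormSection.IsSmooth.d_smul α.2 r

theorem coe_d (α : DeRham E M) :
    (d E M α : FormSection E M) = FormSection.d (α : FormSection E M) := rfl

theorem d_mul_d : d E M * d E M = 0 :=
  LinearMap.ext fun α => Subtype.ext <| FormSection.IsSmooth.d_d α.2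

theorem d_mul (j : ℤ) (α : DeRham E M) (hα : α ∈ DeRham.deg E M j) (β : DeRham E M) :
    d E M (α * β) = d E M α * β + (-1 : ℝ) ^ j • (α * d E M β) :=
  Subtype.ext <| funext fun x => by
    refine (FormSection.IsSmooth.d_mul α.2 β.2 x).trans ?_
    rw [parity_of_mem_deg (hα x), smul_mul_assoc]
    rfl

theorem hasOrderLE_d : HasOrderLE (DeRham.deg E M) 1 1 (d E M) :=
  .of_leibniz (fun _ α hα => FormSection.IsSmooth.d_mem_deg α.2 hα) fun j α hα β => by
    rw [mul_one]; exact d_mul j α hα β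

end DeRham

namespace AlmostSymplectic

variable (S : AlmostSymplectic E M)

/-- The contraction `i_π` on the de Rham algebra. -/
def contract : Module.End ℝ (DeRham E M) :=
  DeRham.fibrewise (fun x => bivector (sharp (S.form x))) fun α hα =>
    (funext (S.contractPoisson_apply α)) ▸ S.isSmooth_contractPoisson hα

theorem coe_contract (α : DeRham E M) :
    (S.contract α : FormSection E M) = S.contractPoisson (α : FormSection E M) :=
  (funext (S.contractPoisson_apply (α : FormSection E M))).symm

theorem hasOrderLE_contract : HasOrderLE (DeRham.deg E M) 2 (-2) S.contract :=
  DeRham.hasOrderLE_of_fibrewise (fun _ _ => rfl) fun _ => hasOrderLE_bivector _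

/-- The operators `Δ n` on the de Rham algebra. -/
def bvOperator : ℕ → Module.End ℝ (DeRham E M) := contractionTower (DeRham.d E M) S.contract

theorem coe_bvOperator_one (α : DeRham E M) : (S.bvOperator 1 α : FormSection E M) =
    S.contractPoisson (FormSection.d (α : FormSection E M)) -
      (S.contractPoisson (α : FormSection E M)).d := by
  rw [← coe_contract, ← DeRham.coe_d, ← DeRham.coe_d, ← coe_contract]
  rfl

theorem coe_bvOperator (n : ℕ) (α : DeRham E M) :
    (S.bvOperator n α : FormSection E M) = S.Δ n (α : FormSection E M) := by
  match n with
  | 0 => rfl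
  | 1 => exact (S.coe_bvOperator_one α).trans (S.dω_add_LamdLω α.2).symm
  | 2 =>
    have h : (S.bvOperator 2 α : FormSection E M) = (1 / 2 : ℝ) •
        (((S.contract (S.bvOperator 1 α) : DeRham E M) : FormSection E M) -
          (S.bvOperator 1 (S.contract α) : FormSection E M)) := rfl
    rw [h, coe_contract, coe_bvOperator_one, coe_bvOperator_one, coe_contract, S.dLω_eq α.2,
      smul_smul]
    norm_num [Δ]
  | n + 3 => rfl

/-- Both operators are symplectic adjoints, up to sign, of products with `ω` and `dω`, which commute
because `ω` has degree two. -/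
theorem contract_mul_bvOperator_two :
    S.contract * S.bvOperator 2 = S.bvOperator 2 * S.contract := by
  refine LinearMap.ext fun α => Subtype.ext <| funext fun x => ?_
  simp only [Module.End.mul_apply, coe_contract, coe_bvOperator, contractPoisson_apply]
  have hs := S.isSharp x
  have h : S.Lam x * S.adjointω x (S.dL x) = S.adjointω x (S.dL x) * S.Lam x := by
    rw [Lam, adjointω_eq, ← adjoint_mul hs.surjective_coForm, ← adjoint_mul hs.surjective_coForm]
    congr 1
    refine LinearMap.ext fun β => ?_
    simp only [L, dL, Module.End.mul_apply, LinearMap.mulLeft_apply, ← mul_assoc,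
      two_comm (S.degree_two x)]
  rw [Lam_eq] at h
  have h1 := LinearMap.congr_fun h ((α : FormSection E M) x)
  simp only [Module.End.mul_apply] at h1
  simp only [Δ, dLω, Pi.neg_apply, map_neg, contractPoisson_apply, h1]

theorem hasOrderLE_bvOperator (n : ℕ) :
    HasOrderLE (DeRham.deg E M) (n + 1) (1 - 2 * n) (S.bvOperator n) :=
  hasOrderLE_contractionTower (𝒜 := DeRham.deg E M) DeRham.mul_mem_deg DeRham.deg_comm DeRham.hasOrderLE_d
    S.hasOrderLE_contract n

theorem isCommBVInfty : IsCommBVInfty (DeRham.deg E M) S.bvOperator where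
  isInternal := DeRham.isInternal
  one_mem _ := one_mem_deg
  mul_mem := DeRham.mul_mem_deg
  graded_comm := DeRham.deg_comm
  leibniz := DeRham.d_mul
  degree n _ _ ha := (S.hasOrderLE_bvOperator n).1 _ _ ha
  multicomplex := contractionTower_multicomplex DeRham.d_mul_d S.contract_mul_bvOperator_two
  order := S.hasOrderLE_bvOperator

variable {S}

theorem LamdLω_of_d_eq_zero (h : S.form.d = 0) (α : FormSection E M) : S.LamdLω α = 0 := by
  funext x
  rw [LamdLω, LamdL, dL, h, adjointω_eq, Pi.zero_apply, LinearMap.mulLeft_zero_eq_zero, mul_zero,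
    zero_mul, sub_zero, adjoint_zero (S.isSharp x).surjective_coForm]
  rfl

theorem dLω_of_d_eq_zero (h : S.form.d = 0) (α : FormSection E M) : S.dLω α = 0 := by
  funext x
  rw [dLω, dL, h, adjointω_eq, Pi.zero_apply, LinearMap.mulLeft_zero_eq_zero,
    adjoint_zero (S.isSharp x).surjective_coForm]
  rfl

theorem d_form_mul {α : FormSection E M} (hα : α.IsSmooth) :
    FormSection.d (S.form * α) - S.form * α.d = S.form.d * α := by
  funext x
  rw [Pi.sub_apply, S.smooth.d_mul hα, parity_of_two (S.degree_two x)]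
  exact add_sub_cancel_right _ _

theorem Δ_eq_koszul (h : S.form.d = 0) {α : FormSection E M} (hα : α.IsSmooth) (n : ℕ) :
    S.Δ n α = S.koszul n α := by
  match n with
  | 0 => rfl
  | 1 => exact S.dω_add_LamdLω hα
  | 2 => exact neg_eq_zero.mpr (dLω_of_d_eq_zero h α)
  | n + 3 => rfl

/-- The form is the only data. Since the Hermitian operators equal those of the underlying almost
symplectic structure, this gives their independence of `J`. -/
theorem ext_form {S S' : AlmostSymplectic E M} (h : S'.form = S.form) : S' = S := by
  cases S; cases S'; congr

end AlmostSymplectic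

end

theorem mainTheorem11
    {E : Type*} [NormedAddCommGroup E] [NormedSpace ℝ E] [FiniteDimensional ℝ E]
    {M : Type*} [TopologicalSpace M] [ChartedSpace E M] [IsManifold 𝓘(ℝ, E) ∞ M]
    (H : AlmostHermitian E M) :
    -- the identities between metric and symplectic adjoints, and `[d, L] = dω ∧ ·`
    (∀ α ∈ DeRham E M,
      H.dcStar α = -H.dω α ∧
      H.dωcStar α = -H.dLω α ∧
      H.TcStar α = -H.LamdLω α ∧
      FormSection.d (H.form * α) - H.form * α.d = H.form.d * α) ∧
    -- both tuples of operators are one and the same commutative `BV_∞`-structure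
    (∃ Δ : ℕ → Module.End ℝ (DeRham E M),
      (∀ n α, (Δ n α : FormSection E M) = H.hermitianΔ n α) ∧
      (∀ n α, (Δ n α : FormSection E M) = H.toAlmostSymplectic.Δ n α) ∧
      IsCommBVInfty (DeRham.deg E M) Δ) ∧
    -- it depends only on `ω`
    (∀ H' : AlmostHermitian E M, H'.form = H.form →
      ∀ n, ∀ α ∈ DeRham E M, H'.hermitianΔ n α = H.hermitianΔ n α) ∧
    -- in the almost Kähler case it is Koszul's `BV`-algebra, with `Δ₁ = [i_π, d] = d^ω`, `Δ₂ = 0`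
    (H.form.d = 0 → ∀ α ∈ DeRham E M,
      H.hermitianΔ 1 α = H.dω α ∧
      H.hermitianΔ 2 α = 0 ∧
      ∀ n, H.hermitianΔ n α = H.toAlmostSymplectic.koszul n α) := by
  refine ⟨fun α hα => ⟨H.dcStar_eq α, H.dωcStar_eq α, H.TcStar_eq α,
    AlmostSymplectic.d_form_mul hα⟩, ⟨H.toAlmostSymplectic.bvOperator, fun n α => ?_,
    H.toAlmostSymplectic.coe_bvOperator, H.toAlmostSymplectic.isCommBVInfty⟩,
    fun H' h n α _ => ?_, fun h α hα => ⟨?_, ?_, fun n => ?_⟩⟩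
  · rw [H.hermitianΔ_eq, AlmostSymplectic.coe_bvOperator]
  · rw [H.hermitianΔ_eq, H'.hermitianΔ_eq, AlmostSymplectic.ext_form h]
  · rw [H.hermitianΔ_eq, ← add_zero (H.dω α), ← AlmostSymplectic.LamdLω_of_d_eq_zero h α]
    rfl
  · rw [H.hermitianΔ_eq]
    exact neg_eq_zero.mpr (AlmostSymplectic.dLω_of_d_eq_zero h α)
  · rw [H.hermitianΔ_eq, AlmostSymplectic.Δ_eq_koszul h hα]
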